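/- Let $N\ge 2$, let $\Omega\subset\mathbb R^N$ be a bounded domain (a nonempty connected open set) with $C^1$ boundary, let $1<q<p<N$, $p^*=Np/(N-p)$, let $g:\mathbb R\to\mathbb R$ be continuous and $G(t)=\int_0^t g(\tau)\,d\tau$. Let $u\in W^{1,p}_0(\Omega)\cap W^{2,p}(\Omega)$ be a weak solution of $$-\Delta_p u-\Delta_q u=g(u)\ \text{ in }\Omega,\qquad u=0\ \text{ on }\partial\Omega,$$ that is, for every $v\in W^{1,p}_0(\Omega)$ the function $g(u)\,v$ is integrable on $\Omega$ and $$\int_\Omega\left(|\nabla u|^{p-2}\nabla u\cdot\nabla v+|\nabla u|^{q-2}\nabla u\cdot\nabla v-g(u)\,v\right)dx=0 .$$ Let $\nu$ be the exterior unit normal to $\partial\Omega$, $\sigma$ the surface measure on $\partial\Omega$, and $\partial u/\partial\nu=\nabla u\cdot\nu$ on $\partial\Omega$ in the sense of traces. Then $|\nabla u|^q$, $G(u)$ and $u\,g(u)$ are integrable on $\Omega$, the trace of $\nabla u$ on $\partial\Omega$ exists, the boundary integrand below is $\sigma$-integrable, and $$\left(\frac1q-\frac1p\right)\int_\Omega|\nabla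 u|^q\,dx-\int_\Omega\left[G(u)-\frac1{p^*}\,u\,g(u)\right]dx+\frac1N\int_{\partial\Omega}\left[\left(1-\frac1p\right)\left|\frac{\partial u}{\partial\nu}\right|^p+\left(1-\frac1q\right)\left|\frac{\partial u}{\partial\nu}\right|^q\right](x\cdot\nu)\,d\sigma=0 .$$ -/

import Mathlib

open MeasureTheory Set Filter Topology
open scoped ENNReal ContDiff

/-- Test functions on `Ω`: the elements of `C_c^∞(Ω)`, extended by zero to the whole space. -/
def IsTestFunction {N : ℕ} (Ω : Set (EuclideanSpace ℝ (Fin N)))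
    (φ : EuclideanSpace ℝ (Fin N) → ℝ) : Prop :=
  ContDiff ℝ ∞ φ ∧ HasCompactSupport φ ∧ tsupport φ ⊆ Ω

/-- `Dv` is the weak (distributional) gradient of `v` on the open set `Ω`. -/
def IsWeakGradient {N : ℕ} (Ω : Set (EuclideanSpace ℝ (Fin N)))
    (v : EuclideanSpace ℝ (Fin N) → ℝ)
    (Dv : EuclideanSpace ℝ (Fin N) → EuclideanSpace ℝ (Fin N)) : Prop :=
  LocallyIntegrableOn v Ω ∧ LocallyIntegrableOn Dv Ω ∧
    ∀ φ : EuclideanSpace ℝ (Fin N) → ℝ, IsTestFunction Ω φ →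
      ∀ i : Fin N, ∫ x in Ω, v x * gradient φ x i = - ∫ x in Ω, Dv x i * φ x

/-- `v ∈ W^{1,p}(Ω)`, with weak gradient `Dv`. -/
def MemW1 {N : ℕ} (Ω : Set (EuclideanSpace ℝ (Fin N))) (p : ℝ≥0∞)
    (v : EuclideanSpace ℝ (Fin N) → ℝ)
    (Dv : EuclideanSpace ℝ (Fin N) → EuclideanSpace ℝ (Fin N)) : Prop :=
  MemLp v p (volume.restrict Ω) ∧ MemLp Dv p (volume.restrict Ω) ∧ IsWeakGradient Ω v Dv

/-- `v ∈ W^{1,p}_0(Ω)`, with weak gradient `Dv`: `v` lies in the closure of `C_c^∞(Ω)`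
in `W^{1,p}(Ω)`. -/
def MemW1Zero {N : ℕ} (Ω : Set (EuclideanSpace ℝ (Fin N))) (p : ℝ≥0∞)
    (v : EuclideanSpace ℝ (Fin N) → ℝ)
    (Dv : EuclideanSpace ℝ (Fin N) → EuclideanSpace ℝ (Fin N)) : Prop :=
  MemW1 Ω p v Dv ∧
    ∃ φ : ℕ → EuclideanSpace ℝ (Fin N) → ℝ, (∀ n, IsTestFunction Ω (φ n)) ∧
      Tendsto (fun n => eLpNorm (fun x => φ n x - v x) p (volume.restrict Ω)) atTop (𝓝 0) ∧
      Tendsto (fun n => eLpNorm (fun x => gradient (φ n) x - Dv x) p (volume.restrict Ω))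
        atTop (𝓝 0)

/-- `v ∈ W^{2,p}(Ω)`: `v ∈ W^{1,p}(Ω)` and every first-order weak partial derivative of `v`
lies in `W^{1,p}(Ω)`. -/
def MemW2 {N : ℕ} (Ω : Set (EuclideanSpace ℝ (Fin N))) (p : ℝ≥0∞)
    (v : EuclideanSpace ℝ (Fin N) → ℝ) : Prop :=
  ∃ Dv : EuclideanSpace ℝ (Fin N) → EuclideanSpace ℝ (Fin N), MemW1 Ω p v Dv ∧
    ∀ i : Fin N, ∃ H : EuclideanSpace ℝ (Fin N) → EuclideanSpace ℝ (Fin N),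
      MemW1 Ω p (fun x => Dv x i) H

/-- `Ω` has `C^1` boundary: near each boundary point, in suitable orthonormal coordinates whose
last direction is the unit vector `e`, the set `Ω` is the region strictly below the graph of a
`C^1` function `γ` of the orthogonal projection of the point onto `e^⊥`. -/
def HasC1Boundary {N : ℕ} (Ω : Set (EuclideanSpace ℝ (Fin N))) : Prop :=
  ∀ x₀ ∈ frontier Ω, ∃ (r : ℝ) (e : EuclideanSpace ℝ (Fin N))
      (γ : EuclideanSpace ℝ (Fin N) → ℝ),
    0 < r ∧ ‖e‖ = 1 ∧ ContDiff ℝ 1 γ ∧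
      ∀ x ∈ Metric.ball x₀ r, (x ∈ Ω ↔ inner ℝ e x < γ (x - inner ℝ e x • e))

/-- `n` is an exterior unit normal of `Ω` at `x`: a unit vector such that every ray from `x`
making an obtuse angle with `n` starts inside `Ω`, and every ray making an acute angle with `n`
starts outside `Ω`. -/
def IsExteriorUnitNormal {N : ℕ} (Ω : Set (EuclideanSpace ℝ (Fin N)))
    (x n : EuclideanSpace ℝ (Fin N)) : Prop :=
  ‖n‖ = 1 ∧
    (∀ w : EuclideanSpace ℝ (Fin N), inner ℝ w n < 0 → ∀ᶠ t in 𝓝[>] (0 : ℝ), x + t • w ∈ Ω) ∧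
    (∀ w : EuclideanSpace ℝ (Fin N), 0 < inner ℝ w n → ∀ᶠ t in 𝓝[>] (0 : ℝ), x + t • w ∉ Ω)

/-- There is at most one exterior unit normal at a point. -/
theorem IsExteriorUnitNormal.unique {N : ℕ} {Ω : Set (EuclideanSpace ℝ (Fin N))}
    {x n m : EuclideanSpace ℝ (Fin N)} (hn : IsExteriorUnitNormal Ω x n)
    (hm : IsExteriorUnitNormal Ω x m) : n = m := by
  by_contra hne
  have h0 : inner ℝ n m ≤ 1 := by
    have h := real_inner_le_norm n m
    rwa [hn.1, hm.1, mul_one] at h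
  have h1 : inner ℝ n m < 1 :=
    lt_of_le_of_ne h0 fun h =>
      hne ((inner_eq_one_iff_of_norm_eq_one (𝕜 := ℝ) hn.1 hm.1).1 h)
  have h2 := hn.2.1 (m - n) (by
    rw [inner_sub_left, real_inner_self_eq_norm_sq, hn.1, real_inner_comm]; linarith)
  have h3 := hm.2.2 (m - n) (by
    rw [inner_sub_left, real_inner_self_eq_norm_sq, hm.1]; linarith)
  obtain ⟨t, h4, h5⟩ := (h2.and h3).exists
  exact h5 h4

/-- The exterior unit normal `ν(x)` of `Ω` at `x` (an arbitrary vector where there is none). -/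
noncomputable def exteriorNormal {N : ℕ} (Ω : Set (EuclideanSpace ℝ (Fin N)))
    (x : EuclideanSpace ℝ (Fin N)) : EuclideanSpace ℝ (Fin N) :=
  Classical.epsilon (IsExteriorUnitNormal Ω x)

/-- The surface measure `dσ` on `∂Ω`: the `(N-1)`-dimensional Hausdorff measure, normalized to
agree with Lebesgue measure in dimension `N - 1`, restricted to `∂Ω`. -/
noncomputable def surfaceMeasure {N : ℕ} (Ω : Set (EuclideanSpace ℝ (Fin N))) :
    Measure (EuclideanSpace ℝ (Fin N)) :=
  (Measure.euclideanHausdorffMeasure (N - 1)).restrict (frontier Ω)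

/-- `T` is the boundary trace of `v ∈ W^{1,p}(Ω)`: the limit in `L^p(∂Ω, dσ)` of the boundary
values of functions that are smooth up to the boundary and converge to `v` in `W^{1,p}(Ω)`. -/
def IsTrace {N : ℕ} (Ω : Set (EuclideanSpace ℝ (Fin N))) (p : ℝ≥0∞)
    (v T : EuclideanSpace ℝ (Fin N) → ℝ) : Prop :=
  MemLp T p (surfaceMeasure Ω) ∧
    ∃ Dv : EuclideanSpace ℝ (Fin N) → EuclideanSpace ℝ (Fin N), MemW1 Ω p v Dv ∧
      ∃ φ : ℕ → EuclideanSpace ℝ (Fin N) → ℝ, (∀ n, ContDiff ℝ ∞ (φ n)) ∧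
        Tendsto (fun n => eLpNorm (fun x => φ n x - v x) p (volume.restrict Ω)) atTop (𝓝 0) ∧
        Tendsto (fun n => eLpNorm (fun x => gradient (φ n) x - Dv x) p (volume.restrict Ω))
          atTop (𝓝 0) ∧
        Tendsto (fun n => eLpNorm (fun x => φ n x - T x) p (surfaceMeasure Ω)) atTop (𝓝 0)

/-- `h` is the normal derivative `∂u/∂ν` on `∂Ω` of a function with weak gradient `Du`: the
inner product of the trace of `Du` (taken componentwise) with the exterior unit normal. -/
def IsNormalDerivative {N : ℕ} (Ω : Set (EuclideanSpace ℝ (Fin N))) (p : ℝ≥0∞)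
    (Du : EuclideanSpace ℝ (Fin N) → EuclideanSpace ℝ (Fin N))
    (h : EuclideanSpace ℝ (Fin N) → ℝ) : Prop :=
  ∃ D : EuclideanSpace ℝ (Fin N) → EuclideanSpace ℝ (Fin N),
    (∀ i : Fin N, IsTrace Ω p (fun x => Du x i) (fun x => D x i)) ∧
      ∀ᵐ x ∂(surfaceMeasure Ω), h x = inner ℝ (D x) (exteriorNormal Ω x)

/-- `u`, with weak gradient `Du`, is a weak solution of `-Δ_p u - Δ_q u = g(u)` in `Ω`, `u = 0`
on `∂Ω`: `u ∈ W^{1,p}_0(Ω)` and the weak formulation, including the integrability of `g(u) v`,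
holds for every `v ∈ W^{1,p}_0(Ω)`. (The other two terms are integrable by Hölder's inequality,
as `q < p` and `Ω` is bounded.) -/
def IsWeakSolution {N : ℕ} (Ω : Set (EuclideanSpace ℝ (Fin N))) (p q : ℝ) (g : ℝ → ℝ)
    (u : EuclideanSpace ℝ (Fin N) → ℝ)
    (Du : EuclideanSpace ℝ (Fin N) → EuclideanSpace ℝ (Fin N)) : Prop :=
  MemW1Zero Ω (ENNReal.ofReal p) u Du ∧
    ∀ (v : EuclideanSpace ℝ (Fin N) → ℝ)
      (Dv : EuclideanSpace ℝ (Fin N) → EuclideanSpace ℝ (Fin N)),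
      MemW1Zero Ω (ENNReal.ofReal p) v Dv →
        IntegrableOn (fun x => g (u x) * v x) Ω ∧
        ∫ x in Ω, (‖Du x‖ ^ (p - 2) * inner ℝ (Du x) (Dv x)
          + ‖Du x‖ ^ (q - 2) * inner ℝ (Du x) (Dv x) - g (u x) * v x) = 0

/-- The primitive `G(t) = ∫₀ᵗ g(τ) dτ`. -/
noncomputable def primitive (g : ℝ → ℝ) (t : ℝ) : ℝ := ∫ τ in (0 : ℝ)..t, g τ

/-- The critical Sobolev exponent `p* = Np/(N - p)`. -/
noncomputable def criticalExponent (N : ℕ) (p : ℝ) : ℝ := N * p / (N - p)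

/-! Write V = ∇u and consider the Pohozaev tensor T = (|V|^{p-2} + |V|^{q-2}) V ⊗ V - (|V|^p/p +
|V|^q/q) I. The equation says that div T = -g(u) V. Contract this with the position x and integrate
by parts over Ω. The interior terms are multiples of ∫|V|^p and ∫|V|^q. The source term becomes N ∫
G(u), because g(u) ∇u = ∇(G(u)) and u vanishes on ∂Ω. As u = 0 on ∂Ω, the trace of V is h ν with h =
∂u/∂ν, so T ν · x is the boundary integrand of the theorem. Testing the equation with u itself
expresses ∫|V|^p through ∫|V|^q and ∫ u g(u); dividing by N and using 1/p* = 1/p - 1/N gives the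
formula.

The work lies in justifying this for u in W^{2,p} only, with no growth condition on g. For exponents
below 2 the flux |ξ|^{s-2} ξ is not C^1, so the equation cannot be differentiated or read pointwise.
The entries of T, however, are C^1 functions of V for all exponents above 1 (`contDiff_stress`), and
their derivatives grow at most like |V|^{p-1}. Hence T lies in W^{1,1} and satisfies Gauss-Green
with the trace of V as boundary value (`HasC1Boundary.integral_nonlinear_gaussGreen`). The formula
for div T comes from testing the weak equation with φ ∂_i u, where φ is a test function; symmetry of
the Hessian turns the result into the divergence of T (`IsWeakSolution.pohozaevDiv_eq`). As div T is
integrable, so is g(u) ∇u, and this is all that is known about g(u). It suffices for the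
integrability of G(u) and for N ∫ G(u) = -∫ g(u) ∇u · x, by truncation and Fatou's lemma
(`MemW1Zero.integral_primitive`).

That the trace of the gradient is normal (`HasC1Boundary.trace_gradient_eq_smul`) follows from
comparing Gauss-Green for ∂_i u in direction j with that for ∂_j u in direction i: the interior
integrals agree, so D_i ν_j = D_j ν_i on ∂Ω.

The remaining groundwork is the area formula for graphs, Gauss-Green for C^1 functions on C^1
domains, density of functions smooth up to the boundary in W^{1,p}, and the trace inequality. -/

/-! ### Area formula for injective C^1 immersions. -/

section AreaFormula

/-- A measure which is locally bounded by every multiple `C > 1` of `ν` is bounded by `ν`. -/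
theorem measure_le_of_locally_le {X : Type*} [TopologicalSpace X] [SecondCountableTopology X]
    [MeasurableSpace X] [OpensMeasurableSpace X] {μ ν : Measure X}
    (h : ∀ C : NNReal, 1 < C → ∀ x, ∃ U ∈ 𝓝 x, ∀ A ⊆ U, MeasurableSet A → μ A ≤ C * ν A) :
    μ ≤ ν := by
  refine Measure.le_iff.2 fun A hA => ?_
  -- For fixed C, a countable subcover by good neighbourhoods is made disjoint and the local bounds
  -- are added up.
  have key : ∀ C : NNReal, 1 < C → μ A ≤ C * ν A := by
    intro C hC
    choose U hU hUA using h C hC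
    obtain ⟨s, hs, hcov⟩ := TopologicalSpace.countable_cover_nhds
      (f := fun x => interior (U x)) fun x => interior_mem_nhds.2 (hU x)
    have := hs.to_subtype
    rcases isEmpty_or_nonempty s with he | hne
    · have : A = ∅ := by
        rw [eq_empty_iff_forall_notMem]
        intro x _
        have : x ∈ ⋃ y ∈ s, interior (U y) := by rw [hcov]; trivial
        simp only [mem_iUnion] at this
        obtain ⟨y, hy, -⟩ := this
        exact he.elim ⟨y, hy⟩
      simp [this]
    obtain ⟨f, hf⟩ := exists_surjective_nat s
    let V : ℕ → Set X := fun n => interior (U (f n))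
    have hV : ∀ n, MeasurableSet (V n) := fun n => isOpen_interior.measurableSet
    have hcovV : ⋃ n, disjointed V n = univ := by
      rw [iUnion_disjointed, eq_univ_iff_forall]
      intro x
      have : x ∈ ⋃ y ∈ s, interior (U y) := by rw [hcov]; trivial
      simp only [mem_iUnion] at this
      obtain ⟨y, hy, hxy⟩ := this
      obtain ⟨n, hn⟩ := hf ⟨y, hy⟩
      exact mem_iUnion.2 ⟨n, by simpa [V, hn] using hxy⟩
    have hAV : ⋃ n, A ∩ disjointed V n = A := by rw [← inter_iUnion, hcovV, inter_univ]
    have hm : ∀ n, MeasurableSet (A ∩ disjointed V n) := fun n =>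
      hA.inter (MeasurableSet.disjointed hV n)
    have hd : Pairwise (Function.onFun Disjoint fun n => A ∩ disjointed V n) := fun i j hij =>
      (disjoint_disjointed V hij).mono inter_subset_right inter_subset_right
    calc μ A = ∑' n, μ (A ∩ disjointed V n) := by rw [← measure_iUnion hd hm, hAV]
      _ ≤ ∑' n, C * ν (A ∩ disjointed V n) := by
        refine ENNReal.tsum_le_tsum fun n => hUA (f n) _ ?_ (hm n)
        exact inter_subset_right.trans ((disjointed_subset V n).trans interior_subset)
      _ = C * ν A := by rw [ENNReal.tsum_mul_left, ← measure_iUnion hd hm, hAV]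
  by_contra hlt
  push Not at hlt
  have hν : ν A ≠ ⊤ := ne_top_of_lt hlt
  -- Now C decreases to 1. Multiplication by `ν A` is continuous there because `ν A` is finite.
  have ht : Tendsto (fun C : NNReal => (C : ℝ≥0∞) * ν A) (𝓝[>] 1) (𝓝 ((1 : NNReal) * ν A)) := by
    refine Tendsto.mono_left ?_ nhdsWithin_le_nhds
    exact ENNReal.Tendsto.mul_const (ENNReal.tendsto_coe.2 tendsto_id) (Or.inr hν)
  have := ge_of_tendsto ht (eventually_nhdsWithin_of_forall fun C hC => key C hC)
  simp only [ENNReal.coe_one, one_mul] at this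
  exact absurd this (not_le.2 hlt)

/-- The normalizing factor of `μHE[d]` depends on d alone, so the bound for the unnormalized
Hausdorff measure carries over. -/
theorem euclideanHausdorffMeasure_image_le_of_lipschitzOnWith {X Y : Type*}
    [EMetricSpace X] [EMetricSpace Y] [MeasurableSpace X] [BorelSpace X]
    [MeasurableSpace Y] [BorelSpace Y] {κ : NNReal} {f : X → Y} {s : Set X}
    (h : LipschitzOnWith κ f s) (d : ℕ) : μHE[d] (f '' s) ≤ (κ : ℝ≥0∞) ^ d * μHE[d] s := by
  have := h.hausdorffMeasure_image_le (d := d) (Nat.cast_nonneg d)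
  simp only [Measure.euclideanHausdorffMeasure_def, Measure.smul_apply, ENNReal.smul_def,
    smul_eq_mul] at this ⊢
  rw [mul_left_comm]
  gcongr
  simpa using this

variable {K E : Type*} [NormedAddCommGroup K] [InnerProductSpace ℝ K] [FiniteDimensional ℝ K]
  [MeasurableSpace K] [BorelSpace K] [NormedAddCommGroup E] [InnerProductSpace ℝ E]
  [MeasurableSpace E] [BorelSpace E]

/-- Near a point `y`, a map which is strictly differentiable at `y` distorts the Hausdorff measure
by nearly the Jacobian of its derivative. -/
theorem exists_nhds_euclideanHausdorffMeasure_image_le {Φ : K → E} {Φ' : K →L[ℝ] E}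
    {M : K ≃L[ℝ] K} {y : K} (hΦ : HasStrictFDerivAt Φ Φ' y) (hM : ∀ v, ‖M v‖ = ‖Φ' v‖)
    {κ : NNReal} (hκ : 1 < κ) :
    ∃ U ∈ 𝓝 y, ∀ A ⊆ U,
      μHE[Module.finrank ℝ K] (Φ '' A)
        ≤ (κ : ℝ≥0∞) ^ Module.finrank ℝ K
          * (ENNReal.ofReal |(M : K →L[ℝ] K).det| * volume A) ∧
      ENNReal.ofReal |(M : K →L[ℝ] K).det| * volume A
        ≤ (κ : ℝ≥0∞) ^ Module.finrank ℝ K * μHE[Module.finrank ℝ K] (Φ '' A) := by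
  have hκ' : (1 : ℝ) < κ := by exact_mod_cast hκ
  -- This δ satisfies both 1 + δ ≤ κ and (1 - δ)⁻¹ = κ, the two Lipschitz constants needed below.
  set δ : ℝ := 1 - 1 / κ with hδ
  have hδ0 : 0 < δ := by rw [hδ, sub_pos, div_lt_one (by linarith)]; exact hκ'
  have hδκ : 1 + δ ≤ κ := by
    have h1 : (κ : ℝ) * (1 / κ) = 1 := by field_simp
    have h2 : 0 < 1 / (κ : ℝ) := by positivity
    rw [hδ]
    nlinarith [sq_nonneg ((κ : ℝ) - 1)]
  have hδκ' : (κ : ℝ) * (1 - δ) = 1 := by rw [hδ]; field_simp; ring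
  set m : ℝ := ‖(M.symm : K →L[ℝ] K)‖ + 1 with hm
  have hm0 : 0 < m := by positivity
  have hMle : ∀ v, ‖v‖ ≤ m * ‖M v‖ := by
    intro v
    have := (M.symm : K →L[ℝ] K).le_opNorm (M v)
    simp only [ContinuousLinearEquiv.coe_coe, ContinuousLinearEquiv.symm_apply_apply] at this
    nlinarith [norm_nonneg (M v)]
  have hlittle := hΦ.isLittleO.def (c := δ / m) (by positivity)
  rw [nhds_prod_eq] at hlittle
  obtain ⟨U, hU, hUs⟩ := Filter.eventually_prod_self_iff'.1 hlittle
  -- Strict differentiability compares all pairs in U. Measuring the error by ‖M (a - b)‖ = ‖Φ' (a -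
  -- b)‖ makes Φ ∘ M⁻¹ and its inverse Lipschitz with constant κ.
  have hmain : ∀ a ∈ U, ∀ b ∈ U, ‖Φ a - Φ b - Φ' (a - b)‖ ≤ δ * ‖M (a - b)‖ := by
    intro a ha b hb
    refine (hUs a ha b hb).trans ?_
    calc δ / m * ‖a - b‖ ≤ δ / m * (m * ‖M (a - b)‖) := by gcongr; exact hMle _
      _ = δ * ‖M (a - b)‖ := by field_simp
  refine ⟨U, hU, fun A hA => ?_⟩
  have hvol : μHE[Module.finrank ℝ K] (M '' A)
      = ENNReal.ofReal |(M : K →L[ℝ] K).det| * volume A := by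
    rw [InnerProductSpace.euclideanHausdorffMeasure_eq_volume]
    exact Measure.addHaar_image_continuousLinearMap volume (M : K →L[ℝ] K) A
  rw [← hvol]
  have hsub : ∀ a b, M a - M b = M (a - b) := fun a b => (map_sub M a b).symm
  constructor
  · have : Φ '' A = (fun z => Φ (M.symm z)) '' (M '' A) := by
      rw [image_image]; simp
    rw [this]
    refine euclideanHausdorffMeasure_image_le_of_lipschitzOnWith ?_ _
    refine LipschitzOnWith.of_dist_le_mul ?_
    rintro _ ⟨a, ha, rfl⟩ _ ⟨b, hb, rfl⟩
    simp only [ContinuousLinearEquiv.symm_apply_apply, dist_eq_norm, hsub]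
    have h1 := hmain a (hA ha) b (hA hb)
    have h2 : ‖Φ a - Φ b‖ ≤ ‖Φ a - Φ b - Φ' (a - b)‖ + ‖Φ' (a - b)‖ := by
      simpa using norm_add_le (Φ a - Φ b - Φ' (a - b)) (Φ' (a - b))
    rw [← hM] at h2
    nlinarith [norm_nonneg (M (a - b))]
  · have hlow : ∀ a ∈ A, ∀ b ∈ A, ‖M (a - b)‖ ≤ κ * ‖Φ a - Φ b‖ := by
      intro a ha b hb
      have h1 := hmain a (hA ha) b (hA hb)
      have h2 : ‖Φ' (a - b)‖ ≤ ‖Φ a - Φ b‖ + ‖Φ a - Φ b - Φ' (a - b)‖ := by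
        simpa using norm_sub_le (Φ a - Φ b) (Φ a - Φ b - Φ' (a - b))
      rw [← hM] at h2
      have h3 : (1 - δ) * ‖M (a - b)‖ ≤ ‖Φ a - Φ b‖ := by linarith
      calc ‖M (a - b)‖ = κ * ((1 - δ) * ‖M (a - b)‖) := by rw [← mul_assoc, hδκ', one_mul]
        _ ≤ κ * ‖Φ a - Φ b‖ := by gcongr
    have hinj : InjOn Φ A := by
      intro a ha b hb hab
      have := hlow a ha b hb
      rw [hab, sub_self, norm_zero, mul_zero] at this
      have h0 : M (a - b) = 0 := norm_le_zero_iff.1 this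
      exact sub_eq_zero.1 ((map_eq_zero_iff M M.injective).1 h0)
    rcases isEmpty_or_nonempty K with hK | hK
    · simp [Subsingleton.elim A ∅]
    have : M '' A = (fun z => M (Function.invFunOn Φ A z)) '' (Φ '' A) := by
      rw [image_image]
      refine image_congr fun a ha => ?_
      rw [hinj.leftInvOn_invFunOn ha]
    rw [this]
    refine euclideanHausdorffMeasure_image_le_of_lipschitzOnWith ?_ _
    refine LipschitzOnWith.of_dist_le_mul ?_
    rintro _ ⟨a, ha, rfl⟩ _ ⟨b, hb, rfl⟩
    simp only [hinj.leftInvOn_invFunOn ha, hinj.leftInvOn_invFunOn hb, dist_eq_norm, hsub]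
    exact hlow a ha b hb

/-- **Area formula** for an injective `C^1` immersion, with the Jacobian written as `|det (M y)|`
for an endomorphism `M y` of the domain such that `‖M y v‖ = ‖Φ' y v‖`. -/
theorem comap_euclideanHausdorffMeasure_eq_withDensity {Φ : K → E} {Φ' : K → K →L[ℝ] E}
    {M : K → K ≃L[ℝ] K} (hΦ : ∀ y, HasStrictFDerivAt Φ (Φ' y) y)
    (hM : ∀ y v, ‖M y v‖ = ‖Φ' y v‖) (hemb : MeasurableEmbedding Φ)
    (hdet : Continuous fun y => (M y : K →L[ℝ] K).det) :
    (μHE[Module.finrank ℝ K]).comap Φ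
      = volume.withDensity fun y => ENNReal.ofReal |(M y : K →L[ℝ] K).det| := by
  have hJm : Measurable fun y => ENNReal.ofReal |(M y : K →L[ℝ] K).det| :=
    ENNReal.measurable_ofReal.comp hdet.abs.measurable
  have local_cmp : ∀ C : NNReal, 1 < C → ∀ y, ∃ U ∈ 𝓝 y, ∀ A ⊆ U, MeasurableSet A →
      (μHE[Module.finrank ℝ K]).comap Φ A
        ≤ C * (volume.withDensity fun y => ENNReal.ofReal |(M y : K →L[ℝ] K).det|) A ∧
      (volume.withDensity fun y => ENNReal.ofReal |(M y : K →L[ℝ] K).det|) A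
        ≤ C * (μHE[Module.finrank ℝ K]).comap Φ A := by
    intro C hC y
    -- One factor κ per dimension pays for the distortion of the Hausdorff measure, and one more for
    -- the oscillation of the Jacobian near y.
    obtain ⟨κ, hκ, hκC⟩ : ∃ κ : NNReal, 1 < κ ∧ κ ^ (Module.finrank ℝ K + 1) ≤ C := by
      have hcont : Tendsto (fun κ : NNReal => κ ^ (Module.finrank ℝ K + 1)) (𝓝[>] 1)
          (𝓝 (1 ^ (Module.finrank ℝ K + 1))) :=
        ((continuous_pow _).tendsto 1).mono_left nhdsWithin_le_nhds
      rw [one_pow] at hcont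
      obtain ⟨κ, h1, h2⟩ := ((hcont.eventually (ge_mem_nhds hC)).and self_mem_nhdsWithin).exists
      exact ⟨κ, h2, h1⟩
    have hκ' : (1 : ℝ) < κ := by exact_mod_cast hκ
    have hdet0 : 0 < |(M y : K →L[ℝ] K).det| := by
      rw [abs_pos]; exact (LinearEquiv.isUnit_det' (M y).toLinearEquiv).ne_zero
    obtain ⟨U, hU, hUA⟩ := exists_nhds_euclideanHausdorffMeasure_image_le (hΦ y) (hM y) hκ
    have hnear : ∀ᶠ z in 𝓝 y, |(M z : K →L[ℝ] K).det| ≤ κ * |(M y : K →L[ℝ] K).det| ∧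
        |(M y : K →L[ℝ] K).det| ≤ κ * |(M z : K →L[ℝ] K).det| := by
      have hc : Tendsto (fun z => |(M z : K →L[ℝ] K).det|) (𝓝 y)
        (𝓝 |(M y : K →L[ℝ] K).det|) := hdet.abs.tendsto y
      refine (hc.eventually (ge_mem_nhds ?_)).and
        ((hc.const_mul (κ : ℝ)).eventually (le_mem_nhds ?_)) <;> nlinarith
    refine ⟨U ∩ {z | _}, inter_mem hU hnear, fun A hA hAm => ?_⟩
    obtain ⟨h1, h2⟩ := hUA A (hA.trans inter_subset_left)
    rw [hemb.comap_apply, withDensity_apply _ hAm]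
    have e1 : ∫⁻ z in A, ENNReal.ofReal |(M z : K →L[ℝ] K).det|
        ≤ κ * (ENNReal.ofReal |(M y : K →L[ℝ] K).det| * volume A) := by
      rw [← mul_assoc, ← setLIntegral_const]
      refine setLIntegral_mono' hAm fun z hz => ?_
      rw [← ENNReal.ofReal_coe_nnreal, ← ENNReal.ofReal_mul (by positivity)]
      exact ENNReal.ofReal_le_ofReal (hA hz).2.1
    have e2 : ENNReal.ofReal |(M y : K →L[ℝ] K).det| * volume A
        ≤ κ * ∫⁻ z in A, ENNReal.ofReal |(M z : K →L[ℝ] K).det| := by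
      rw [← setLIntegral_const, ← lintegral_const_mul _ hJm]
      refine setLIntegral_mono' hAm fun z hz => ?_
      rw [← ENNReal.ofReal_coe_nnreal, ← ENNReal.ofReal_mul (by positivity)]
      exact ENNReal.ofReal_le_ofReal (hA hz).2.2
    have hpow : (κ : ℝ≥0∞) ^ Module.finrank ℝ K * κ ≤ C := by
      rw [← pow_succ]; exact_mod_cast hκC
    constructor
    · calc μHE[Module.finrank ℝ K] (Φ '' A) ≤ _ := h1
        _ ≤ (κ : ℝ≥0∞) ^ Module.finrank ℝ K
            * (κ * ∫⁻ z in A, ENNReal.ofReal |(M z : K →L[ℝ] K).det|) := by gcongr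
        _ ≤ _ := by rw [← mul_assoc]; gcongr
    · calc _ ≤ _ := e1
        _ ≤ κ * ((κ : ℝ≥0∞) ^ Module.finrank ℝ K * μHE[Module.finrank ℝ K] (Φ '' A)) := by
          gcongr
        _ ≤ _ := by rw [← mul_assoc, mul_comm (κ : ℝ≥0∞)]; gcongr
  refine le_antisymm (measure_le_of_locally_le fun C hC y => ?_)
    (measure_le_of_locally_le fun C hC y => ?_)
  · obtain ⟨U, hU, h⟩ := local_cmp C hC y
    exact ⟨U, hU, fun A hA hAm => (h A hA hAm).1⟩
  · obtain ⟨U, hU, h⟩ := local_cmp C hC y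
    exact ⟨U, hU, fun A hA hAm => (h A hA hAm).2⟩

end AreaFormula

/-! ### Coordinates adapted to a graph, and integration by parts below it. -/

section Graph

variable {E : Type*} [NormedAddCommGroup E] [InnerProductSpace ℝ E]

/-- The function whose zero set is the graph of `γ` over `e^⊥`, and which is negative strictly
below that graph. -/
noncomputable def graphDefining (e : E) (γ : E → ℝ) (x : E) : ℝ :=
  inner ℝ e x - γ (x - inner ℝ e x • e)

/-- Orthogonal projection to `e^⊥`, for a unit vector `e`. -/
noncomputable def perpProj {e : E} (he : ‖e‖ = 1) : E →L[ℝ] (ℝ ∙ e)ᗮ :=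
  (ContinuousLinearMap.id ℝ E - (innerSL ℝ e).smulRight e).codRestrict _ fun x => by
    rw [Submodule.mem_orthogonal_singleton_iff_inner_right]
    simp [inner_sub_right, inner_smul_right, he]

@[simp]
theorem coe_perpProj {e : E} (he : ‖e‖ = 1) (x : E) :
    (perpProj he x : E) = x - inner ℝ e x • e := by
  simp [perpProj]

theorem inner_coe_perp {e : E} (y : (ℝ ∙ e)ᗮ) : inner ℝ e (y : E) = 0 :=
  Submodule.mem_orthogonal_singleton_iff_inner_right.1 y.2

/-- Coordinates on `E` adapted to the graph of `γ` over `e^⊥`. -/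
noncomputable def graphHomeo {e : E} (he : ‖e‖ = 1) {γ : E → ℝ} (hγ : Continuous γ) :
    (ℝ ∙ e)ᗮ × ℝ ≃ₜ E where
  toFun z := (z.1 : E) + (γ z.1 + z.2) • e
  invFun x := (perpProj he x, graphDefining e γ x)
  left_inv z := by
    have h := inner_coe_perp z.1
    refine Prod.ext (Subtype.ext ?_) ?_ <;>
      simp [graphDefining, inner_add_right, inner_smul_right, h, he]
  right_inv x := by simp [graphDefining]
  continuous_toFun := by fun_prop
  continuous_invFun := by unfold graphDefining; fun_prop

theorem graphHomeo_apply {e : E} (he : ‖e‖ = 1) {γ : E → ℝ} (hγ : Continuous γ)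
    (z : (ℝ ∙ e)ᗮ × ℝ) : graphHomeo he hγ z = (z.1 : E) + (γ z.1 + z.2) • e := rfl

theorem graphHomeo_symm_apply {e : E} (he : ‖e‖ = 1) {γ : E → ℝ} (hγ : Continuous γ) (x : E) :
    (graphHomeo he hγ).symm x = (perpProj he x, graphDefining e γ x) := rfl

theorem graphDefining_graphHomeo {e : E} (he : ‖e‖ = 1) {γ : E → ℝ} (hγ : Continuous γ)
    (z : (ℝ ∙ e)ᗮ × ℝ) : graphDefining e γ (graphHomeo he hγ z) = z.2 :=
  congrArg Prod.snd ((graphHomeo he hγ).symm_apply_apply z)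

theorem contDiff_graphDefining {e : E} {γ : E → ℝ} (hγ : ContDiff ℝ 1 γ) :
    ContDiff ℝ 1 (graphDefining e γ) := by
  unfold graphDefining
  have : ContDiff ℝ 1 fun x : E => inner ℝ e x := contDiff_const.inner ℝ contDiff_id
  exact this.sub (hγ.comp (contDiff_id.sub (this.smul contDiff_const)))

theorem fderiv_graphDefining {e : E} {γ : E → ℝ} (hγ : ContDiff ℝ 1 γ) (x w : E) :
    fderiv ℝ (graphDefining e γ) x w
      = inner ℝ e w - fderiv ℝ γ (x - inner ℝ e x • e) (w - inner ℝ e w • e) := by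
  have h1 : HasFDerivAt (fun x : E => inner ℝ e x) (innerSL ℝ e) x := (innerSL ℝ e).hasFDerivAt
  have h2 : HasFDerivAt (fun x : E => x - inner ℝ e x • e) _ x :=
    (hasFDerivAt_id x).sub (h1.smul_const e)
  have h3 : HasFDerivAt γ _ (x - inner ℝ e x • e) :=
    (hγ.differentiable one_ne_zero _).hasFDerivAt
  have h4 : HasFDerivAt (graphDefining e γ) _ x := h1.sub (h3.comp x h2)
  rw [h4.fderiv]
  simp

variable [FiniteDimensional ℝ E] [MeasurableSpace E] [BorelSpace E]

/-- The map is a surjective linear isometry once the product carries the Euclidean norm, so the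
proof passes through `WithLp 2`. -/
theorem measurePreserving_perp_prod {e : E} (he : ‖e‖ = 1) :
    MeasurePreserving (fun z : (ℝ ∙ e)ᗮ × ℝ => (z.1 : E) + z.2 • e)
      (volume.prod volume) volume := by
  let T : WithLp 2 ((ℝ ∙ e)ᗮ × ℝ) →ₗᵢ[ℝ] E :=
    { toFun := fun z => (z.fst : E) + z.snd • e
      map_add' := fun a b => by
        simp only [WithLp.add_fst, WithLp.add_snd, Submodule.coe_add, add_smul]; abel
      map_smul' := fun c a => by simp [mul_smul]
      norm_map' := fun z => by
        have h : inner ℝ (z.fst : E) (z.snd • e) = 0 := by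
          rw [inner_smul_right, real_inner_comm, inner_coe_perp, mul_zero]
        have h2 := norm_add_sq_eq_norm_sq_add_norm_sq_of_inner_eq_zero _ _ h
        rw [norm_smul, he, mul_one, ← pow_two, ← pow_two, ← pow_two] at h2
        rw [WithLp.prod_norm_eq_of_L2, eq_comm, Real.sqrt_eq_iff_eq_sq (by positivity)
          (norm_nonneg _)]
        exact h2.symm }
  have hT : Function.Surjective T := fun x =>
    ⟨WithLp.toLp 2 (perpProj he x, inner ℝ e x), by simp [T]⟩
  exact (LinearIsometryEquiv.ofSurjective T hT).measurePreserving.comp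
    (WithLp.volume_preserving_toLp (ℝ ∙ e)ᗮ ℝ)

/-- A shear translates every vertical line, so it preserves volume without any differentiability of
γ. -/
theorem measurePreserving_graphHomeo {e : E} (he : ‖e‖ = 1) {γ : E → ℝ} (hγ : Continuous γ) :
    MeasurePreserving (graphHomeo he hγ) (volume.prod volume) volume := by
  refine (measurePreserving_perp_prod he).comp (f := fun z : (ℝ ∙ e)ᗮ × ℝ => (z.1, γ z.1 + z.2)) ?_
  refine (MeasurePreserving.id (volume : Measure (ℝ ∙ e)ᗮ)).skew_product (μc := (volume : Measure ℝ))
    (μd := volume) (g := fun (y : (ℝ ∙ e)ᗮ) (t : ℝ) => γ y + t) ?_ ?_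
  · exact Continuous.measurable (by unfold Function.uncurry; fun_prop)
  · exact Filter.Eventually.of_forall fun y => (measurePreserving_add_left volume (γ y)).map_eq

theorem isClosedEmbedding_prod_left {X Y : Type*} [TopologicalSpace X] [TopologicalSpace Y]
    [T1Space X] (x : X) : Topology.IsClosedEmbedding fun y : Y => (x, y) := by
  refine ⟨isEmbedding_prodMkRight x, ?_⟩
  have : range (fun y : Y => (x, y)) = Prod.fst ⁻¹' {x} := by
    ext ⟨a, b⟩; simp [eq_comm]
  rw [this]
  exact isClosed_singleton.preimage continuous_fst

theorem isClosedEmbedding_prod_right {X Y : Type*} [TopologicalSpace X] [TopologicalSpace Y]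
    [T1Space Y] (y : Y) : Topology.IsClosedEmbedding fun x : X => (x, y) :=
  (Homeomorph.prodComm Y X).isClosedEmbedding.comp (isClosedEmbedding_prod_left y)

/-- Integration over the region below a graph, by parts, in graph coordinates. -/
theorem setIntegral_subgraph_fderiv {e : E} (he : ‖e‖ = 1) {γ : E → ℝ} (hγ : ContDiff ℝ 1 γ)
    {ψ : E → ℝ} (hψ : ContDiff ℝ 1 ψ) (hψc : HasCompactSupport ψ) (w : E) :
    ∫ x in {x | graphDefining e γ x < 0}, fderiv ℝ ψ x w
      = ∫ y : (ℝ ∙ e)ᗮ, ψ ((y : E) + γ y • e)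
          * fderiv ℝ (graphDefining e γ) ((y : E) + γ y • e) w := by
  set Θ := graphHomeo he hγ.continuous with hΘ
  set h : (ℝ ∙ e)ᗮ × ℝ → ℝ := fun z => ψ (Θ z) with hh
  have hΘC : ContDiff ℝ 1 Θ := by
    have h1 : ContDiff ℝ 1 fun z : (ℝ ∙ e)ᗮ × ℝ => (z.1 : E) :=
      (Submodule.subtypeL (ℝ ∙ e)ᗮ).contDiff.comp contDiff_fst
    exact h1.add (((hγ.comp h1).add contDiff_snd).smul contDiff_const)
  have hhC : ContDiff ℝ 1 h := hψ.comp hΘC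
  have hhc : HasCompactSupport h := hψc.comp_homeomorph Θ
  set a : (ℝ ∙ e)ᗮ → ℝ := fun y => fderiv ℝ (graphDefining e γ) ((y : E) + γ y • e) w with ha
  have hac : Continuous a := by
    have := (contDiff_graphDefining (e := e) hγ).continuous_fderiv one_ne_zero
    have hγc := hγ.continuous
    fun_prop
  have hy : ∀ y : (ℝ ∙ e)ᗮ, (y : E) + γ y • e - inner ℝ e ((y : E) + γ y • e) • e = y := by
    intro y
    simp [inner_add_right, inner_smul_right, inner_coe_perp, he]
  -- The constant direction w splits into a horizontal derivative and a multiple of the vertical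
  -- one. The coefficient `a` does not depend on the height, so it is never differentiated and γ of
  -- class C^1 is enough.
  have hfd : ∀ z : (ℝ ∙ e)ᗮ × ℝ,
      fderiv ℝ ψ (Θ z) w = fderiv ℝ h z (perpProj he w, 0) + a z.1 * fderiv ℝ h z (0, 1) := by
    intro z
    have hS : HasFDerivAt (fun z : (ℝ ∙ e)ᗮ × ℝ => (z.1 : E)) 
      ((Submodule.subtypeL _).comp (ContinuousLinearMap.fst ℝ _ ℝ)) z :=
      ((Submodule.subtypeL _).comp (ContinuousLinearMap.fst ℝ _ ℝ)).hasFDerivAt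
    have hG : HasFDerivAt (fun z : (ℝ ∙ e)ᗮ × ℝ => γ z.1) _ z :=
      (hγ.differentiable one_ne_zero _).hasFDerivAt.comp z hS
    have hΘd : HasFDerivAt Θ _ z :=
      hS.add ((hG.add (ContinuousLinearMap.snd ℝ _ ℝ).hasFDerivAt).smul_const e)
    have hhd : HasFDerivAt h _ z :=
      ((hψ.differentiable one_ne_zero _).hasFDerivAt).comp z hΘd
    rw [hhd.fderiv, ha]
    simp only [fderiv_graphDefining hγ, hy]
    simp only [ContinuousLinearMap.comp_apply, add_apply,
      ContinuousLinearMap.smulRight_apply, ContinuousLinearMap.coe_fst',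
      ContinuousLinearMap.coe_snd', Submodule.subtypeL_apply, coe_perpProj, map_add, map_smul,
      map_sub, map_zero, smul_eq_mul, zero_add, add_zero, one_mul]
    ring
  clear_value h
  have hstep : ∫ x in {x | graphDefining e γ x < 0}, fderiv ℝ ψ x w
      = ∫ z in univ ×ˢ Iic 0, fderiv ℝ ψ (Θ z) w ∂(volume.prod volume) := by
    have hpre : univ ×ˢ Iio 0 = Θ ⁻¹' {x | graphDefining e γ x < 0} := by
      ext z; simp [hΘ, graphDefining_graphHomeo]
    rw [← (measurePreserving_graphHomeo he hγ.continuous).setIntegral_preimage_emb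
      Θ.measurableEmbedding, ← hΘ, ← hpre]
    refine setIntegral_congr_set ?_
    exact Measure.set_prod_ae_eq (ae_eq_refl _) Iio_ae_eq_Iic
  rw [hstep]
  simp only [hfd]
  have hd1 : ∀ v, Continuous fun z => fderiv ℝ h z v := fun v =>
    (hhC.continuous_fderiv one_ne_zero).clm_apply continuous_const
  have hd1c : ∀ v, HasCompactSupport fun z => fderiv ℝ h z v := fun v =>
    hhc.fderiv_apply (𝕜 := ℝ) v
  have hi1 : Integrable (fun z => fderiv ℝ h z (perpProj he w, 0)) (volume.prod volume) :=
    (hd1 _).integrable_of_hasCompactSupport (hd1c _)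
  have hi2 : Integrable (fun z => a z.1 * fderiv ℝ h z (0, 1)) (volume.prod volume) :=
    ((hac.comp continuous_fst).mul (hd1 _)).integrable_of_hasCompactSupport (hd1c _).mul_left
  rw [integral_add hi1.integrableOn hi2.integrableOn]
  -- On each horizontal slice this is the integral of a derivative of a compactly supported
  -- function.
  have hz1 : ∫ z in univ ×ˢ Iic 0, fderiv ℝ h z (perpProj he w, 0) ∂(volume.prod volume) = 0 := by
    rw [← Measure.prod_restrict, Measure.restrict_univ, integral_prod_symm]
    swap
    · have := hi1.integrableOn (s := univ ×ˢ Iic 0)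
      rwa [IntegrableOn, ← Measure.prod_restrict, Measure.restrict_univ] at this
    refine integral_eq_zero_of_ae (Filter.Eventually.of_forall fun t => ?_)
    have hcl : Topology.IsClosedEmbedding fun y : (ℝ ∙ e)ᗮ => (y, t) :=
      isClosedEmbedding_prod_right t
    have hk : ContDiff ℝ 1 fun y : (ℝ ∙ e)ᗮ => h (y, t) :=
      hhC.comp (contDiff_id.prodMk contDiff_const)
    have hkc : HasCompactSupport fun y : (ℝ ∙ e)ᗮ => h (y, t) := hhc.comp_isClosedEmbedding hcl
    have hkd : ∀ y, fderiv ℝ h (y, t) (perpProj he w, 0)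
        = fderiv ℝ (fun y => h (y, t)) y (perpProj he w) := by
      intro y
      have h1 := hasFDerivAt_prodMk_left (𝕜 := ℝ) y t
      have h2 : HasFDerivAt (fun y : (ℝ ∙ e)ᗮ => h (y, t)) _ y :=
        (hhC.differentiable one_ne_zero (y, t)).hasFDerivAt.comp y h1
      rw [h2.fderiv]; simp
    simp only [hkd, Pi.zero_apply]
    have hkci : Integrable fun y => fderiv ℝ (fun y => h (y, t)) y (perpProj he w) :=
      ((hk.continuous_fderiv one_ne_zero).clm_apply continuous_const).integrable_of_hasCompactSupport
        (hkc.fderiv_apply (𝕜 := ℝ) _)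
    have := integral_mul_fderiv_eq_neg_fderiv_mul_of_integrable (μ := volume)
      (f := fun _ : (ℝ ∙ e)ᗮ => (1 : ℝ)) (g := fun y => h (y, t)) (v := perpProj he w)
      (by simp) (by simpa using hkci)
      (by simpa using hk.continuous.integrable_of_hasCompactSupport hkc)
      (fun _ _ => differentiableAt_const (1 : ℝ)) (fun y _ => hk.differentiable one_ne_zero y)
    simpa using this
  -- On each vertical half-line the fundamental theorem of calculus leaves the value on the graph,
  -- at height 0.
  have hz2 : ∫ z in univ ×ˢ Iic 0, a z.1 * fderiv ℝ h z (0, 1) ∂(volume.prod volume)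
      = ∫ y : (ℝ ∙ e)ᗮ, ψ ((y : E) + γ y • e) * a y := by
    rw [setIntegral_prod _ hi2.integrableOn, Measure.restrict_univ]
    refine integral_congr_ae (Filter.Eventually.of_forall fun y => ?_)
    have hcl : Topology.IsClosedEmbedding fun t : ℝ => (y, t) := isClosedEmbedding_prod_left y
    have hk : ContDiff ℝ 1 fun t : ℝ => h (y, t) :=
      ContDiff.comp (f := fun t : ℝ => (y, t)) hhC (contDiff_const.prodMk contDiff_id)
    have hkc : HasCompactSupport fun t : ℝ => h (y, t) := hhc.comp_isClosedEmbedding hcl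
    have hkd : ∀ t, fderiv ℝ h (y, t) (0, 1) = deriv (fun t => h (y, t)) t := by
      intro t
      have h1 := hasFDerivAt_prodMk_right (𝕜 := ℝ) y t
      have h2 : HasFDerivAt (fun t : ℝ => h (y, t)) _ t :=
        (hhC.differentiable one_ne_zero (y, t)).hasFDerivAt.comp t h1
      rw [h2.hasDerivAt.deriv]; simp
    simp only [hkd]
    rw [integral_const_mul, hkc.integral_Iic_deriv_eq hk 0, mul_comm]
    simp [hh, hΘ, graphHomeo_apply]
  rw [hz1, hz2, zero_add]

end Graph

/-! ### Surface measure of a graph and Gauss-Green for a subgraph. -/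

section GraphSurface

variable {E : Type*} [NormedAddCommGroup E] [InnerProductSpace ℝ E]

theorem range_graph {e : E} {γ : E → ℝ} (hγ : Continuous γ) (he : ‖e‖ = 1) :
    range (fun y : (ℝ ∙ e)ᗮ => (y : E) + γ y • e) = {x | graphDefining e γ x = 0} := by
  ext x
  constructor
  · rintro ⟨y, rfl⟩
    have := graphDefining_graphHomeo he hγ (y, 0)
    simpa [graphHomeo_apply] using this
  · intro hx
    refine ⟨perpProj he x, ?_⟩
    have h := (graphHomeo he hγ).apply_symm_apply x
    rw [graphHomeo_symm_apply, graphHomeo_apply, (show graphDefining e γ x = 0 from hx)] at h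
    simpa using h

theorem finrank_perp [FiniteDimensional ℝ E] {e : E} (he : ‖e‖ = 1) :
    Module.finrank ℝ (ℝ ∙ e)ᗮ = Module.finrank ℝ E - 1 := by
  have h := (ℝ ∙ e).finrank_add_finrank_orthogonal
  have he0 : e ≠ 0 := by rintro rfl; simp at he
  rw [finrank_span_singleton he0] at h
  omega

theorem measurableEmbedding_graph [MeasurableSpace E] [BorelSpace E] {e : E} {γ : E → ℝ} (hγ : Continuous γ) (he : ‖e‖ = 1) :
    MeasurableEmbedding fun y : (ℝ ∙ e)ᗮ => (y : E) + γ y • e := by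
  have h := (graphHomeo he hγ).isClosedEmbedding.comp
    (isClosedEmbedding_prod_right (X := (ℝ ∙ e)ᗮ) (0 : ℝ))
  have h2 : (fun y : (ℝ ∙ e)ᗮ => (y : E) + γ y • e)
      = graphHomeo he hγ ∘ fun y : (ℝ ∙ e)ᗮ => (y, (0 : ℝ)) := by
    ext y; simp [graphHomeo_apply]
  rw [h2]
  exact h.measurableEmbedding

/-- The derivative along the graph of the function defining the graph has norm
`√(1 + ‖∇γ‖²)`. -/
theorem norm_fderiv_graphDefining {e : E} (he : ‖e‖ = 1) {γ : E → ℝ} (hγ : ContDiff ℝ 1 γ)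
    (y a : (ℝ ∙ e)ᗮ) (ha : ∀ v : (ℝ ∙ e)ᗮ, inner ℝ a v = fderiv ℝ γ y v) :
    ‖fderiv ℝ (graphDefining e γ) ((y : E) + γ y • e)‖ = √(1 + ‖a‖ ^ 2) := by
  have hy : (y : E) + γ y • e - inner ℝ e ((y : E) + γ y • e) • e = y := by
    simp [inner_add_right, inner_smul_right, inner_coe_perp, he]
  have : fderiv ℝ (graphDefining e γ) ((y : E) + γ y • e) = innerSL ℝ (e - (a : E)) := by
    ext w
    have h1 := ha (perpProj he w)
    rw [Submodule.coe_inner, coe_perpProj, inner_sub_right, inner_smul_right, real_inner_comm,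
      real_inner_comm e (a : E), inner_coe_perp, mul_zero, sub_zero] at h1
    rw [fderiv_graphDefining hγ, hy, ← h1, innerSL_apply_apply, inner_sub_left,
      real_inner_comm w (a : E)]
  rw [this, innerSL_apply_norm, eq_comm, Real.sqrt_eq_iff_eq_sq (by positivity) (norm_nonneg _),
    norm_sub_sq_real, inner_coe_perp, he]
  simp

variable [FiniteDimensional ℝ E] [MeasurableSpace E] [BorelSpace E]

/-- The surface measure on a `C^1` graph, in graph coordinates. -/
theorem comap_euclideanHausdorffMeasure_graph {e : E} (he : ‖e‖ = 1) {γ : E → ℝ}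
    (hγ : ContDiff ℝ 1 γ) :
    (μHE[Module.finrank ℝ E - 1]).comap (fun y : (ℝ ∙ e)ᗮ => (y : E) + γ y • e)
      = volume.withDensity fun y : (ℝ ∙ e)ᗮ =>
        ENNReal.ofReal ‖fderiv ℝ (graphDefining e γ) ((y : E) + γ y • e)‖ := by
  let ℓ : (ℝ ∙ e)ᗮ → StrongDual ℝ (ℝ ∙ e)ᗮ := fun y =>
    (fderiv ℝ γ y).comp (Submodule.subtypeL _)
  let a : (ℝ ∙ e)ᗮ → (ℝ ∙ e)ᗮ := fun y => (InnerProductSpace.toDual ℝ _).symm (ℓ y)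
  have ha : ∀ y v, inner ℝ (a y) v = ℓ y v := fun y v => by simp [a]
  have hac : Continuous a := by
    have h := hγ.continuous_fderiv one_ne_zero
    refine (InnerProductSpace.toDual ℝ _).symm.continuous.comp ?_
    exact (h.comp continuous_subtype_val).clm_comp continuous_const
  let S : (ℝ ∙ e)ᗮ → ℝ := fun y => √(1 + ‖a y‖ ^ 2)
  have hS : ∀ y, S y ^ 2 = 1 + ‖a y‖ ^ 2 := fun y => Real.sq_sqrt (by positivity)
  have hSpos : ∀ y, 0 < S y := fun y => Real.sqrt_pos.2 (by positivity)
  have hSn : ∀ y : (ℝ ∙ e)ᗮ, ‖fderiv ℝ (graphDefining e γ) ((y : E) + γ y • e)‖ = S y := fun y =>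
    norm_fderiv_graphDefining he hγ y (a y) (ha y)
  -- With a = ∇γ along e^⊥, this is the positive square root of I + a ⊗ a, the first fundamental
  -- form of the graph: it is the identity on a^⊥ and multiplies a by 1 + |a|²/(1 + S) = S. Hence ‖L
  -- v‖ = ‖Φ' v‖ and det L = S.
  let L : (ℝ ∙ e)ᗮ → (ℝ ∙ e)ᗮ →L[ℝ] (ℝ ∙ e)ᗮ := fun y =>
    ContinuousLinearMap.id ℝ _ + (ℓ y).smulRight ((1 + S y)⁻¹ • a y)
  have hLdet : ∀ y, (L y).det = S y := by
    intro y
    have h1 : ((L y : (ℝ ∙ e)ᗮ →L[ℝ] (ℝ ∙ e)ᗮ) : (ℝ ∙ e)ᗮ →ₗ[ℝ] (ℝ ∙ e)ᗮ)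
        = LinearMap.transvection (ℓ y : (ℝ ∙ e)ᗮ →ₗ[ℝ] ℝ) ((1 + S y)⁻¹ • a y) := by
      ext v; simp [L, LinearMap.transvection]
    rw [ContinuousLinearMap.det, h1, LinearMap.transvection.det]
    have h2 : ℓ y (a y) = ‖a y‖ ^ 2 := by rw [← ha, real_inner_self_eq_norm_sq]
    simp only [ContinuousLinearMap.coe_coe, map_smul, h2, smul_eq_mul]
    have := hS y
    have := hSpos y
    field_simp
    nlinarith
  let M : (ℝ ∙ e)ᗮ → (ℝ ∙ e)ᗮ ≃L[ℝ] (ℝ ∙ e)ᗮ := fun y =>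
    (L y).toContinuousLinearEquivOfDetNeZero (by rw [hLdet]; exact (hSpos y).ne')
  have hML : ∀ y, (M y : (ℝ ∙ e)ᗮ →L[ℝ] (ℝ ∙ e)ᗮ) = L y := fun y =>
    ContinuousLinearMap.coe_toContinuousLinearEquivOfDetNeZero _ _
  let Φ' : (ℝ ∙ e)ᗮ → (ℝ ∙ e)ᗮ →L[ℝ] E := fun y =>
    Submodule.subtypeL _ + (ℓ y).smulRight e
  have hΦ : ∀ y, HasStrictFDerivAt (fun y : (ℝ ∙ e)ᗮ => (y : E) + γ y • e) (Φ' y) y := by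
    intro y
    have h1 : HasStrictFDerivAt (fun y : (ℝ ∙ e)ᗮ => (y : E)) (Submodule.subtypeL _) y :=
      (Submodule.subtypeL _).hasStrictFDerivAt
    have h2 := ((hγ.contDiffAt (x := (y : E))).hasStrictFDerivAt one_ne_zero).comp y h1
    exact h1.add (h2.smul_const e)
  have hM : ∀ y v, ‖M y v‖ = ‖Φ' y v‖ := by
    intro y v
    have e1 : M y v = L y v := by rw [← hML]; rfl
    have e2 : L y v = v + (ℓ y v * (1 + S y)⁻¹) • a y := by simp [L, mul_smul]
    have e3 : Φ' y v = (v : E) + ℓ y v • e := by simp [Φ']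
    rw [e1, e2, e3, ← sq_eq_sq₀ (norm_nonneg _) (norm_nonneg _), norm_add_sq_real,
      norm_add_sq_real, inner_smul_right, inner_smul_right,
      real_inner_comm (a y) v, ha, real_inner_comm e (v : E), inner_coe_perp, norm_smul, norm_smul, he, mul_pow, mul_pow,
      Real.norm_eq_abs, Real.norm_eq_abs, sq_abs, sq_abs]
    have h1 := hS y
    have h2 := hSpos y
    have h3 : ‖a y‖ ^ 2 = S y ^ 2 - 1 := by linarith
    rw [h3, Submodule.coe_norm]
    field_simp
    ring
  have hdet : ∀ y, (M y : (ℝ ∙ e)ᗮ →L[ℝ] (ℝ ∙ e)ᗮ).det = S y := fun y => by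
    rw [hML, hLdet]
  have key := comap_euclideanHausdorffMeasure_eq_withDensity hΦ hM
    (measurableEmbedding_graph hγ.continuous he) (by simp only [hdet, S]; fun_prop)
  rw [finrank_perp he] at key
  rw [key]
  congr 1
  ext y
  rw [hdet, hSn, abs_of_pos (hSpos y)]

/-- Surface integrals over a `C^1` graph, in graph coordinates. -/
theorem setIntegral_graph {e : E} (he : ‖e‖ = 1) {γ : E → ℝ} (hγ : ContDiff ℝ 1 γ) (f : E → ℝ) :
    ∫ x in {x | graphDefining e γ x = 0}, f x ∂μHE[Module.finrank ℝ E - 1]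
      = ∫ y : (ℝ ∙ e)ᗮ, ‖fderiv ℝ (graphDefining e γ) ((y : E) + γ y • e)‖
          * f ((y : E) + γ y • e) := by
  have hemb := measurableEmbedding_graph hγ.continuous he
  rw [← range_graph hγ.continuous he, ← hemb.map_comap, hemb.integral_map,
    comap_euclideanHausdorffMeasure_graph he hγ, integral_withDensity_eq_integral_toReal_smul]
  · simp
  · refine ENNReal.measurable_ofReal.comp (Continuous.measurable ?_)
    have h1 := (contDiff_graphDefining (e := e) hγ).continuous_fderiv one_ne_zero
    have h2 := hγ.continuous
    fun_prop
  · simp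

/-- **Gauss-Green** for the region below a `C^1` graph. -/
theorem setIntegral_subgraph_fderiv_eq_setIntegral_graph {e : E} (he : ‖e‖ = 1) {γ : E → ℝ}
    (hγ : ContDiff ℝ 1 γ) {ψ : E → ℝ} (hψ : ContDiff ℝ 1 ψ) (hψc : HasCompactSupport ψ) (w : E) :
    ∫ x in {x | graphDefining e γ x < 0}, fderiv ℝ ψ x w
      = ∫ x in {x | graphDefining e γ x = 0},
          ψ x * (‖fderiv ℝ (graphDefining e γ) x‖⁻¹ * fderiv ℝ (graphDefining e γ) x w)
          ∂μHE[Module.finrank ℝ E - 1] := by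
  rw [setIntegral_subgraph_fderiv he hγ hψ hψc w, setIntegral_graph he hγ]
  refine integral_congr_ae (Filter.Eventually.of_forall fun y => ?_)
  let a := (InnerProductSpace.toDual ℝ (ℝ ∙ e)ᗮ).symm ((fderiv ℝ γ y).comp (Submodule.subtypeL _))
  have h := norm_fderiv_graphDefining he hγ y a (fun v => by simp [a])
  have hpos : 0 < ‖fderiv ℝ (graphDefining e γ) ((y : E) + γ y • e)‖ := by
    rw [h]; exact Real.sqrt_pos.2 (by positivity)
  field_simp

/-- The parameters over a compact set form a compact set, and the area density is continuous. Used
for finiteness of the surface measure of ∂Ω. -/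
theorem euclideanHausdorffMeasure_graph_inter_lt_top {e : E} (he : ‖e‖ = 1) {γ : E → ℝ}
    (hγ : ContDiff ℝ 1 γ) {s : Set E} (hs : IsCompact s) :
    μHE[Module.finrank ℝ E - 1] ({x | graphDefining e γ x = 0} ∩ s) < ⊤ := by
  have hemb := measurableEmbedding_graph hγ.continuous he
  set Φ := fun y : (ℝ ∙ e)ᗮ => (y : E) + γ y • e with hΦ
  have hcl : IsCompact (Φ ⁻¹' s) := by
    have h := (graphHomeo he hγ.continuous).isClosedEmbedding.comp
      (isClosedEmbedding_prod_right (X := (ℝ ∙ e)ᗮ) (0 : ℝ))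
    have h2 : Φ = graphHomeo he hγ.continuous ∘ fun y : (ℝ ∙ e)ᗮ => (y, (0 : ℝ)) := by
      ext y; simp [graphHomeo_apply, hΦ]
    rw [h2]
    exact h.isCompact_preimage hs
  have h1 := (contDiff_graphDefining (e := e) hγ).continuous_fderiv one_ne_zero
  have h2 := hγ.continuous
  have : {x | graphDefining e γ x = 0} ∩ s = Φ '' (Φ ⁻¹' s) := by
    rw [image_preimage_eq_inter_range, range_graph hγ.continuous he, inter_comm]
  rw [this, ← hemb.comap_apply, comap_euclideanHausdorffMeasure_graph he hγ,
    withDensity_apply _ hcl.measurableSet]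
  have hc : Continuous fun y : (ℝ ∙ e)ᗮ =>
      ‖fderiv ℝ (graphDefining e γ) ((y : E) + γ y • e)‖ := by fun_prop
  exact (hc.continuousOn.integrableOn_compact hcl).lintegral_lt_top

end GraphSurface

/-! ### Finite smooth partitions of unity on compact sets. -/

section PartitionOfUnity

/-- Intersecting the given neighbourhoods with unit balls forces compact supports, and compactness
of K makes the family finite, so that sums and integrals can be exchanged freely. -/
theorem exists_contDiff_partition {E : Type*} [NormedAddCommGroup E] [NormedSpace ℝ E]
    [FiniteDimensional ℝ E] {K : Set E} (hK : IsCompact K) {U : E → Set E}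
    (hU : ∀ x ∈ K, U x ∈ 𝓝 x) :
    ∃ (t : Finset E) (η : E → E → ℝ), (∀ x ∈ t, x ∈ K) ∧ (∀ x ∈ t, ContDiff ℝ ∞ (η x)) ∧
      (∀ x ∈ t, HasCompactSupport (η x)) ∧ (∀ x ∈ t, tsupport (η x) ⊆ U x) ∧
      (∀ x y, 0 ≤ η x y) ∧ ∀ y ∈ K, ∑ x ∈ t, η x y = 1 := by
  classical
  let V : E → Set E := fun x => interior (U x) ∩ Metric.ball x 1
  have hV : ∀ x ∈ K, V x ∈ 𝓝 x := fun x hx =>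
    inter_mem (interior_mem_nhds.2 (hU x hx)) (Metric.ball_mem_nhds x one_pos)
  obtain ⟨t, htK, ht⟩ := hK.elim_nhds_subcover V hV
  obtain ⟨f, hf⟩ := SmoothPartitionOfUnity.exists_isSubordinate (modelWithCornersSelf ℝ E)
    hK.isClosed (fun x : t => V x) (fun x => isOpen_interior.inter Metric.isOpen_ball)
    (fun y hy => by
      have := ht hy
      simp only [mem_iUnion] at this ⊢
      obtain ⟨x, hx, hxy⟩ := this
      exact ⟨⟨x, hx⟩, hxy⟩)
  -- The value 0 outside `t` keeps nonnegativity unconditional in the index.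
  refine ⟨t, fun x y => if h : x ∈ t then f ⟨x, h⟩ y else 0, htK, ?_, ?_, ?_, ?_, ?_⟩
  · intro x hx
    simp only [hx, dif_pos]
    exact (f ⟨x, hx⟩).contMDiff.contDiff
  · intro x hx
    simp only [hx, dif_pos]
    refine HasCompactSupport.of_support_subset_isCompact (isCompact_closedBall x 1) ?_
    exact (subset_tsupport _).trans ((hf ⟨x, hx⟩).trans
      (inter_subset_right.trans Metric.ball_subset_closedBall))
  · intro x hx
    simp only [hx, dif_pos]
    exact (hf ⟨x, hx⟩).trans (inter_subset_left.trans interior_subset)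
  · intro x y
    dsimp only
    split_ifs with h
    · exact f.nonneg ⟨x, h⟩ y
    · exact le_rfl
  · intro y hy
    have h1 := f.sum_eq_one hy
    rw [finsum_eq_sum_of_fintype] at h1
    rw [← h1, ← Finset.sum_coe_sort]
    refine Finset.sum_congr rfl fun x _ => ?_
    simp

end PartitionOfUnity

/-! ### Exterior normal, surface measure and Gauss-Green on a C^1 domain. -/

section Domain

variable {N : ℕ} {Ω : Set (EuclideanSpace ℝ (Fin N))}

theorem fderiv_graphDefining_self {E : Type*} [NormedAddCommGroup E] [InnerProductSpace ℝ E]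
    {e : E} (he : ‖e‖ = 1) {γ : E → ℝ} (hγ : ContDiff ℝ 1 γ) (x : E) :
    fderiv ℝ (graphDefining e γ) x e = 1 := by
  rw [fderiv_graphDefining hγ]
  simp [he]

/-- A chart only describes membership in Ω. Strictly above the graph a whole neighbourhood misses Ω;
a point of the graph is outside Ω but is the limit of the points x - t e, which lie in Ω. -/
theorem mem_frontier_iff_graphDefining {x₀ e : EuclideanSpace ℝ (Fin N)}
    {r : ℝ} {γ : EuclideanSpace ℝ (Fin N) → ℝ} (he : ‖e‖ = 1) (hγ : ContDiff ℝ 1 γ)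
    (h : ∀ x ∈ Metric.ball x₀ r, (x ∈ Ω ↔ graphDefining e γ x < 0)) (hΩ : IsOpen Ω)
    {x : EuclideanSpace ℝ (Fin N)} (hx : x ∈ Metric.ball x₀ r) :
    x ∈ frontier Ω ↔ graphDefining e γ x = 0 := by
  have hc := (contDiff_graphDefining (e := e) hγ).continuous
  rw [hΩ.frontier_eq, Set.mem_sdiff, h x hx, not_lt]
  constructor
  · rintro ⟨h1, h2⟩
    refine le_antisymm (not_lt.1 fun h3 => ?_) h2
    have h4 : Metric.ball x₀ r ∩ {y | 0 < graphDefining e γ y} ∈ 𝓝 x :=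
      inter_mem (Metric.isOpen_ball.mem_nhds hx) ((isOpen_lt continuous_const hc).mem_nhds h3)
    obtain ⟨y, ⟨hy1, hy2⟩, hy3⟩ := mem_closure_iff_nhds.1 h1 _ h4
    exact absurd ((h y hy1).1 hy3) (not_lt.2 (le_of_lt hy2))
  · intro h0
    refine ⟨?_, h0.ge⟩
    have hlim : Tendsto (fun t : ℝ => x - t • e) (𝓝[>] 0) (𝓝 x) := by
      have : Continuous fun t : ℝ => x - t • e := by fun_prop
      simpa using (this.tendsto 0).mono_left nhdsWithin_le_nhds
    refine mem_closure_of_tendsto hlim ?_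
    filter_upwards [hlim.eventually (Metric.isOpen_ball.mem_nhds hx), self_mem_nhdsWithin]
      with t ht1 ht2
    rw [h _ ht1]
    have h5 : graphDefining e γ (x - t • e) = graphDefining e γ x - t := by
      have : x - t • e - (inner ℝ e x - t) • e = x - inner ℝ e x • e := by
        rw [sub_smul]; abel
      simp [graphDefining, inner_sub_right, inner_smul_right, he, this]
      ring
    rw [h5, h0]
    simpa using ht2

/-- The exterior unit normal of a region which is locally the region below a graph. -/
theorem isExteriorUnitNormal_of_graph {x₀ e : EuclideanSpace ℝ (Fin N)}
    {r : ℝ} {γ : EuclideanSpace ℝ (Fin N) → ℝ} (he : ‖e‖ = 1) (hγ : ContDiff ℝ 1 γ)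
    (h : ∀ x ∈ Metric.ball x₀ r, (x ∈ Ω ↔ graphDefining e γ x < 0))
    {x : EuclideanSpace ℝ (Fin N)} (hx : x ∈ Metric.ball x₀ r) (h0 : graphDefining e γ x = 0) :
    IsExteriorUnitNormal Ω x (‖fderiv ℝ (graphDefining e γ) x‖⁻¹ •
      gradient (graphDefining e γ) x) := by
  have hd := ((contDiff_graphDefining (e := e) hγ).differentiable one_ne_zero x).hasFDerivAt
  set D := fderiv ℝ (graphDefining e γ) x with hD
  have hDe : D e = 1 := fderiv_graphDefining_self he hγ x
  have hD0 : 0 < ‖D‖ := norm_pos_iff.2 fun h => by simp [h] at hDe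
  have hin : ∀ w, inner ℝ w (‖D‖⁻¹ • gradient (graphDefining e γ) x) = ‖D‖⁻¹ * D w := by
    intro w
    rw [inner_smul_right, real_inner_comm, gradient, InnerProductSpace.toDual_symm_apply]
  have hlin : ∀ w, Tendsto (fun t : ℝ => x + t • w) (𝓝[>] 0) (𝓝 x) := by
    intro w
    have : Continuous fun t : ℝ => x + t • w := by fun_prop
    simpa using (this.tendsto 0).mono_left nhdsWithin_le_nhds
  -- The slope at 0 decides the sign of the defining function along a short ray, hence on which side
  -- of ∂Ω the ray starts.
  have hslope : ∀ w, Tendsto (fun t : ℝ => t⁻¹ * graphDefining e γ (x + t • w)) (𝓝[>] 0)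
      (𝓝 (D w)) := by
    intro w
    have h1 := (hd.hasLineDerivAt w).tendsto_slope_zero_right
    simpa [h0] using h1
  refine ⟨?_, fun w hw => ?_, fun w hw => ?_⟩
  · rw [norm_smul, norm_inv, norm_norm, gradient, LinearIsometryEquiv.norm_map]
    exact inv_mul_cancel₀ hD0.ne'
  · rw [hin] at hw
    have hw' : D w < 0 := by
      by_contra hc
      exact absurd hw (not_lt.2 (mul_nonneg (by positivity) (not_lt.1 hc)))
    filter_upwards [(hlin w).eventually (Metric.isOpen_ball.mem_nhds hx),
      (hslope w).eventually (gt_mem_nhds hw'), self_mem_nhdsWithin] with t ht1 ht2 ht3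
    rw [h _ ht1]
    by_contra hc
    exact absurd ht2 (not_lt.2 (mul_nonneg (inv_nonneg.2 (le_of_lt ht3)) (not_lt.1 hc)))
  · rw [hin] at hw
    have hw' : 0 < D w := by
      by_contra hc
      exact absurd hw (not_lt.2 (mul_nonpos_of_nonneg_of_nonpos (by positivity) (not_lt.1 hc)))
    filter_upwards [(hlin w).eventually (Metric.isOpen_ball.mem_nhds hx),
      (hslope w).eventually (lt_mem_nhds hw'), self_mem_nhdsWithin] with t ht1 ht2 ht3
    rw [h _ ht1]
    intro hc
    exact absurd ht2 (not_lt.2 (mul_nonpos_of_nonneg_of_nonpos (inv_nonneg.2 (le_of_lt ht3)) hc.le))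

theorem exteriorNormal_eq {x n : EuclideanSpace ℝ (Fin N)} (hn : IsExteriorUnitNormal Ω x n) :
    exteriorNormal Ω x = n :=
  (Classical.epsilon_spec (p := IsExteriorUnitNormal Ω x) ⟨n, hn⟩).unique hn

theorem inner_exteriorNormal_of_graph {x₀ e : EuclideanSpace ℝ (Fin N)}
    {r : ℝ} {γ : EuclideanSpace ℝ (Fin N) → ℝ} (he : ‖e‖ = 1) (hγ : ContDiff ℝ 1 γ)
    (h : ∀ x ∈ Metric.ball x₀ r, (x ∈ Ω ↔ graphDefining e γ x < 0))
    {x : EuclideanSpace ℝ (Fin N)} (hx : x ∈ Metric.ball x₀ r) (h0 : graphDefining e γ x = 0)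
    (w : EuclideanSpace ℝ (Fin N)) :
    inner ℝ (exteriorNormal Ω x) w
      = ‖fderiv ℝ (graphDefining e γ) x‖⁻¹ * fderiv ℝ (graphDefining e γ) x w := by
  rw [exteriorNormal_eq (isExteriorUnitNormal_of_graph he hγ h hx h0), real_inner_smul_left,
    gradient, InnerProductSpace.toDual_symm_apply]

theorem HasC1Boundary.isExteriorUnitNormal (hΩ : HasC1Boundary Ω) (hΩo : IsOpen Ω)
    {x : EuclideanSpace ℝ (Fin N)} (hx : x ∈ frontier Ω) :
    IsExteriorUnitNormal Ω x (exteriorNormal Ω x) := by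
  obtain ⟨r, e, γ, hr, he, hγ, h⟩ := hΩ x hx
  have h' : ∀ y ∈ Metric.ball x r, (y ∈ Ω ↔ graphDefining e γ y < 0) := fun y hy => by
    rw [h y hy, graphDefining, sub_neg]
  have hxb := Metric.mem_ball_self (x := x) hr
  have hn := isExteriorUnitNormal_of_graph he hγ h' hxb
    ((mem_frontier_iff_graphDefining he hγ h' hΩo hxb).1 hx)
  rwa [exteriorNormal_eq hn]

/-- The normalized gradient of the defining function of one chart is continuous, and by uniqueness
of the normal it represents `exteriorNormal` at all boundary points in the chart's ball. -/
theorem HasC1Boundary.continuousOn_exteriorNormal (hΩ : HasC1Boundary Ω) (hΩo : IsOpen Ω) :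
    ContinuousOn (exteriorNormal Ω) (frontier Ω) := by
  intro x hx
  obtain ⟨r, e, γ, hr, he, hγ, h⟩ := hΩ x hx
  have h' : ∀ y ∈ Metric.ball x r, (y ∈ Ω ↔ graphDefining e γ y < 0) := fun y hy => by
    rw [h y hy, graphDefining, sub_neg]
  have hc : Continuous fun y => ‖fderiv ℝ (graphDefining e γ) y‖⁻¹ •
      gradient (graphDefining e γ) y := by
    have h1 := (contDiff_graphDefining (e := e) hγ).continuous_fderiv one_ne_zero
    refine (h1.norm.inv₀ fun y hy => ?_).smul
      ((InnerProductSpace.toDual ℝ _).symm.continuous.comp h1)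
    have h2 := fderiv_graphDefining_self he hγ y
    rw [norm_eq_zero.1 hy] at h2
    simp at h2
  refine (hc.continuousAt (x := x)).continuousWithinAt.congr_of_eventuallyEq ?_ ?_
  · filter_upwards [self_mem_nhdsWithin,
      mem_nhdsWithin_of_mem_nhds (Metric.ball_mem_nhds x hr)] with y hy1 hy2
    exact exteriorNormal_eq (isExteriorUnitNormal_of_graph he hγ h' hy2
      ((mem_frontier_iff_graphDefining he hγ h' hΩo hy2).1 hy1))
  · have hxb := Metric.mem_ball_self (x := x) hr
    exact exteriorNormal_eq (isExteriorUnitNormal_of_graph he hγ h' hxb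
      ((mem_frontier_iff_graphDefining he hγ h' hΩo hxb).1 hx))

theorem isCompact_frontier_of_isBounded (hΩb : Bornology.IsBounded Ω) :
    IsCompact (frontier Ω) :=
  hΩb.isCompact_closure.of_isClosed_subset isClosed_frontier frontier_subset_closure

theorem HasC1Boundary.isFiniteMeasure_surfaceMeasure (hΩ : HasC1Boundary Ω) (hΩo : IsOpen Ω)
    (hΩb : Bornology.IsBounded Ω) : IsFiniteMeasure (surfaceMeasure Ω) := by
  refine ⟨?_⟩
  rw [surfaceMeasure, Measure.restrict_apply_univ]
  choose! r e γ hr he hγ h using hΩ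
  obtain ⟨t, ht, hcov⟩ := (isCompact_frontier_of_isBounded hΩb).elim_nhds_subcover
    (fun x => Metric.ball x (r x / 2))
    fun x hx => Metric.ball_mem_nhds x (half_pos (hr x hx))
  have hsub : frontier Ω ⊆ ⋃ x ∈ t,
      ({y | graphDefining (e x) (γ x) y = 0} ∩ Metric.closedBall x (r x / 2)) := by
    intro y hy
    obtain ⟨x, hx, hyx⟩ := mem_iUnion₂.1 (hcov hy)
    refine mem_iUnion₂.2 ⟨x, hx, ?_, Metric.ball_subset_closedBall hyx⟩
    refine (mem_frontier_iff_graphDefining (he x (ht x hx)) (hγ x (ht x hx))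
      (fun z hz => ?_) hΩo (x₀ := x) (r := r x) ?_).1 hy
    · rw [h x (ht x hx) z hz, graphDefining, sub_neg]
    · exact Metric.ball_subset_ball (by linarith [hr x (ht x hx)]) hyx
  refine (measure_mono hsub).trans_lt ((measure_biUnion_finset_le _ _).trans_lt ?_)
  refine ENNReal.sum_lt_top.2 fun x hx => ?_
  have := euclideanHausdorffMeasure_graph_inter_lt_top (he x (ht x hx)) (hγ x (ht x hx))
    (isCompact_closedBall x (r x / 2))
  rwa [finrank_euclideanSpace_fin] at this

theorem integrable_surfaceMeasure_of_continuousOn [IsFiniteMeasure (surfaceMeasure Ω)]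
    (hΩb : Bornology.IsBounded Ω) {F : Type*} [NormedAddCommGroup F]
    {f : EuclideanSpace ℝ (Fin N) → F} (hf : ContinuousOn f (frontier Ω)) :
    Integrable f (surfaceMeasure Ω) := by
  have hK := isCompact_frontier_of_isBounded hΩb
  obtain ⟨C, hC⟩ := hK.exists_bound_of_continuousOn hf
  refine Integrable.of_bound (hf.aestronglyMeasurable_of_isCompact hK hK.measurableSet) C ?_
  exact (ae_restrict_iff' hK.measurableSet).2 (Filter.Eventually.of_forall hC)

theorem integrableOn_of_continuous_of_isBounded (hΩb : Bornology.IsBounded Ω) {F : Type*}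
    [NormedAddCommGroup F] {f : EuclideanSpace ℝ (Fin N) → F} (hf : Continuous f) :
    IntegrableOn f Ω :=
  (hf.continuousOn.integrableOn_compact hΩb.isCompact_closure).mono_set subset_closure

/-- Interior patches of Gauss-Green: both sides vanish. -/
theorem setIntegral_fderiv_of_tsupport_subset (hΩo : IsOpen Ω)
    {ψ : EuclideanSpace ℝ (Fin N) → ℝ} (hψ : ContDiff ℝ 1 ψ) (hψc : HasCompactSupport ψ)
    (hs : tsupport ψ ⊆ Ω) (w : EuclideanSpace ℝ (Fin N)) :
    ∫ x in Ω, fderiv ℝ ψ x w = ∫ x, ψ x * inner ℝ (exteriorNormal Ω x) w ∂surfaceMeasure Ω := by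
  have h1 : ∫ x, ψ x * inner ℝ (exteriorNormal Ω x) w ∂surfaceMeasure Ω = 0 := by
    refine setIntegral_eq_zero_of_forall_eq_zero fun x hx => ?_
    have hx' : x ∉ tsupport ψ := fun h =>
      (hΩo.frontier_eq ▸ hx : x ∈ closure Ω \ Ω).2 (hs h)
    rw [image_eq_zero_of_notMem_tsupport hx', zero_mul]
  have h2 : ∫ x in Ω, fderiv ℝ ψ x w = ∫ x, fderiv ℝ ψ x w := by
    refine setIntegral_eq_integral_of_forall_compl_eq_zero fun x hx => ?_
    have : x ∉ tsupport (fderiv ℝ ψ) := fun h => hx (hs (tsupport_fderiv_subset ℝ h))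
    rw [image_eq_zero_of_notMem_tsupport this]; simp
  have hi : Integrable fun x => fderiv ℝ ψ x w :=
    ((hψ.continuous_fderiv one_ne_zero).clm_apply continuous_const).integrable_of_hasCompactSupport
      (hψc.fderiv_apply (𝕜 := ℝ) _)
  have h3 := integral_mul_fderiv_eq_neg_fderiv_mul_of_integrable (μ := volume)
    (f := fun _ : EuclideanSpace ℝ (Fin N) => (1 : ℝ)) (g := ψ) (v := w)
    (by simp) (by simpa using hi) (by simpa using hψ.continuous.integrable_of_hasCompactSupport hψc)
    (fun _ _ => differentiableAt_const (1 : ℝ)) (fun y _ => hψ.differentiable one_ne_zero y)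
  rw [h1, h2]
  simpa using h3

/-- Boundary patches of Gauss-Green: in the ball, Ω and ∂Ω coincide with the subgraph and the graph,
and outside it ψ vanishes, so the formula for the full graph applies. -/
theorem setIntegral_fderiv_of_tsupport_subset_ball {x₀ e : EuclideanSpace ℝ (Fin N)}
    {r : ℝ} {γ : EuclideanSpace ℝ (Fin N) → ℝ} (he : ‖e‖ = 1) (hγ : ContDiff ℝ 1 γ)
    (h : ∀ x ∈ Metric.ball x₀ r, (x ∈ Ω ↔ graphDefining e γ x < 0)) (hΩo : IsOpen Ω)
    {ψ : EuclideanSpace ℝ (Fin N) → ℝ} (hψ : ContDiff ℝ 1 ψ) (hψc : HasCompactSupport ψ)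
    (hs : tsupport ψ ⊆ Metric.ball x₀ r) (w : EuclideanSpace ℝ (Fin N)) :
    ∫ x in Ω, fderiv ℝ ψ x w = ∫ x, ψ x * inner ℝ (exteriorNormal Ω x) w ∂surfaceMeasure Ω := by
  have hgc := (contDiff_graphDefining (e := e) hγ).continuous
  have h1 : ∫ x in Ω, fderiv ℝ ψ x w
      = ∫ x in {x | graphDefining e γ x < 0}, fderiv ℝ ψ x w := by
    rw [← integral_indicator hΩo.measurableSet,
      ← integral_indicator (isOpen_lt hgc continuous_const).measurableSet]
    congr 1
    ext x
    by_cases hx : x ∈ Metric.ball x₀ r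
    · by_cases hxΩ : x ∈ Ω
      · rw [indicator_of_mem hxΩ,
          indicator_of_mem (show x ∈ {x | graphDefining e γ x < 0} from (h x hx).1 hxΩ)]
      · rw [indicator_of_notMem hxΩ, indicator_of_notMem
          (show x ∉ {x | graphDefining e γ x < 0} from fun hc => hxΩ ((h x hx).2 hc))]
    · have : x ∉ tsupport (fderiv ℝ ψ) := fun h => hx (hs (tsupport_fderiv_subset ℝ h))
      simp [indicator_apply, image_eq_zero_of_notMem_tsupport this]
  have h2 : ∫ x, ψ x * inner ℝ (exteriorNormal Ω x) w ∂surfaceMeasure Ω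
      = ∫ x in {x | graphDefining e γ x = 0},
          ψ x * (‖fderiv ℝ (graphDefining e γ) x‖⁻¹ * fderiv ℝ (graphDefining e γ) x w)
          ∂μHE[N - 1] := by
    rw [surfaceMeasure, ← integral_indicator isClosed_frontier.measurableSet,
      ← integral_indicator (isClosed_eq hgc continuous_const).measurableSet]
    congr 1
    ext x
    by_cases hx : x ∈ Metric.ball x₀ r
    · have hiff := mem_frontier_iff_graphDefining he hγ h hΩo hx
      by_cases hxΩ : x ∈ frontier Ω
      · rw [indicator_of_mem hxΩ, 
          indicator_of_mem (show x ∈ {x | graphDefining e γ x = 0} from hiff.1 hxΩ),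
          inner_exteriorNormal_of_graph he hγ h hx (hiff.1 hxΩ)]
      · rw [indicator_of_notMem hxΩ, indicator_of_notMem
          (show x ∉ {x | graphDefining e γ x = 0} from fun hc => hxΩ (hiff.2 hc))]
    · simp [indicator_apply, image_eq_zero_of_notMem_tsupport fun h => hx (hs h)]
  rw [h1, h2, setIntegral_subgraph_fderiv_eq_setIntegral_graph he hγ hψ hψc w,
    finrank_euclideanSpace_fin]

/-- **Gauss-Green** on a bounded open set with `C^1` boundary. -/
theorem HasC1Boundary.setIntegral_fderiv (hΩ : HasC1Boundary Ω) (hΩo : IsOpen Ω)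
    (hΩb : Bornology.IsBounded Ω) {φ : EuclideanSpace ℝ (Fin N) → ℝ} (hφ : ContDiff ℝ 1 φ)
    (w : EuclideanSpace ℝ (Fin N)) :
    ∫ x in Ω, fderiv ℝ φ x w = ∫ x, φ x * inner ℝ (exteriorNormal Ω x) w ∂surfaceMeasure Ω := by
  have hfin := hΩ.isFiniteMeasure_surfaceMeasure hΩo hΩb
  have hloc : ∀ x ∈ closure Ω, ∃ U ∈ 𝓝 x, ∀ ψ : EuclideanSpace ℝ (Fin N) → ℝ, ContDiff ℝ 1 ψ →
      HasCompactSupport ψ → tsupport ψ ⊆ U → ∫ x in Ω, fderiv ℝ ψ x w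
        = ∫ x, ψ x * inner ℝ (exteriorNormal Ω x) w ∂surfaceMeasure Ω := by
    intro x hx
    by_cases hxΩ : x ∈ Ω
    · exact ⟨Ω, hΩo.mem_nhds hxΩ, fun ψ h1 h2 h3 =>
        setIntegral_fderiv_of_tsupport_subset hΩo h1 h2 h3 w⟩
    · have hxf : x ∈ frontier Ω := by rw [hΩo.frontier_eq]; exact ⟨hx, hxΩ⟩
      obtain ⟨r, e, γ, hr, he, hγ, h⟩ := hΩ x hxf
      refine ⟨_, Metric.ball_mem_nhds x hr, fun ψ h1 h2 h3 =>
        setIntegral_fderiv_of_tsupport_subset_ball he hγ (fun y hy => ?_) hΩo h1 h2 h3 w⟩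
      rw [h y hy, graphDefining, sub_neg]
  choose! U hU hUψ using hloc
  obtain ⟨t, η, htK, hηC, hηc, hηU, -, hη1⟩ := exists_contDiff_partition hΩb.isCompact_closure hU
  have hpC : ∀ x ∈ t, ContDiff ℝ 1 fun y => η x y * φ y := fun x hx =>
    ((hηC x hx).of_le (by exact_mod_cast le_top)).mul hφ
  have hpatch : ∀ x ∈ t, ∫ y in Ω, fderiv ℝ (fun y => η x y * φ y) y w
      = ∫ y, η x y * φ y * inner ℝ (exteriorNormal Ω y) w ∂surfaceMeasure Ω := fun x hx =>
    hUψ x (htK x hx) _ (hpC x hx) (hηc x hx).mul_right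
      ((tsupport_mul_subset_left).trans (hηU x hx))
  have hsum : ∀ y ∈ closure Ω, ∑ x ∈ t, η x y * φ y = φ y := fun y hy => by
    rw [← Finset.sum_mul, hη1 y hy, one_mul]
  calc ∫ y in Ω, fderiv ℝ φ y w
      = ∫ y in Ω, ∑ x ∈ t, fderiv ℝ (fun y => η x y * φ y) y w := by
        refine setIntegral_congr_fun hΩo.measurableSet fun y hy => ?_
        -- The partition sums to 1 on the closure only; since Ω is open the identity holds near y
        -- and may be differentiated.
        have h1 : φ =ᶠ[𝓝 y] fun y => ∑ x ∈ t, η x y * φ y := by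
          filter_upwards [hΩo.mem_nhds hy] with z hz
          exact (hsum z (subset_closure hz)).symm
        rw [h1.fderiv_eq, fderiv_fun_sum fun x hx => (hpC x hx).differentiable one_ne_zero y]
        simp
    _ = ∑ x ∈ t, ∫ y in Ω, fderiv ℝ (fun y => η x y * φ y) y w := by
        refine integral_finsetSum _ fun x hx => ?_
        exact integrableOn_of_continuous_of_isBounded hΩb
          (((hpC x hx).continuous_fderiv one_ne_zero).clm_apply continuous_const)
    _ = ∑ x ∈ t, ∫ y, η x y * φ y * inner ℝ (exteriorNormal Ω y) w ∂surfaceMeasure Ω :=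
        Finset.sum_congr rfl hpatch
    _ = ∫ y, ∑ x ∈ t, η x y * φ y * inner ℝ (exteriorNormal Ω y) w ∂surfaceMeasure Ω := by
        refine (integral_finsetSum _ fun x hx => ?_).symm
        refine integrable_surfaceMeasure_of_continuousOn hΩb ?_
        exact (hpC x hx).continuous.continuousOn.mul
          ((hΩ.continuousOn_exteriorNormal hΩo).inner continuousOn_const)
    _ = _ := by
        refine setIntegral_congr_fun isClosed_frontier.measurableSet fun y hy => ?_
        rw [← Finset.sum_mul, hsum y (frontier_subset_closure hy)]

end Domain

/-! ### Convolution estimates in L^p. -/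

section Mollification

variable {E F : Type*} [NormedAddCommGroup E] [InnerProductSpace ℝ E] [FiniteDimensional ℝ E]
  [MeasurableSpace E] [BorelSpace E] [NormedAddCommGroup F]

/-- Translations act continuously on `Lp` for finite p; the action is that of `DomAddAct`. -/
theorem tendsto_eLpNorm_translate_sub {p : ℝ≥0∞} (hp1 : 1 ≤ p) (hp : p ≠ ⊤) {f : E → F}
    (hf : MemLp f p) :
    Tendsto (fun y : E => eLpNorm (fun x => f (y + x) - f x) p volume) (𝓝 0) (𝓝 0) := by
  have : Fact (1 ≤ p) := ⟨hp1⟩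
  have : Fact (p ≠ ⊤) := ⟨hp⟩
  have hc : Continuous fun y : E => DomAddAct.mk y +ᵥ hf.toLp f := by
    have h1 : Continuous fun y : E => DomAddAct.mk y := DomAddAct.continuous_mk
    exact h1.vadd continuous_const
  have h2 : ∀ y : E, DomAddAct.mk y +ᵥ hf.toLp f
      = (hf.comp_measurePreserving <| measurePreserving_vadd y volume).toLp
        (f <| y +ᵥ ·) := fun y => DomAddAct.mk_vadd_toLp y hf
  have h3 : Tendsto (fun y : E => edist (DomAddAct.mk y +ᵥ hf.toLp f) (hf.toLp f)) (𝓝 0)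
      (𝓝 0) := by
    have h4 : Continuous fun y : E => edist (DomAddAct.mk y +ᵥ hf.toLp f) (hf.toLp f) :=
      hc.edist continuous_const
    have h5 := h4.tendsto 0
    simpa [h2] using h5
  refine h3.congr fun y => ?_
  rw [h2, Lp.edist_toLp_toLp]
  rfl

/-- The kernel defines a probability measure, under which the L^1 norm is at most the L^p norm, and
Tonelli averages the translation errors. The kernel need not be centred at 0: only translates in its
support matter, which leaves room for shifted mollifiers. Strong measurability of f itself gives
joint measurability of f (x - t). -/
theorem eLpNorm_mollification_sub_le [NormedSpace ℝ F] [CompleteSpace F] [MeasurableSpace F] [BorelSpace F]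
    {p : ℝ≥0∞} (hp1 : 1 ≤ p) (hp : p ≠ ⊤)
    {f : E → F} (hfm : StronglyMeasurable f) (hf : MemLp f p) {ρ : E → ℝ} (hρ : Continuous ρ)
    (hρc : HasCompactSupport ρ) (hρ0 : ∀ t, 0 ≤ ρ t) (hρ1 : ∫ t, ρ t = 1) {ε : ℝ≥0∞}
    (hε : ∀ t, ρ t ≠ 0 → eLpNorm (fun x => f (x - t) - f x) p volume ≤ ε) :
    eLpNorm (fun x => (∫ t, ρ t • f (x - t)) - f x) p volume ≤ ε := by
  have hρi : Integrable ρ := hρ.integrable_of_hasCompactSupport hρc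
  set μ : Measure E := volume.withDensity fun t => ENNReal.ofReal (ρ t) with hμ
  have hρm : Measurable fun t => ENNReal.ofReal (ρ t) :=
    ENNReal.measurable_ofReal.comp hρ.measurable
  have hprob : IsProbabilityMeasure μ := by
    refine ⟨?_⟩
    rw [hμ, withDensity_apply _ MeasurableSet.univ, Measure.restrict_univ,
      ← ofReal_integral_eq_lintegral_ofReal hρi (Filter.Eventually.of_forall hρ0), hρ1]
    simp
  have hp0 : 0 < p.toReal := ENNReal.toReal_pos (by positivity) hp
  have hpne : p ≠ 0 := by positivity
  have hloc : LocallyIntegrable f := hf.locallyIntegrable hp1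
  have hconv : ∀ x, ∫ t, ρ t • f (x - t) = ∫ t, f (x - t) ∂μ := by
    intro x
    rw [hμ, integral_withDensity_eq_integral_toReal_smul hρm (by simp)]
    simp [ENNReal.toReal_ofReal, hρ0]
  have hmeas2 : StronglyMeasurable fun z : E × E => f (z.1 - z.2) - f z.1 :=
    (hfm.comp_measurable (by fun_prop)).sub (hfm.comp_measurable measurable_fst)
  have hint : ∀ x, Integrable (fun t => f (x - t)) μ := by
    intro x
    rw [hμ, integrable_withDensity_iff_integrable_smul' hρm (by simp)]
    have h1 : LocallyIntegrable fun t => f (x - t) := by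
      intro t
      obtain ⟨U, hU, hfU⟩ := hloc (x - t)
      refine ⟨(fun t => x - t) ⁻¹' U, ?_, ?_⟩
      · exact (by fun_prop : Continuous fun t => x - t).continuousAt.preimage_mem_nhds hU
      · exact (((Measure.measurePreserving_sub_left volume x).integrableOn_comp_preimage
          (Homeomorph.subLeft x).measurableEmbedding).2 hfU)
    have h2 := h1.integrable_smul_left_of_hasCompactSupport hρ hρc
    refine h2.congr (Filter.Eventually.of_forall fun t => ?_)
    simp [ENNReal.toReal_ofReal, hρ0]
  have hpt : ∀ x, ‖(∫ t, ρ t • f (x - t)) - f x‖ₑ ^ p.toReal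
      ≤ ∫⁻ t, ‖f (x - t) - f x‖ₑ ^ p.toReal ∂μ := by
    intro x
    have h1 : (∫ t, ρ t • f (x - t)) - f x = ∫ t, (f (x - t) - f x) ∂μ := by
      rw [integral_sub (hint x) (integrable_const _), hconv]
      simp
    have hm : AEStronglyMeasurable (fun t => f (x - t) - f x) μ :=
      (hmeas2.comp_measurable (measurable_const.prodMk measurable_id)).aestronglyMeasurable
    have h2 : ‖∫ t, (f (x - t) - f x) ∂μ‖ₑ ≤ eLpNorm (fun t => f (x - t) - f x) p μ :=
      calc _ ≤ ∫⁻ t, ‖f (x - t) - f x‖ₑ ∂μ := enorm_integral_le_lintegral_enorm _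
        _ = eLpNorm (fun t => f (x - t) - f x) 1 μ := eLpNorm_one_eq_lintegral_enorm.symm
        _ ≤ _ := eLpNorm_le_eLpNorm_of_exponent_le hp1 hm
    rw [h1]
    calc _ ≤ eLpNorm (fun t => f (x - t) - f x) p μ ^ p.toReal := by gcongr
      _ = _ := by
        rw [eLpNorm_eq_lintegral_rpow_enorm_toReal hpne hp, ← ENNReal.rpow_mul,
          one_div, inv_mul_cancel₀ hp0.ne', ENNReal.rpow_one]
  rw [eLpNorm_eq_lintegral_rpow_enorm_toReal hpne hp, one_div,
    ENNReal.rpow_inv_le_iff hp0]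
  calc ∫⁻ x, ‖(∫ t, ρ t • f (x - t)) - f x‖ₑ ^ p.toReal
      ≤ ∫⁻ x, ∫⁻ t, ‖f (x - t) - f x‖ₑ ^ p.toReal ∂μ := lintegral_mono hpt
    _ = ∫⁻ t, ∫⁻ x, ‖f (x - t) - f x‖ₑ ^ p.toReal ∂volume ∂μ :=
        lintegral_lintegral_swap (hmeas2.enorm.pow_const _).aemeasurable
    _ ≤ ∫⁻ _, ε ^ p.toReal ∂μ := by
        refine lintegral_mono_ae ?_
        rw [hμ, ae_withDensity_iff hρm]
        refine Filter.Eventually.of_forall fun t ht => ?_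
        have h := hε t fun h0 => ht (by simp [h0])
        rwa [eLpNorm_eq_lintegral_rpow_enorm_toReal hpne hp, one_div,
          ENNReal.rpow_inv_le_iff hp0] at h
    _ = ε ^ p.toReal := by simp

end Mollification

/-! ### Density of functions smooth up to the boundary. -/

section Density

variable {N : ℕ} {Ω : Set (EuclideanSpace ℝ (Fin N))}

theorem gradient_apply_eq_fderiv (φ : EuclideanSpace ℝ (Fin N) → ℝ)
    (x : EuclideanSpace ℝ (Fin N)) (i : Fin N) :
    gradient φ x i = fderiv ℝ φ x (EuclideanSpace.single i 1) := by
  have h : inner ℝ (gradient φ x) (EuclideanSpace.single i (1 : ℝ))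
      = fderiv ℝ φ x (EuclideanSpace.single i 1) := by
    rw [gradient, InnerProductSpace.toDual_symm_apply]
  rw [← h, EuclideanSpace.inner_single_right]
  simp

theorem inner_gradient_eq_fderiv (φ : EuclideanSpace ℝ (Fin N) → ℝ)
    (x w : EuclideanSpace ℝ (Fin N)) : inner ℝ (gradient φ x) w = fderiv ℝ φ x w := by
  rw [gradient, InnerProductSpace.toDual_symm_apply]

theorem continuous_gradient {φ : EuclideanSpace ℝ (Fin N) → ℝ} (hφ : ContDiff ℝ 1 φ) :
    Continuous (gradient φ) :=
  (InnerProductSpace.toDual ℝ _).symm.continuous.comp (hφ.continuous_fderiv one_ne_zero)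

theorem isFiniteMeasure_restrict_of_isBounded (hΩb : Bornology.IsBounded Ω) :
    IsFiniteMeasure (volume.restrict Ω) :=
  ⟨by rw [Measure.restrict_apply_univ]; exact hΩb.measure_lt_top⟩

theorem exists_bound_of_continuous_of_isBounded (hΩb : Bornology.IsBounded Ω) {F : Type*}
    [NormedAddCommGroup F] {k : EuclideanSpace ℝ (Fin N) → F} (hk : Continuous k) :
    ∃ C, ∀ x ∈ Ω, ‖k x‖ ≤ C := by
  obtain ⟨C, hC⟩ := hΩb.isCompact_closure.exists_bound_of_continuousOn hk.continuousOn
  exact ⟨C, fun x hx => hC x (subset_closure hx)⟩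

theorem memLp_smul_of_continuous (hΩo : IsOpen Ω) (hΩb : Bornology.IsBounded Ω) {F : Type*}
    [NormedAddCommGroup F] [NormedSpace ℝ F] {p : ℝ≥0∞} {k : EuclideanSpace ℝ (Fin N) → ℝ}
    (hk : Continuous k) {f : EuclideanSpace ℝ (Fin N) → F} (hf : MemLp f p (volume.restrict Ω)) :
    MemLp (fun x => k x • f x) p (volume.restrict Ω) := by
  obtain ⟨C, hC⟩ := exists_bound_of_continuous_of_isBounded hΩb hk
  refine MemLp.of_le_mul (c := C) hf (hk.aestronglyMeasurable.smul hf.1) ?_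
  refine (ae_restrict_iff' hΩo.measurableSet).2 (Filter.Eventually.of_forall fun x hx => ?_)
  rw [norm_smul]
  gcongr
  exact hC x hx

theorem memLp_smul_continuous (hΩo : IsOpen Ω) (hΩb : Bornology.IsBounded Ω) {F : Type*}
    [NormedAddCommGroup F] [NormedSpace ℝ F] {p : ℝ≥0∞} {k : EuclideanSpace ℝ (Fin N) → F}
    (hk : Continuous k) {f : EuclideanSpace ℝ (Fin N) → ℝ} (hf : MemLp f p (volume.restrict Ω)) :
    MemLp (fun x => f x • k x) p (volume.restrict Ω) := by
  obtain ⟨C, hC⟩ := exists_bound_of_continuous_of_isBounded hΩb hk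
  refine MemLp.of_le_mul (c := C) hf (hf.1.smul hk.aestronglyMeasurable) ?_
  refine (ae_restrict_iff' hΩo.measurableSet).2 (Filter.Eventually.of_forall fun x hx => ?_)
  rw [norm_smul, mul_comm]
  gcongr
  exact hC x hx

theorem graphDefining_add_smul {E : Type*} [NormedAddCommGroup E] [InnerProductSpace ℝ E]
    {e : E} (he : ‖e‖ = 1) (γ : E → ℝ) (z : E) (s : ℝ) :
    graphDefining e γ (z + s • e) = graphDefining e γ z + s := by
  have : z + s • e - (inner ℝ e z + s) • e = z - inner ℝ e z • e := by
    rw [add_smul]; abel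
  simp [graphDefining, inner_add_right, inner_smul_right, he, this]
  ring

/-- A `C^1` domain satisfies a uniform local cone condition. -/
theorem HasC1Boundary.exists_inward_cone (hΩ : HasC1Boundary Ω) (hΩo : IsOpen Ω)
    {x₀ : EuclideanSpace ℝ (Fin N)} (hx₀ : x₀ ∈ closure Ω) :
    ∃ U ∈ 𝓝 x₀, ∃ (e : EuclideanSpace ℝ (Fin N)) (c s₀ : ℝ), 0 < c ∧ 0 < s₀ ∧
      ∀ s, 0 < s → s < s₀ → ∀ x ∈ Ω, ∀ z ∈ U, ‖x - z - s • e‖ ≤ c * s → z ∈ Ω := by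
  by_cases hx : x₀ ∈ Ω
  -- At an interior point the neighbourhood can be Ω itself, and no shift is needed.
  · exact ⟨Ω, hΩo.mem_nhds hx, 0, 1, 1, one_pos, one_pos, fun _ _ _ _ _ _ hz _ => hz⟩
  obtain ⟨r, e, γ, hr, he, hγ, h⟩ := hΩ x₀ (by rw [hΩo.frontier_eq]; exact ⟨hx₀, hx⟩)
  obtain ⟨L, V, hV, hLV⟩ := (contDiff_graphDefining (e := e) hγ).contDiffAt.exists_lipschitzOnWith
    (x := x₀)
  obtain ⟨δ, hδ, hδV⟩ := Metric.mem_nhds_iff.1 (inter_mem hV (Metric.ball_mem_nhds x₀ hr))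
  -- Let L be a Lipschitz constant of the defining function on the δ-ball. Moving by at most c s
  -- changes it by less than s as c L < 1, while the step s e changes it by exactly s. Since c ≤ 1
  -- and s < δ/4, all points stay in that ball.
  refine ⟨Metric.ball x₀ (δ / 2), Metric.ball_mem_nhds _ (half_pos hδ), e, 1 / (2 * (L + 1)), δ / 4,
    by positivity, by positivity, fun s hs0 hs x hxΩ z hz hxz => ?_⟩
  have hL : (0 : ℝ) ≤ L := L.2
  have hc1 : 1 / (2 * ((L : ℝ) + 1)) ≤ 1 := by
    rw [div_le_one (by positivity)]; linarith
  have hLc : (L : ℝ) * (1 / (2 * ((L : ℝ) + 1))) < 1 := by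
    rw [mul_one_div, div_lt_one (by positivity)]; linarith
  rw [Metric.mem_ball, dist_eq_norm] at hz
  have hse : ‖s • e‖ = s := by rw [norm_smul, he, mul_one, Real.norm_of_nonneg hs0.le]
  have hzs : z + s • e ∈ Metric.ball x₀ δ := by
    rw [Metric.mem_ball, dist_eq_norm]
    calc ‖z + s • e - x₀‖ = ‖(z - x₀) + s • e‖ := by congr 1; abel
      _ ≤ ‖z - x₀‖ + ‖s • e‖ := norm_add_le _ _
      _ < δ := by rw [hse]; linarith
  have hx' : x ∈ Metric.ball x₀ δ := by
    rw [Metric.mem_ball, dist_eq_norm]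
    calc ‖x - x₀‖ = ‖(x - z - s • e) + ((z - x₀) + s • e)‖ := by congr 1; abel
      _ ≤ ‖x - z - s • e‖ + (‖z - x₀‖ + ‖s • e‖) :=
        (norm_add_le _ _).trans (by gcongr; exact norm_add_le _ _)
      _ < δ := by rw [hse]; nlinarith
  have hz' : z ∈ Metric.ball x₀ δ := by
    rw [Metric.mem_ball, dist_eq_norm]; linarith
  have h1 := hLV.dist_le_mul x (hδV hx').1 _ (hδV hzs).1
  rw [dist_eq_norm, dist_eq_norm, graphDefining_add_smul he, ← sub_sub x z, Real.norm_eq_abs] at h1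
  have h2 := (abs_le.1 h1).1
  have h3 : graphDefining e γ x < 0 := by
    rw [graphDefining, sub_neg, ← h x (hδV hx').2]; exact hxΩ
  have h4 : (L : ℝ) * ‖x - z - s • e‖ < s := by
    calc (L : ℝ) * ‖x - z - s • e‖ ≤ L * (1 / (2 * (L + 1)) * s) := by gcongr
      _ = L * (1 / (2 * (L + 1))) * s := by ring
      _ < 1 * s := by gcongr
      _ = s := one_mul s
  rw [h z (hδV hz').2, ← sub_neg]
  change graphDefining e γ z < 0
  linarith

/-- The derivative falls on the kernel, where it can be read as that of a test function in the weak
gradient identity. -/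
theorem fderiv_convolution_apply {ρ f : EuclideanSpace ℝ (Fin N) → ℝ} (hρ : ContDiff ℝ 1 ρ)
    (hρc : HasCompactSupport ρ) (hf : LocallyIntegrable f) (x v : EuclideanSpace ℝ (Fin N)) :
    fderiv ℝ (fun x => ∫ t, ρ t • f (x - t)) x v = ∫ z, fderiv ℝ ρ (x - z) v * f z := by
  have h1 := hρc.hasFDerivAt_convolution_left (ContinuousLinearMap.lsmul ℝ ℝ) hρ hf x
  have h2 : (fun x => ∫ t, ρ t • f (x - t))
      = convolution ρ f (ContinuousLinearMap.lsmul ℝ ℝ) volume := rfl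
  have h3 : ConvolutionExists (fderiv ℝ ρ) f
      ((ContinuousLinearMap.lsmul ℝ ℝ).precompL (EuclideanSpace ℝ (Fin N))) volume :=
    (hρc.fderiv ℝ).convolutionExists_left _ (hρ.continuous_fderiv one_ne_zero) hf
  rw [h2, h1.fderiv, convolution, ContinuousLinearMap.integral_apply (h3 x),
    ← integral_sub_left_eq_self _ volume x]
  simp

/-- Mollification in the direction of an inward cone, for one patch of a partition of unity. -/
theorem exists_contDiff_approx_patch (hΩo : IsOpen Ω) (hΩb : Bornology.IsBounded Ω)
    {p : ℝ≥0∞} (hp1 : 1 ≤ p) (hp : p ≠ ⊤) {U : Set (EuclideanSpace ℝ (Fin N))}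
    {e : EuclideanSpace ℝ (Fin N)} {c s₀ : ℝ} (hc : 0 < c) (hs₀ : 0 < s₀)
    (hcone : ∀ s, 0 < s → s < s₀ → ∀ x ∈ Ω, ∀ z ∈ U, ‖x - z - s • e‖ ≤ c * s → z ∈ Ω)
    {η : EuclideanSpace ℝ (Fin N) → ℝ} (hη : ContDiff ℝ ∞ η) (hηc : HasCompactSupport η)
    (hηU : tsupport η ⊆ U)
    {w : EuclideanSpace ℝ (Fin N) → ℝ} {Dw : EuclideanSpace ℝ (Fin N) → EuclideanSpace ℝ (Fin N)}
    (hw : MemW1 Ω p w Dw) {ε : ℝ≥0∞} (hε : 0 < ε) :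
    ∃ φ : EuclideanSpace ℝ (Fin N) → ℝ, ContDiff ℝ ∞ φ ∧
      eLpNorm (fun x => φ x - η x * w x) p (volume.restrict Ω) ≤ ε ∧
      eLpNorm (fun x => gradient φ x - (w x • gradient η x + η x • Dw x)) p
        (volume.restrict Ω) ≤ ε := by
  obtain ⟨hwp, hDp, -, -, hweak⟩ := hw
  have hfin := isFiniteMeasure_restrict_of_isBounded hΩb
  have hwi : IntegrableOn w Ω := hwp.integrable hp1
  have hDi : IntegrableOn Dw Ω := hDp.integrable hp1
  have hη1 : ContDiff ℝ 1 η := hη.of_le (by exact_mod_cast le_top)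
  have hf0 : MemLp (Ω.indicator fun z => η z * w z) p :=
    (memLp_indicator_iff_restrict hΩo.measurableSet).2
      (memLp_smul_of_continuous hΩo hΩb hη.continuous hwp)
  have hF0 : MemLp (Ω.indicator fun z => w z • gradient η z + η z • Dw z) p :=
    (memLp_indicator_iff_restrict hΩo.measurableSet).2
      ((memLp_smul_continuous hΩo hΩb (continuous_gradient hη1) hwp).add
        (memLp_smul_of_continuous hΩo hΩb hη.continuous hDp))
  -- Here f and F extend η w and its weak gradient by zero, in strongly measurable form. F is in
  -- general not the weak gradient of f across ∂Ω; the two are related only at points of Ω, after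
  -- the shifted convolution.
  set f := hf0.1.mk _ with hf
  set F := hF0.1.mk _ with hF
  have hfeq := hf0.1.ae_eq_mk
  have hFeq := hF0.1.ae_eq_mk
  rw [← hf] at hfeq
  rw [← hF] at hFeq
  have hfm : StronglyMeasurable f := hf0.1.stronglyMeasurable_mk
  have hFm : StronglyMeasurable F := hF0.1.stronglyMeasurable_mk
  have hfp : MemLp f p := (memLp_congr_ae hfeq).1 hf0
  have hFp : MemLp F p := (memLp_congr_ae hFeq).1 hF0
  clear_value f F
  have hsmall : ∀ᶠ y in 𝓝 (0 : EuclideanSpace ℝ (Fin N)),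
      eLpNorm (fun x => f (y + x) - f x) p volume ≤ ε ∧
      eLpNorm (fun x => F (y + x) - F x) p volume ≤ ε :=
    ((tendsto_eLpNorm_translate_sub hp1 hp hfp).eventually (ge_mem_nhds hε)).and
      ((tendsto_eLpNorm_translate_sub hp1 hp hFp).eventually (ge_mem_nhds hε))
  obtain ⟨δ, hδ, hδs⟩ := Metric.eventually_nhds_iff.1 hsmall
  -- The kernel will live in the closed ball of radius c s about s e, so its support has norm at
  -- most s (‖e‖ + c); this keeps every translation below the threshold δ.
  obtain ⟨s, hs0, hss₀, hsδ⟩ : ∃ s, 0 < s ∧ s < s₀ ∧ s * (‖e‖ + c) < δ := by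
    have : 0 < ‖e‖ + c := by positivity
    refine ⟨min (s₀ / 2) (δ / (2 * (‖e‖ + c))), by positivity, ?_, ?_⟩
    · exact (min_le_left _ _).trans_lt (by linarith)
    · calc _ ≤ δ / (2 * (‖e‖ + c)) * (‖e‖ + c) := by gcongr; exact min_le_right _ _
        _ = δ / 2 := by field_simp
        _ < δ := by linarith
  let b : ContDiffBump (s • e) := ⟨c * s / 2, c * s, by positivity, by linarith [mul_pos hc hs0]⟩
  set ρ : EuclideanSpace ℝ (Fin N) → ℝ := b.normed volume with hρdef
  have hρC : ContDiff ℝ ∞ ρ := b.contDiff_normed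
  have hρC1 : ContDiff ℝ 1 ρ := hρC.of_le (by exact_mod_cast le_top)
  have hρc : HasCompactSupport ρ := b.hasCompactSupport_normed
  have hρ0 : ∀ t, 0 ≤ ρ t := b.nonneg_normed
  have hρ1 : ∫ t, ρ t = 1 := b.integral_normed
  have hρs : tsupport ρ = Metric.closedBall (s • e) (c * s) := b.tsupport_normed_eq
  have htr : ∀ t, ρ t ≠ 0 → dist (-t) 0 < δ := by
    intro t ht
    have h1 : t ∈ tsupport ρ := subset_tsupport _ ht
    rw [hρs, Metric.mem_closedBall, dist_eq_norm] at h1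
    rw [dist_zero_right, norm_neg]
    calc ‖t‖ = ‖(t - s • e) + s • e‖ := by congr 1; abel
      _ ≤ ‖t - s • e‖ + ‖s • e‖ := norm_add_le _ _
      _ ≤ c * s + s * ‖e‖ := by rw [norm_smul, Real.norm_of_nonneg hs0.le]; gcongr
      _ < δ := by linarith
  have hmf := eLpNorm_mollification_sub_le hp1 hp hfm hfp hρC.continuous hρc hρ0 hρ1 (ε := ε)
    fun t ht => by simpa [neg_add_eq_sub] using (hδs (htr t ht)).1
  have hmF := eLpNorm_mollification_sub_le hp1 hp hFm hFp hρC.continuous hρc hρ0 hρ1 (ε := ε)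
    fun t ht => by simpa [neg_add_eq_sub] using (hδs (htr t ht)).2
  have hfl : LocallyIntegrable f := hfp.locallyIntegrable hp1
  have hFl : LocallyIntegrable F := hFp.locallyIntegrable hp1
  refine ⟨fun x => ∫ t, ρ t • f (x - t), ?_, ?_, ?_⟩
  · exact hρc.contDiff_convolution_left (ContinuousLinearMap.lsmul ℝ ℝ) hρC hfl
  · refine le_trans (eLpNorm_congr_ae ?_).le ((eLpNorm_mono_measure _ Measure.restrict_le_self).trans
      hmf)
    filter_upwards [ae_restrict_of_ae hfeq, ae_restrict_mem hΩo.measurableSet] with x hx hxΩ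
    rw [← hx, indicator_of_mem hxΩ]
  · have hgrad : ∀ x ∈ Ω, gradient (fun x => ∫ t, ρ t • f (x - t)) x = ∫ t, ρ t • F (x - t) := by
      intro x hx
      ext i
      have hFint : Integrable fun t => ρ t • F (x - t) :=
        hρc.convolutionExists_left (ContinuousLinearMap.lsmul ℝ ℝ) hρC.continuous hFl x
      have hcoord : (∫ t, ρ t • F (x - t)) i = ∫ t, (ρ t • F (x - t)) i :=
        ((EuclideanSpace.proj (𝕜 := ℝ) i).integral_comp_comm hFint).symm
      rw [gradient_apply_eq_fderiv, fderiv_convolution_apply hρC1 hρc hfl, hcoord,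
        ← integral_sub_left_eq_self (fun t => (ρ t • F (x - t)) i) volume x]
      simp only [sub_sub_cancel, PiLp.smul_apply, smul_eq_mul]
      set v : EuclideanSpace ℝ (Fin N) := EuclideanSpace.single i 1 with hv
      have hleft : ∫ z, fderiv ℝ ρ (x - z) v * f z
          = ∫ z in Ω, fderiv ℝ ρ (x - z) v * (η z * w z) := by
        rw [← integral_indicator hΩo.measurableSet]
        refine integral_congr_ae ?_
        filter_upwards [hfeq] with z hz
        rw [← hz]
        by_cases hzΩ : z ∈ Ω <;> simp [hzΩ]
      have hright : ∫ z, ρ (x - z) * F z i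
          = ∫ z in Ω, ρ (x - z) * (w z * gradient η z i + η z * Dw z i) := by
        rw [← integral_indicator hΩo.measurableSet]
        refine integral_congr_ae ?_
        filter_upwards [hFeq] with z hz
        rw [← hz]
        by_cases hzΩ : z ∈ Ω <;> simp [hzΩ]
      rw [hleft, hright]
      -- For x in Ω the cone condition places the support of θ inside Ω. Testing the weak gradient
      -- of w with θ gives ∇(ρ * f) = ρ * F at x.
      set θ : EuclideanSpace ℝ (Fin N) → ℝ := fun z => ρ (x - z) * η z with hθ
      have hsubC : ContDiff ℝ ∞ fun z : EuclideanSpace ℝ (Fin N) => x - z :=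
        contDiff_const.sub contDiff_id
      have hθC : ContDiff ℝ ∞ θ := (hρC.comp hsubC).mul hη
      have hθc : HasCompactSupport θ := hηc.mul_left
      have hθs : tsupport θ ⊆ Ω := by
        intro z hz
        have h1 : z ∈ tsupport η := tsupport_mul_subset_right hz
        have h2 : z ∈ (fun z => x - z) ⁻¹' tsupport ρ :=
          tsupport_comp_subset_preimage ρ (by fun_prop) (tsupport_mul_subset_left hz)
        rw [hρs, mem_preimage, Metric.mem_closedBall, dist_eq_norm] at h2
        exact hcone s hs0 hss₀ x hx z (hηU h1) h2
      have hdθ : ∀ z, gradient θ z i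
          = -(fderiv ℝ ρ (x - z) v * η z) + ρ (x - z) * gradient η z i := by
        intro z
        have h1 : HasFDerivAt (fun z => ρ (x - z)) _ z :=
          (hρC1.differentiable one_ne_zero (x - z)).hasFDerivAt.comp z
            ((hasFDerivAt_id z).const_sub x)
        have h2 : HasFDerivAt θ _ z := h1.mul (hη1.differentiable one_ne_zero z).hasFDerivAt
        rw [gradient_apply_eq_fderiv, gradient_apply_eq_fderiv, h2.fderiv]
        simp only [add_apply, smul_apply, ContinuousLinearMap.comp_apply,
          neg_apply, ContinuousLinearMap.id_apply, map_neg, smul_eq_mul]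
        ring
      have hid := hweak θ ⟨hθC, hθc, hθs⟩ i
      simp only [hdθ] at hid
      have hA : IntegrableOn (fun z => fderiv ℝ ρ (x - z) v * (η z * w z)) Ω := by
        have hk : Continuous fun z => fderiv ℝ ρ (x - z) v * η z := by
          have := hρC1.continuous_fderiv one_ne_zero
          have := hη.continuous
          fun_prop
        have := (memLp_smul_of_continuous hΩo hΩb hk (memLp_one_iff_integrable.2 hwi))
        refine (memLp_one_iff_integrable.1 this).congr (Filter.Eventually.of_forall fun z => ?_)
        simp [mul_assoc]
      have hB : IntegrableOn (fun z => ρ (x - z) * (w z * gradient η z i)) Ω := by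
        have hk : Continuous fun z => ρ (x - z) * gradient η z i := by
          have := continuous_gradient hη1
          have := hρC.continuous
          fun_prop
        have := (memLp_smul_of_continuous hΩo hΩb hk (memLp_one_iff_integrable.2 hwi))
        refine (memLp_one_iff_integrable.1 this).congr (Filter.Eventually.of_forall fun z => ?_)
        simp only [smul_eq_mul]; ring
      have hC : IntegrableOn (fun z => ρ (x - z) * (η z * Dw z i)) Ω := by
        have hk : Continuous fun z => ρ (x - z) * η z := by
          have := hρC.continuous
          have := hη.continuous
          fun_prop
        have hDi' : IntegrableOn (fun z => Dw z i) Ω :=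
          (EuclideanSpace.proj (𝕜 := ℝ) i).integrable_comp hDi
        have := (memLp_smul_of_continuous hΩo hΩb hk (memLp_one_iff_integrable.2 hDi'))
        refine (memLp_one_iff_integrable.1 this).congr (Filter.Eventually.of_forall fun z => ?_)
        simp only [smul_eq_mul]; ring
      have e1 : ∫ z in Ω, w z * (-(fderiv ℝ ρ (x - z) v * η z) + ρ (x - z) * gradient η z i)
          = (∫ z in Ω, ρ (x - z) * (w z * gradient η z i))
            - ∫ z in Ω, fderiv ℝ ρ (x - z) v * (η z * w z) := by
        rw [← integral_sub hB hA]
        congr 1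
        ext z
        ring
      have e2 : ∫ z in Ω, Dw z i * θ z = ∫ z in Ω, ρ (x - z) * (η z * Dw z i) := by
        congr 1
        ext z
        simp only [hθ]
        ring
      have e3 : ∫ z in Ω, ρ (x - z) * (w z * gradient η z i + η z * Dw z i)
          = (∫ z in Ω, ρ (x - z) * (w z * gradient η z i))
            + ∫ z in Ω, ρ (x - z) * (η z * Dw z i) := by
        rw [← integral_add hB hC]
        congr 1
        ext z
        ring
      rw [e1, e2] at hid
      rw [e3]
      linarith
    refine le_trans (eLpNorm_congr_ae ?_).le ((eLpNorm_mono_measure _ Measure.restrict_le_self).trans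
      hmF)
    filter_upwards [ae_restrict_of_ae hFeq, ae_restrict_mem hΩo.measurableSet] with x hx hxΩ
    rw [← hx, indicator_of_mem hxΩ, hgrad x hxΩ]

/-- Functions smooth up to the boundary are dense in `W^{1,p}(Ω)`. -/
theorem HasC1Boundary.exists_contDiff_approx (hΩ : HasC1Boundary Ω) (hΩo : IsOpen Ω)
    (hΩb : Bornology.IsBounded Ω) {p : ℝ≥0∞} (hp1 : 1 ≤ p) (hp : p ≠ ⊤)
    {w : EuclideanSpace ℝ (Fin N) → ℝ} {Dw : EuclideanSpace ℝ (Fin N) → EuclideanSpace ℝ (Fin N)}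
    (hw : MemW1 Ω p w Dw) {ε : ℝ≥0∞} (hε : 0 < ε) :
    ∃ φ : EuclideanSpace ℝ (Fin N) → ℝ, ContDiff ℝ ∞ φ ∧
      eLpNorm (fun x => φ x - w x) p (volume.restrict Ω) ≤ ε ∧
      eLpNorm (fun x => gradient φ x - Dw x) p (volume.restrict Ω) ≤ ε := by
  have hloc : ∀ x₀ ∈ closure Ω, ∃ U ∈ 𝓝 x₀, ∀ η : EuclideanSpace ℝ (Fin N) → ℝ, ContDiff ℝ ∞ η →
      HasCompactSupport η → tsupport η ⊆ U → ∀ ε : ℝ≥0∞, 0 < ε →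
      ∃ φ : EuclideanSpace ℝ (Fin N) → ℝ, ContDiff ℝ ∞ φ ∧
      eLpNorm (fun x => φ x - η x * w x) p (volume.restrict Ω) ≤ ε ∧
      eLpNorm (fun x => gradient φ x - (w x • gradient η x + η x • Dw x)) p
        (volume.restrict Ω) ≤ ε := by
    intro x₀ hx₀
    obtain ⟨U, hU, e, c, s₀, hc, hs₀, hcone⟩ := hΩ.exists_inward_cone hΩo hx₀
    exact ⟨U, hU, fun η h1 h2 h3 ε hε =>
      exists_contDiff_approx_patch hΩo hΩb hp1 hp hc hs₀ hcone h1 h2 h3 hw hε⟩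
  choose! U hU happ using hloc
  obtain ⟨t, η, htK, hηC, hηc, hηU, -, hη1⟩ := exists_contDiff_partition hΩb.isCompact_closure hU
  -- The summand 1 covers an empty partition.
  have hε' : 0 < ε / (t.card + 1) := ENNReal.div_pos hε.ne' (by finiteness)
  have hch : ∀ x ∈ t, ∃ φ : EuclideanSpace ℝ (Fin N) → ℝ, ContDiff ℝ ∞ φ ∧
      eLpNorm (fun y => φ y - η x y * w y) p (volume.restrict Ω) ≤ ε / (t.card + 1) ∧
      eLpNorm (fun y => gradient φ y - (w y • gradient (η x) y + η x y • Dw y)) p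
        (volume.restrict Ω) ≤ ε / (t.card + 1) := fun x hx =>
    happ x (htK x hx) (η x) (hηC x hx) (hηc x hx) (hηU x hx) _ hε'
  choose! φ hφC hφ1 hφ2 using hch
  have hcard : ∑ _x ∈ t, ε / (t.card + 1) ≤ ε := by
    rw [Finset.sum_const, nsmul_eq_mul]
    calc (t.card : ℝ≥0∞) * (ε / (t.card + 1)) ≤ (t.card + 1) * (ε / (t.card + 1)) := by
          gcongr; exact le_self_add
      _ = ε := ENNReal.mul_div_cancel (by positivity) (by finiteness)
  have hdiff : ∀ x ∈ t, Differentiable ℝ (φ x) := fun x hx => (hφC x hx).differentiable (by simp)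
  have hηdiff : ∀ x ∈ t, Differentiable ℝ (η x) := fun x hx => (hηC x hx).differentiable (by simp)
  -- Consequently the terms w ∇η of the patch gradients cancel in the sum.
  have hη0 : ∀ y ∈ Ω, ∑ x ∈ t, gradient (η x) y = 0 := by
    intro y hy
    have h1 : (fun z => ∑ x ∈ t, η x z) =ᶠ[𝓝 y] fun _ => 1 := by
      filter_upwards [hΩo.mem_nhds hy] with z hz using hη1 z (subset_closure hz)
    have h2 := h1.fderiv_eq (𝕜 := ℝ)
    rw [fderiv_fun_sum fun x hx => hηdiff x hx y] at h2
    simp only [gradient, ← map_sum, h2]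
    simp
  have hgr : ∀ y, gradient (fun y => ∑ x ∈ t, φ x y) y = ∑ x ∈ t, gradient (φ x) y := by
    intro y
    simp only [gradient, ← map_sum]
    rw [fderiv_fun_sum fun x hx => hdiff x hx y]
  have hmeasφ : ∀ x ∈ t, AEStronglyMeasurable (fun y => φ x y - η x y * w y) (volume.restrict Ω) :=
    fun x hx => (hφC x hx).continuous.aestronglyMeasurable.sub
      ((hηC x hx).continuous.aestronglyMeasurable.mul hw.1.1)
  have hmeasg : ∀ x ∈ t, AEStronglyMeasurable
      (fun y => gradient (φ x) y - (w y • gradient (η x) y + η x y • Dw y))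
      (volume.restrict Ω) := fun x hx =>
    (continuous_gradient ((hφC x hx).of_le (by exact_mod_cast le_top))).aestronglyMeasurable.sub
      ((hw.1.1.smul (continuous_gradient
        ((hηC x hx).of_le (by exact_mod_cast le_top))).aestronglyMeasurable).add
        ((hηC x hx).continuous.aestronglyMeasurable.smul hw.2.1.1))
  refine ⟨fun y => ∑ x ∈ t, φ x y, ContDiff.sum fun x hx => hφC x hx, ?_, ?_⟩
  · calc eLpNorm (fun y => (∑ x ∈ t, φ x y) - w y) p (volume.restrict Ω)
        = eLpNorm (∑ x ∈ t, fun y => φ x y - η x y * w y) p (volume.restrict Ω) := by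
          refine eLpNorm_congr_ae ?_
          filter_upwards [ae_restrict_mem hΩo.measurableSet] with y hy
          rw [Finset.sum_apply, Finset.sum_sub_distrib, ← Finset.sum_mul, hη1 y (subset_closure hy),
            one_mul]
      _ ≤ ∑ x ∈ t, eLpNorm (fun y => φ x y - η x y * w y) p (volume.restrict Ω) :=
          eLpNorm_sum_le hmeasφ hp1
      _ ≤ ∑ _x ∈ t, ε / (t.card + 1) := Finset.sum_le_sum hφ1
      _ ≤ ε := hcard
  · calc eLpNorm (fun y => gradient (fun y => ∑ x ∈ t, φ x y) y - Dw y) p (volume.restrict Ω)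
        = eLpNorm (∑ x ∈ t, fun y => gradient (φ x) y - (w y • gradient (η x) y + η x y • Dw y)) p
          (volume.restrict Ω) := by
          refine eLpNorm_congr_ae ?_
          filter_upwards [ae_restrict_mem hΩo.measurableSet] with y hy
          rw [Finset.sum_apply, Finset.sum_sub_distrib, Finset.sum_add_distrib, ← Finset.smul_sum,
            ← Finset.sum_smul, hη1 y (subset_closure hy), hη0 y hy, hgr, smul_zero, zero_add,
            one_smul]
      _ ≤ ∑ x ∈ t, eLpNorm (fun y => gradient (φ x) y - (w y • gradient (η x) y + η x y • Dw y)) p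
          (volume.restrict Ω) := eLpNorm_sum_le hmeasg hp1
      _ ≤ ∑ _x ∈ t, ε / (t.card + 1) := Finset.sum_le_sum hφ2
      _ ≤ ε := hcard

end Density

/-! ### The trace inequality and existence of traces. -/

section Trace

variable {N : ℕ} {Ω : Set (EuclideanSpace ℝ (Fin N))}

/-- A crude Young inequality: replace the smaller of the two numbers by the larger. -/
theorem rpow_sub_one_mul_le {a b r : ℝ} (ha : 0 ≤ a) (hb : 0 ≤ b) (hr : 1 < r) :
    a ^ (r - 1) * b ≤ a ^ r + b ^ r := by
  have h1 : ∀ {c : ℝ}, 0 ≤ c → c ^ (r - 1) * c = c ^ r := fun {c} hc => by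
    rw [← Real.rpow_add_one' hc (by linarith), sub_add_cancel]
  rcases le_total a b with h | h
  · calc a ^ (r - 1) * b ≤ b ^ (r - 1) * b := by gcongr
      _ = b ^ r := h1 hb
      _ ≤ a ^ r + b ^ r := by linarith [Real.rpow_nonneg ha r]
  · calc a ^ (r - 1) * b ≤ a ^ (r - 1) * a := by gcongr
      _ = a ^ r := h1 ha
      _ ≤ a ^ r + b ^ r := by linarith [Real.rpow_nonneg hb r]

theorem norm_gradient (φ : EuclideanSpace ℝ (Fin N) → ℝ) (x : EuclideanSpace ℝ (Fin N)) :
    ‖gradient φ x‖ = ‖fderiv ℝ φ x‖ := by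
  rw [gradient, LinearIsometryEquiv.norm_map]

/-- The integral trace inequality, for functions which are `C^1` up to the boundary. -/
theorem HasC1Boundary.exists_integral_trace_le (hΩ : HasC1Boundary Ω) (hΩo : IsOpen Ω)
    (hΩb : Bornology.IsBounded Ω) {r : ℝ} (hr : 1 < r) :
    ∃ C : ℝ, 0 ≤ C ∧ ∀ φ : EuclideanSpace ℝ (Fin N) → ℝ, ContDiff ℝ 1 φ →
      ∫ x, ‖φ x‖ ^ r ∂surfaceMeasure Ω
        ≤ C * ((∫ x in Ω, ‖φ x‖ ^ r) + ∫ x in Ω, ‖gradient φ x‖ ^ r) := by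
  have hfin := hΩ.isFiniteMeasure_surfaceMeasure hΩo hΩb
  have hνc := hΩ.continuousOn_exteriorNormal hΩo
  -- By continuity of the normal, the constant direction ν(x) is transversal to ∂Ω near x.
  -- Gauss-Green for η |φ|^r in that direction then controls half the boundary integral of η |φ|^r,
  -- and r > 1 makes |φ|^r of class C^1.
  have hnear : ∀ x ∈ frontier Ω, {y | y ∈ frontier Ω →
      1 / 2 < inner ℝ (exteriorNormal Ω y) (exteriorNormal Ω x)} ∈ 𝓝 x := by
    intro x hx
    have h1 : ContinuousWithinAt
        (fun y => inner ℝ (exteriorNormal Ω y) (exteriorNormal Ω x)) (frontier Ω) x :=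
      (hνc x hx).inner continuousWithinAt_const
    have h2 : (1 / 2 : ℝ) < inner ℝ (exteriorNormal Ω x) (exteriorNormal Ω x) := by
      rw [real_inner_self_eq_norm_sq, (hΩ.isExteriorUnitNormal hΩo hx).1]; norm_num
    exact mem_nhdsWithin_iff_eventually.1 (h1.eventually (lt_mem_nhds h2))
  obtain ⟨t, η, htK, hηC, hηc, hηU, hη0, hη1⟩ :=
    exists_contDiff_partition (isCompact_frontier_of_isBounded hΩb) hnear
  have hηC1 : ∀ x ∈ t, ContDiff ℝ 1 (η x) := fun x hx =>
    (hηC x hx).of_le (by exact_mod_cast le_top)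
  have hb1 : ∀ x ∈ t, ∃ A, ∀ y ∈ Ω, ‖η x y‖ ≤ A := fun x hx =>
    exists_bound_of_continuous_of_isBounded hΩb (hηC x hx).continuous
  have hb2 : ∀ x ∈ t, ∃ B, ∀ y ∈ Ω, ‖fderiv ℝ (η x) y‖ ≤ B := fun x hx =>
    exists_bound_of_continuous_of_isBounded hΩb ((hηC1 x hx).continuous_fderiv one_ne_zero)
  choose! A hA using hb1
  choose! B hB using hb2
  have hconst : ∀ x ∈ t, ∀ φ : EuclideanSpace ℝ (Fin N) → ℝ, ContDiff ℝ 1 φ → ∀ y ∈ Ω,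
      fderiv ℝ (fun y => η x y * ‖φ y‖ ^ r) y (exteriorNormal Ω x)
        ≤ (|A x| * r + |B x|) * (‖φ y‖ ^ r + ‖gradient φ y‖ ^ r) := by
    intro x hx φ hφ y hy
    have h1 := ((hηC1 x hx).differentiable one_ne_zero y).hasFDerivAt
    have h2 := (((contDiff_norm_rpow hr).comp hφ).differentiable one_ne_zero y).hasFDerivAt
    have h3 : HasFDerivAt (fun y => η x y * ‖φ y‖ ^ r) _ y := h1.mul h2
    have h4 : ‖fderiv ℝ (fun y => ‖φ y‖ ^ r) y‖ ≤ r * ‖φ y‖ ^ (r - 1) * ‖fderiv ℝ φ y‖ :=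
      norm_fderiv_norm_rpow_le (hφ.differentiable one_ne_zero) hr
    have hn : ‖exteriorNormal Ω x‖ = 1 := (hΩ.isExteriorUnitNormal hΩo (htK x hx)).1
    rw [h3.fderiv, norm_gradient]
    have hφ0 : 0 ≤ ‖φ y‖ ^ r := by positivity
    have hg0 : 0 ≤ ‖fderiv ℝ φ y‖ ^ r := by positivity
    have hA' : ‖η x y‖ ≤ |A x| := (hA x hx y hy).trans (le_abs_self _)
    have hB' : ‖fderiv ℝ (η x) y‖ ≤ |B x| := (hB x hx y hy).trans (le_abs_self _)
    refine (le_abs_self _).trans ?_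
    rw [← Real.norm_eq_abs]
    refine (ContinuousLinearMap.le_opNorm _ _).trans ?_
    rw [hn, mul_one]
    refine (norm_add_le _ _).trans ?_
    rw [norm_smul, norm_smul]
    have e1 : ‖η x y‖ * ‖fderiv ℝ ((fun x => ‖x‖ ^ r) ∘ φ) y‖
        ≤ |A x| * (r * (‖φ y‖ ^ r + ‖fderiv ℝ φ y‖ ^ r)) := by
      refine mul_le_mul hA' (h4.trans ?_) (norm_nonneg _) (abs_nonneg _)
      rw [mul_assoc]
      gcongr
      exact rpow_sub_one_mul_le (norm_nonneg _) (norm_nonneg _) hr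
    have e2 : ‖((fun x => ‖x‖ ^ r) ∘ φ) y‖ * ‖fderiv ℝ (η x) y‖
        ≤ |B x| * (‖φ y‖ ^ r + ‖fderiv ℝ φ y‖ ^ r) := by
      rw [Function.comp_apply, Real.norm_of_nonneg hφ0, mul_comm]
      refine mul_le_mul hB' (by linarith) hφ0 (abs_nonneg _)
    calc _ ≤ _ := add_le_add e1 e2
      _ = _ := by ring
  refine ⟨2 * ∑ x ∈ t, (|A x| * r + |B x|), by positivity, fun φ hφ => ?_⟩
  have hφr : ContDiff ℝ 1 fun y => ‖φ y‖ ^ r := (contDiff_norm_rpow hr).comp hφ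
  have hpC : ∀ x ∈ t, ContDiff ℝ 1 fun y => η x y * ‖φ y‖ ^ r := fun x hx =>
    (hηC1 x hx).mul hφr
  have hgr : Continuous fun y => ‖gradient φ y‖ ^ r :=
    (continuous_gradient hφ).norm.rpow_const fun _ => Or.inr (by linarith)
  have hI1 : IntegrableOn (fun y => ‖φ y‖ ^ r) Ω :=
    integrableOn_of_continuous_of_isBounded hΩb hφr.continuous
  have hI2 : IntegrableOn (fun y => ‖gradient φ y‖ ^ r) Ω :=
    integrableOn_of_continuous_of_isBounded hΩb hgr
  have hbd : ∀ x ∈ t, ContinuousOn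
      (fun y => η x y * ‖φ y‖ ^ r * inner ℝ (exteriorNormal Ω y) (exteriorNormal Ω x))
      (frontier Ω) := fun x hx =>
    (hpC x hx).continuous.continuousOn.mul (hνc.inner continuousOn_const)
  have hlow : ∫ x, ‖φ x‖ ^ r ∂surfaceMeasure Ω
      ≤ 2 * ∑ x ∈ t, ∫ y, η x y * ‖φ y‖ ^ r * inner ℝ (exteriorNormal Ω y) (exteriorNormal Ω x)
        ∂surfaceMeasure Ω := by
    rw [← integral_finsetSum _ fun x hx => integrable_surfaceMeasure_of_continuousOn hΩb
      (hbd x hx), ← integral_const_mul]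
    refine integral_mono_ae ?_ ?_ ?_
    · exact integrable_surfaceMeasure_of_continuousOn hΩb hφr.continuous.continuousOn
    · exact (integrable_finsetSum _ fun x hx => integrable_surfaceMeasure_of_continuousOn hΩb
        (hbd x hx)).const_mul _
    · refine (ae_restrict_iff' isClosed_frontier.measurableSet).2
        (Filter.Eventually.of_forall fun y hy => ?_)
      have hterm : ∀ x ∈ t, η x y * ‖φ y‖ ^ r * (1 / 2)
          ≤ η x y * ‖φ y‖ ^ r * inner ℝ (exteriorNormal Ω y) (exteriorNormal Ω x) := by
        intro x hx
        by_cases hyx : y ∈ tsupport (η x)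
        · have := hηU x hx hyx hy
          exact mul_le_mul_of_nonneg_left this.le (mul_nonneg (hη0 x y) (by positivity))
        · simp [image_eq_zero_of_notMem_tsupport hyx]
      have h5 := Finset.sum_le_sum hterm
      rw [← Finset.sum_mul, ← Finset.sum_mul, hη1 y hy] at h5
      dsimp only
      linarith
  refine hlow.trans ?_
  rw [mul_assoc, Finset.sum_mul, ← integral_add hI1 hI2]
  gcongr with x hx
  rw [← hΩ.setIntegral_fderiv hΩo hΩb (hpC x hx), ← integral_const_mul]
  refine setIntegral_mono_on ?_ ((hI1.add hI2).const_mul _) hΩo.measurableSet fun y hy => ?_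
  · exact integrableOn_of_continuous_of_isBounded hΩb
      (((hpC x hx).continuous_fderiv one_ne_zero).clm_apply continuous_const)
  · exact hconst x hx φ hφ y hy

theorem eLpNorm_rpow_eq_ofReal_integral {α F : Type*} [MeasurableSpace α] {μ : Measure α}
    [NormedAddCommGroup F] {r : ℝ} (hr : 0 < r) {f : α → F}
    (hf : Integrable (fun x => ‖f x‖ ^ r) μ) :
    eLpNorm f (ENNReal.ofReal r) μ ^ r = ENNReal.ofReal (∫ x, ‖f x‖ ^ r ∂μ) := by
  rw [eLpNorm_eq_lintegral_rpow_enorm_toReal (by simpa using hr) ENNReal.ofReal_ne_top,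
    ENNReal.toReal_ofReal hr.le, ← ENNReal.rpow_mul, one_div, inv_mul_cancel₀ hr.ne',
    ENNReal.rpow_one, ofReal_integral_eq_lintegral_ofReal hf
      (Filter.Eventually.of_forall fun x => by positivity)]
  refine lintegral_congr fun x => ?_
  rw [← ENNReal.ofReal_rpow_of_nonneg (norm_nonneg _) hr.le, ofReal_norm]

/-- The trace inequality in `L^r` norms. -/
theorem HasC1Boundary.exists_eLpNorm_trace_le (hΩ : HasC1Boundary Ω) (hΩo : IsOpen Ω)
    (hΩb : Bornology.IsBounded Ω) {r : ℝ} (hr : 1 < r) :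
    ∃ C : ℝ≥0∞, C ≠ ⊤ ∧ ∀ φ : EuclideanSpace ℝ (Fin N) → ℝ, ContDiff ℝ 1 φ →
      eLpNorm φ (ENNReal.ofReal r) (surfaceMeasure Ω)
        ≤ C * (eLpNorm φ (ENNReal.ofReal r) (volume.restrict Ω)
          + eLpNorm (gradient φ) (ENNReal.ofReal r) (volume.restrict Ω)) := by
  have hfin := hΩ.isFiniteMeasure_surfaceMeasure hΩo hΩb
  have hr0 : 0 < r := by linarith
  obtain ⟨C, hC0, hC⟩ := hΩ.exists_integral_trace_le hΩo hΩb hr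
  refine ⟨ENNReal.ofReal C ^ (1 / r), by finiteness, fun φ hφ => ?_⟩
  have hφr : Continuous fun y => ‖φ y‖ ^ r :=
    hφ.continuous.norm.rpow_const fun _ => Or.inr (by linarith)
  have hgr : Continuous fun y => ‖gradient φ y‖ ^ r :=
    (continuous_gradient hφ).norm.rpow_const fun _ => Or.inr (by linarith)
  have h1 := eLpNorm_rpow_eq_ofReal_integral hr0 (f := φ) (μ := surfaceMeasure Ω)
    (integrable_surfaceMeasure_of_continuousOn hΩb hφr.continuousOn)
  have h2 := eLpNorm_rpow_eq_ofReal_integral hr0 (f := φ) (μ := volume.restrict Ω)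
    (integrableOn_of_continuous_of_isBounded hΩb hφr)
  have h3 := eLpNorm_rpow_eq_ofReal_integral hr0 (f := gradient φ) (μ := volume.restrict Ω)
    (integrableOn_of_continuous_of_isBounded hΩb hgr)
  have h4 := ENNReal.ofReal_le_ofReal (hC φ hφ)
  rw [ENNReal.ofReal_mul hC0, ENNReal.ofReal_add (integral_nonneg fun x => by positivity)
    (integral_nonneg fun x => by positivity), ← h1, ← h2, ← h3] at h4
  calc eLpNorm φ (ENNReal.ofReal r) (surfaceMeasure Ω)
      = (eLpNorm φ (ENNReal.ofReal r) (surfaceMeasure Ω) ^ r) ^ (1 / r) := by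
        rw [← ENNReal.rpow_mul, mul_one_div_cancel hr0.ne', ENNReal.rpow_one]
    _ ≤ _ := ENNReal.rpow_le_rpow h4 (by positivity)
    _ ≤ _ := by
        rw [ENNReal.mul_rpow_of_nonneg _ _ (by positivity)]
        gcongr
        exact ENNReal.rpow_add_rpow_le_add _ _ hr.le

theorem gradient_sub {φ ψ : EuclideanSpace ℝ (Fin N) → ℝ} (hφ : Differentiable ℝ φ)
    (hψ : Differentiable ℝ ψ) (x : EuclideanSpace ℝ (Fin N)) :
    gradient (fun x => φ x - ψ x) x = gradient φ x - gradient ψ x := by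
  simp only [gradient, ← map_sub]
  rw [fderiv_fun_sub (hφ x) (hψ x)]

/-- Every function in `W^{1,r}(Ω)` has a boundary trace. -/
theorem HasC1Boundary.exists_isTrace (hΩ : HasC1Boundary Ω) (hΩo : IsOpen Ω)
    (hΩb : Bornology.IsBounded Ω) {r : ℝ} (hr : 1 < r)
    {w : EuclideanSpace ℝ (Fin N) → ℝ} {Dw : EuclideanSpace ℝ (Fin N) → EuclideanSpace ℝ (Fin N)}
    (hw : MemW1 Ω (ENNReal.ofReal r) w Dw) :
    ∃ T, IsTrace Ω (ENNReal.ofReal r) w T := by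
  have hfin := hΩ.isFiniteMeasure_surfaceMeasure hΩo hΩb
  set P := ENNReal.ofReal r with hP
  have hP1 : 1 ≤ P := by rw [hP, ENNReal.one_le_ofReal]; exact hr.le
  have hPt : P ≠ ⊤ := ENNReal.ofReal_ne_top
  obtain ⟨C, hCt, hC⟩ := hΩ.exists_eLpNorm_trace_le hΩo hΩb hr
  have hpos : ∀ n : ℕ, (0 : ℝ≥0∞) < (1 / 2) ^ n := fun n => by
    have : (0 : ℝ≥0∞) < 1 / 2 := by simp
    positivity
  -- The rate 2^{-n} in W^{1,r} becomes, by the trace inequality, a summable Cauchy bound in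
  -- L^r(∂Ω).
  choose φ hφC hφ1 hφ2 using fun n : ℕ =>
    hΩ.exists_contDiff_approx hΩo hΩb hP1 hPt hw (hpos n)
  have hφC1 : ∀ n, ContDiff ℝ 1 (φ n) := fun n => (hφC n).of_le (by exact_mod_cast le_top)
  have hdiff : ∀ n, Differentiable ℝ (φ n) := fun n => (hφC1 n).differentiable one_ne_zero
  have hlim0 : Tendsto (fun n : ℕ => ((1 : ℝ≥0∞) / 2) ^ n) atTop (𝓝 0) :=
    ENNReal.tendsto_pow_atTop_nhds_zero_of_lt_one (by rw [one_div]; exact ENNReal.one_half_lt_one)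
  have hmem : ∀ n, MemLp (φ n) P (surfaceMeasure Ω) := by
    intro n
    obtain ⟨c, hc⟩ := (isCompact_frontier_of_isBounded hΩb).exists_bound_of_continuousOn
      (hφC n).continuous.continuousOn
    exact MemLp.of_bound (hφC n).continuous.aestronglyMeasurable c
      ((ae_restrict_iff' isClosed_frontier.measurableSet).2 (Filter.Eventually.of_forall hc))
  have hmono : ∀ {M n : ℕ}, M ≤ n → ((1 : ℝ≥0∞) / 2) ^ n ≤ (1 / 2) ^ M := fun h =>
    pow_le_pow_right_of_le_one' (by rw [one_div]; exact ENNReal.one_half_lt_one.le) h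
  -- The constant is C * 4 + 1 rather than C * 4 because the completeness criterion wants a strict
  -- inequality.
  have hcau : ∀ M n m : ℕ, M ≤ n → M ≤ m →
      eLpNorm (φ n - φ m) P (surfaceMeasure Ω) < (C * 4 + 1) * (1 / 2) ^ M := by
    intro M n m hn hm
    have a1 : eLpNorm (φ n - φ m) P (volume.restrict Ω) ≤ 2 * (1 / 2) ^ M := by
      have : φ n - φ m = (fun x => φ n x - w x) - fun x => φ m x - w x := by
        ext x; simp
      rw [this, two_mul]
      refine (eLpNorm_sub_le ((hφC n).continuous.aestronglyMeasurable.sub hw.1.1)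
        ((hφC m).continuous.aestronglyMeasurable.sub hw.1.1) hP1).trans ?_
      exact add_le_add ((hφ1 n).trans (hmono hn)) ((hφ1 m).trans (hmono hm))
    have a2 : eLpNorm (gradient (φ n - φ m)) P (volume.restrict Ω) ≤ 2 * (1 / 2) ^ M := by
      have : gradient (φ n - φ m)
          = (fun x => gradient (φ n) x - Dw x) - fun x => gradient (φ m) x - Dw x := by
        ext1 x
        simp only [Pi.sub_apply, sub_sub_sub_cancel_right]
        exact gradient_sub (hdiff n) (hdiff m) x
      rw [this, two_mul]
      refine (eLpNorm_sub_le ((continuous_gradient (hφC1 n)).aestronglyMeasurable.sub hw.2.1.1)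
        ((continuous_gradient (hφC1 m)).aestronglyMeasurable.sub hw.2.1.1) hP1).trans ?_
      exact add_le_add ((hφ2 n).trans (hmono hn)) ((hφ2 m).trans (hmono hm))
    have hft : C * 4 * (1 / 2) ^ M ≠ ⊤ :=
      ENNReal.mul_ne_top (by finiteness) (ENNReal.pow_ne_top (by simp))
    calc eLpNorm (φ n - φ m) P (surfaceMeasure Ω)
        ≤ C * (eLpNorm (φ n - φ m) P (volume.restrict Ω)
          + eLpNorm (gradient (φ n - φ m)) P (volume.restrict Ω)) :=
          hC _ ((hφC1 n).sub (hφC1 m))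
      _ ≤ C * (2 * (1 / 2) ^ M + 2 * (1 / 2) ^ M) := by gcongr
      _ = C * 4 * (1 / 2) ^ M := by ring
      _ < C * 4 * (1 / 2) ^ M + (1 / 2) ^ M := ENNReal.lt_add_right hft (hpos M).ne'
      _ = _ := by ring
  have hsum : ∑' M : ℕ, (C * 4 + 1) * ((1 : ℝ≥0∞) / 2) ^ M ≠ ⊤ := by
    rw [ENNReal.tsum_mul_left, one_div, ENNReal.tsum_geometric, ENNReal.one_sub_inv_two, inv_inv]
    finiteness
  obtain ⟨T, hT, hTlim⟩ := Lp.cauchy_complete_eLpNorm hP1 hmem hsum hcau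
  exact ⟨T, hT, Dw, hw, φ, hφC,
    tendsto_of_tendsto_of_tendsto_of_le_of_le tendsto_const_nhds hlim0 (fun _ => zero_le) hφ1,
    tendsto_of_tendsto_of_tendsto_of_le_of_le tendsto_const_nhds hlim0 (fun _ => zero_le) hφ2,
    hTlim⟩

end Trace

/-! ### Domination of rapidly converging sequences. -/

section DominatedSubsequence

/-- A sequence which converges fast in `L^r` converges almost everywhere and is dominated. -/
theorem exists_memLp_bound_of_eLpNorm_sub_le {α F : Type*} [MeasurableSpace α] {μ : Measure α}
    [NormedAddCommGroup F] {r : ℝ} (hr : 1 ≤ r) {f : ℕ → α → F} {g : α → F}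
    (hf : ∀ n, AEStronglyMeasurable (f n) μ) (hg : MemLp g (ENNReal.ofReal r) μ)
    (h : ∀ n, eLpNorm (fun x => f n x - g x) (ENNReal.ofReal r) μ ≤ (1 / 2) ^ n) :
    ∃ k : α → ℝ, MemLp k (ENNReal.ofReal r) μ ∧ ∀ᵐ x ∂μ, (∀ n, ‖f n x‖ ≤ k x) ∧
      Tendsto (fun n => f n x) atTop (𝓝 (g x)) := by
  have hr0 : 0 < r := by linarith
  have hP0 : ENNReal.ofReal r ≠ 0 := by simpa using hr0
  -- S is integrable by the assumed rate. Its finiteness almost everywhere makes the terms tend to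
  -- 0, and S^{1/r}, which lies in L^r, dominates all differences at once.
  set S : α → ℝ≥0∞ := fun x => ∑' n, ‖f n x - g x‖ₑ ^ r with hS
  have hterm : ∀ n, AEMeasurable (fun x => ‖f n x - g x‖ₑ ^ r) μ := fun n =>
    ((hf n).sub hg.1).enorm.pow_const _
  have hSm : AEMeasurable S μ := AEMeasurable.tsum hterm
  have hSint : ∫⁻ x, S x ∂μ ≠ ⊤ := by
    rw [hS, lintegral_tsum hterm]
    refine ne_top_of_le_ne_top (b := ∑' n : ℕ, ((1 : ℝ≥0∞) / 2) ^ n) ?_ ?_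
    · rw [one_div, ENNReal.tsum_geometric, ENNReal.one_sub_inv_two, inv_inv]
      finiteness
    · refine ENNReal.tsum_le_tsum fun n => ?_
      have h1 := h n
      rw [eLpNorm_eq_lintegral_rpow_enorm_toReal hP0 ENNReal.ofReal_ne_top,
        ENNReal.toReal_ofReal hr0.le, one_div, ENNReal.rpow_inv_le_iff hr0] at h1
      have hle : ((1 : ℝ≥0∞) / 2) ^ n ≤ 1 :=
        pow_le_one' (by rw [one_div]; exact ENNReal.one_half_lt_one.le) n
      refine h1.trans ?_
      rw [one_div] at hle ⊢
      exact (ENNReal.rpow_le_rpow_of_exponent_ge hle hr).trans_eq (ENNReal.rpow_one _)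
  have hfin : ∀ᵐ x ∂μ, S x < ⊤ := ae_lt_top' hSm hSint
  have hkm : MemLp (fun x => (S x ^ (1 / r)).toReal) (ENNReal.ofReal r) μ := by
    refine ⟨(hSm.pow_const _).ennreal_toReal.aestronglyMeasurable, ?_⟩
    rw [eLpNorm_lt_top_iff_lintegral_rpow_enorm_lt_top hP0 ENNReal.ofReal_ne_top,
      ENNReal.toReal_ofReal hr0.le]
    refine lt_of_le_of_lt (lintegral_mono_ae ?_) hSint.lt_top
    filter_upwards [hfin] with x hx
    rw [Real.enorm_of_nonneg ENNReal.toReal_nonneg,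
      ENNReal.ofReal_toReal (by finiteness), ← ENNReal.rpow_mul, one_div,
      inv_mul_cancel₀ hr0.ne', ENNReal.rpow_one]
  refine ⟨fun x => ‖g x‖ + (S x ^ (1 / r)).toReal, hg.norm.add hkm, ?_⟩
  filter_upwards [hfin] with x hx
  have hle : ∀ n, ‖f n x - g x‖ₑ ≤ S x ^ (1 / r) := by
    intro n
    rw [one_div, ENNReal.le_rpow_inv_iff hr0]
    exact ENNReal.le_tsum (f := fun n => ‖f n x - g x‖ₑ ^ r) n
  constructor
  · intro n
    have h1 : ‖f n x - g x‖ ≤ (S x ^ (1 / r)).toReal := by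
      rw [← toReal_enorm]
      exact ENNReal.toReal_mono (by finiteness) (hle n)
    calc ‖f n x‖ = ‖g x + (f n x - g x)‖ := by congr 1; abel
      _ ≤ ‖g x‖ + ‖f n x - g x‖ := norm_add_le _ _
      _ ≤ _ := by gcongr
  · have h1 : Tendsto (fun n => ‖f n x - g x‖ₑ ^ r) atTop (𝓝 0) :=
      ENNReal.tendsto_atTop_zero_of_tsum_ne_top hx.ne
    have h2 : Tendsto (fun n => (‖f n x - g x‖ₑ ^ r) ^ (1 / r)) atTop (𝓝 (0 ^ (1 / r))) :=
      (ENNReal.continuous_rpow_const.tendsto 0).comp h1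
    rw [ENNReal.zero_rpow_of_pos (by positivity)] at h2
    simp only [← ENNReal.rpow_mul, mul_one_div_cancel hr0.ne', ENNReal.rpow_one] at h2
    rw [tendsto_iff_edist_tendsto_0]
    simpa [edist_eq_enorm_sub] using h2

theorem tendsto_integral_mul_of_dominated {α : Type*} [MeasurableSpace α] {μ : Measure α}
    {f : ℕ → α → ℝ} {g B c : α → ℝ} {M : ℝ} (hB : Integrable B μ)
    (hfm : ∀ n, AEStronglyMeasurable (f n) μ) (hfB : ∀ᵐ x ∂μ, ∀ n, ‖f n x‖ ≤ B x)
    (hfg : ∀ᵐ x ∂μ, Tendsto (fun n => f n x) atTop (𝓝 (g x)))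
    (hcm : AEStronglyMeasurable c μ) (hcM : ∀ᵐ x ∂μ, ‖c x‖ ≤ M) :
    Tendsto (fun n => ∫ x, f n x * c x ∂μ) atTop (𝓝 (∫ x, g x * c x ∂μ)) := by
  refine tendsto_integral_of_dominated_convergence (fun x => B x * M)
    (fun n => (hfm n).mul hcm) (hB.mul_const M) (fun n => ?_) ?_
  · filter_upwards [hfB, hcM] with x h1 h2
    rw [norm_mul]
    exact mul_le_mul (h1 n) h2 (norm_nonneg _) ((norm_nonneg _).trans (h1 n))
  · filter_upwards [hfg] with x h1 using h1.mul_const _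

end DominatedSubsequence

/-! ### Gauss-Green for nonlinear functions of Sobolev vector fields. -/

section NonlinearGaussGreen

variable {N : ℕ} {Ω : Set (EuclideanSpace ℝ (Fin N))}

theorem memW1_integrableOn (hΩb : Bornology.IsBounded Ω) {P : ℝ≥0∞} (hP : 1 ≤ P)
    {v : EuclideanSpace ℝ (Fin N) → ℝ} {A : EuclideanSpace ℝ (Fin N) → EuclideanSpace ℝ (Fin N)}
    (hA : MemW1 Ω P v A) : IntegrableOn v Ω ∧ IntegrableOn A Ω := by
  have := isFiniteMeasure_restrict_of_isBounded hΩb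
  exact ⟨hA.1.integrable hP, hA.2.1.integrable hP⟩

theorem integrableOn_coord {A : EuclideanSpace ℝ (Fin N) → EuclideanSpace ℝ (Fin N)}
    (hA : IntegrableOn A Ω) (i : Fin N) : IntegrableOn (fun x => A x i) Ω :=
  (EuclideanSpace.proj (𝕜 := ℝ) i).integrable_comp hA

theorem integrableOn_mul_of_continuous (hΩo : IsOpen Ω) (hΩb : Bornology.IsBounded Ω)
    {k f : EuclideanSpace ℝ (Fin N) → ℝ} (hk : Continuous k) (hf : IntegrableOn f Ω) :
    IntegrableOn (fun x => f x * k x) Ω := by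
  have := memLp_one_iff_integrable.1
    (memLp_smul_of_continuous hΩo hΩb hk (memLp_one_iff_integrable.2 hf))
  exact this.congr (Filter.Eventually.of_forall fun z => by simp [mul_comm])

/-- The fundamental lemma of the calculus of variations on `Ω`. -/
theorem ae_eq_of_forall_setIntegral_mul_eq (hΩo : IsOpen Ω)
    {f g : EuclideanSpace ℝ (Fin N) → ℝ}
    (hf : LocallyIntegrableOn f Ω) (hg : LocallyIntegrableOn g Ω)
    (h : ∀ φ, IsTestFunction Ω φ → ∫ x in Ω, f x * φ x = ∫ x in Ω, g x * φ x) :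
    ∀ᵐ x ∂(volume.restrict Ω), f x = g x := by
  have hint : ∀ {k : EuclideanSpace ℝ (Fin N) → ℝ} {φ : EuclideanSpace ℝ (Fin N) → ℝ},
      LocallyIntegrableOn k Ω → IsTestFunction Ω φ → IntegrableOn (fun x => k x * φ x) Ω := by
    intro k φ hk hφ
    have h1 : IntegrableOn k (tsupport φ) := hk.integrableOn_compact_subset hφ.2.2 hφ.2.1
    have h2 : IntegrableOn (fun x => k x * φ x) (tsupport φ) :=
      h1.mul_continuousOn hφ.1.continuous.continuousOn hφ.2.1
    have h3 : Integrable fun x => k x * φ x := by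
      rw [← integrableOn_univ]
      refine h2.of_forall_sdiff_eq_zero MeasurableSet.univ fun x hx => ?_
      rw [image_eq_zero_of_notMem_tsupport hx.2, mul_zero]
    exact h3.integrableOn
  have key := hΩo.ae_eq_zero_of_integral_contDiff_smul_eq_zero (μ := volume)
    (f := fun x => f x - g x) (hf.sub hg) fun φ hφ1 hφ2 hφ3 => by
      have hφ : IsTestFunction Ω φ := ⟨hφ1, hφ2, hφ3⟩
      have h1 : ∫ x, φ x • (f x - g x) = ∫ x in Ω, φ x • (f x - g x) := by
        refine (setIntegral_eq_integral_of_forall_compl_eq_zero fun x hx => ?_).symm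
        rw [image_eq_zero_of_notMem_tsupport fun hx' => hx (hφ3 hx'), zero_smul]
      have h2 : ∫ x in Ω, φ x • (f x - g x)
          = (∫ x in Ω, f x * φ x) - ∫ x in Ω, g x * φ x := by
        rw [← integral_sub (hint hf hφ) (hint hg hφ)]
        congr 1
        ext x
        simp only [smul_eq_mul]
        ring
      rw [h1, h2, h φ hφ, sub_self]
  refine (ae_restrict_iff' hΩo.measurableSet).2 ?_
  filter_upwards [key] with x hx hxΩ
  exact sub_eq_zero.1 (hx hxΩ)

/-- Weak gradients are unique. -/
theorem IsWeakGradient.ae_eq (hΩo : IsOpen Ω)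
    {v : EuclideanSpace ℝ (Fin N) → ℝ} {A B : EuclideanSpace ℝ (Fin N) → EuclideanSpace ℝ (Fin N)}
    (hA : IsWeakGradient Ω v A) (hB : IsWeakGradient Ω v B) :
    ∀ᵐ x ∂(volume.restrict Ω), A x = B x := by
  have hcoord : ∀ {A : EuclideanSpace ℝ (Fin N) → EuclideanSpace ℝ (Fin N)},
      LocallyIntegrableOn A Ω → ∀ i, LocallyIntegrableOn (fun x => A x i) Ω := by
    intro A hA i x hx
    obtain ⟨U, hU, hAU⟩ := hA x hx
    exact ⟨U, hU, (EuclideanSpace.proj (𝕜 := ℝ) i).integrable_comp hAU⟩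
  have h : ∀ i, ∀ᵐ x ∂(volume.restrict Ω), A x i = B x i := fun i =>
    ae_eq_of_forall_setIntegral_mul_eq hΩo (hcoord hA.2.1 i) (hcoord hB.2.1 i) fun φ hφ =>
      neg_injective ((hA.2.2 φ hφ i).symm.trans (hB.2.2 φ hφ i))
  filter_upwards [ae_all_iff.2 h] with x hx
  ext i
  exact hx i

/-- The definition of trace brings its own weak gradient; uniqueness replaces it by the prescribed
H, so that a single smooth function approximates v, H and T. -/
theorem IsTrace.exists_approx (hΩo : IsOpen Ω) {P : ℝ≥0∞}
    {v T : EuclideanSpace ℝ (Fin N) → ℝ} {H : EuclideanSpace ℝ (Fin N) → EuclideanSpace ℝ (Fin N)}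
    (hT : IsTrace Ω P v T) (hH : MemW1 Ω P v H) {ε : ℝ≥0∞} (hε : 0 < ε) :
    ∃ φ : EuclideanSpace ℝ (Fin N) → ℝ, ContDiff ℝ ∞ φ ∧
      eLpNorm (fun x => φ x - v x) P (volume.restrict Ω) ≤ ε ∧
      eLpNorm (fun x => gradient φ x - H x) P (volume.restrict Ω) ≤ ε ∧
      eLpNorm (fun x => φ x - T x) P (surfaceMeasure Ω) ≤ ε := by
  obtain ⟨-, Dv, hDv, φ, hφC, h1, h2, h3⟩ := hT
  have heq := hDv.2.2.ae_eq hΩo hH.2.2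
  have h2' : Tendsto (fun n => eLpNorm (fun x => gradient (φ n) x - H x) P (volume.restrict Ω))
      atTop (𝓝 0) := by
    refine h2.congr fun n => eLpNorm_congr_ae ?_
    filter_upwards [heq] with x hx
    rw [hx]
  obtain ⟨n, hn1, hn2, hn3⟩ := ((h1.eventually (ge_mem_nhds hε)).and
    ((h2'.eventually (ge_mem_nhds hε)).and (h3.eventually (ge_mem_nhds hε)))).exists
  exact ⟨φ n, hφC n, hn1, hn2, hn3⟩

theorem norm_le_sum_coord (x : EuclideanSpace ℝ (Fin N)) : ‖x‖ ≤ ∑ i, ‖x i‖ := by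
  have h := (EuclideanSpace.basisFun (Fin N) ℝ).sum_repr x
  calc ‖x‖ = ‖∑ i, (EuclideanSpace.basisFun (Fin N) ℝ).repr x i • EuclideanSpace.basisFun (Fin N) ℝ i‖ := by
        rw [h]
    _ ≤ ∑ i, ‖(EuclideanSpace.basisFun (Fin N) ℝ).repr x i • EuclideanSpace.basisFun (Fin N) ℝ i‖ :=
        norm_sum_le _ _
    _ = _ := by simp [norm_smul]

/-- The directional derivative `∂_w V` of a vector field whose components have the weak gradients
`H i`. -/
noncomputable def weakDirDeriv (H : Fin N → EuclideanSpace ℝ (Fin N) → EuclideanSpace ℝ (Fin N))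
    (w x : EuclideanSpace ℝ (Fin N)) : EuclideanSpace ℝ (Fin N) :=
  WithLp.toLp 2 fun i => inner ℝ (H i x) w

@[simp]
theorem weakDirDeriv_apply (H : Fin N → EuclideanSpace ℝ (Fin N) → EuclideanSpace ℝ (Fin N))
    (w x : EuclideanSpace ℝ (Fin N)) (i : Fin N) :
    weakDirDeriv H w x i = inner ℝ (H i x) w := rfl

theorem tendsto_euclidean {ι : Type*} {l : Filter ι} {f : ι → EuclideanSpace ℝ (Fin N)}
    {y : EuclideanSpace ℝ (Fin N)} (h : ∀ i, Tendsto (fun n => f n i) l (𝓝 (y i))) :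
    Tendsto f l (𝓝 y) := by
  have h1 : Tendsto (fun n => WithLp.ofLp (f n)) l (𝓝 (WithLp.ofLp y)) := tendsto_pi_nhds.2 h
  exact ((PiLp.continuous_toLp 2 _).tendsto _).comp h1

theorem MemLp.integrable_norm_rpow_ofReal {α F : Type*} [MeasurableSpace α] {μ : Measure α}
    [NormedAddCommGroup F] {r : ℝ} (hr : 0 < r) {f : α → F}
    (hf : MemLp f (ENNReal.ofReal r) μ) : Integrable (fun x => ‖f x‖ ^ r) μ := by
  have := hf.integrable_norm_rpow (by simpa using hr) ENNReal.ofReal_ne_top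
  rwa [ENNReal.toReal_ofReal hr.le] at this

/-- **Gauss-Green** for a nonlinear function `F(V)` of a Sobolev vector field `V` with boundary
trace `D`, where `F` is `C^1` with natural growth. -/
theorem HasC1Boundary.integral_nonlinear_gaussGreen (hΩ : HasC1Boundary Ω) (hΩo : IsOpen Ω)
    (hΩb : Bornology.IsBounded Ω) {r : ℝ} (hr : 1 < r)
    {V D : EuclideanSpace ℝ (Fin N) → EuclideanSpace ℝ (Fin N)}
    {H : Fin N → EuclideanSpace ℝ (Fin N) → EuclideanSpace ℝ (Fin N)}
    (hV : ∀ i, MemW1 Ω (ENNReal.ofReal r) (fun x => V x i) (H i))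
    (hD : ∀ i, IsTrace Ω (ENNReal.ofReal r) (fun x => V x i) (fun x => D x i))
    {F : EuclideanSpace ℝ (Fin N) → ℝ} (hF : ContDiff ℝ 1 F) {C : ℝ} (hC : 0 ≤ C)
    (hF1 : ∀ ξ, |F ξ| ≤ C * (1 + ‖ξ‖ ^ r))
    (hF2 : ∀ ξ, ‖fderiv ℝ F ξ‖ ≤ C * (1 + ‖ξ‖ ^ (r - 1)))
    (w : EuclideanSpace ℝ (Fin N)) :
    IntegrableOn (fun x => F (V x)) Ω ∧
    IntegrableOn (fun x => fderiv ℝ F (V x) (weakDirDeriv H w x)) Ω ∧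
    Integrable (fun x => F (D x)) (surfaceMeasure Ω) ∧
    ∀ φ : EuclideanSpace ℝ (Fin N) → ℝ, ContDiff ℝ 1 φ →
      (∫ x in Ω, F (V x) * fderiv ℝ φ x w)
        + ∫ x in Ω, fderiv ℝ F (V x) (weakDirDeriv H w x) * φ x
        = ∫ x, F (D x) * (φ x * inner ℝ (exteriorNormal Ω x) w) ∂surfaceMeasure Ω := by
  have hr0 : 0 < r := by linarith
  have hfinσ := hΩ.isFiniteMeasure_surfaceMeasure hΩo hΩb
  have hfinΩ := isFiniteMeasure_restrict_of_isBounded hΩb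
  have hpos : ∀ n : ℕ, (0 : ℝ≥0∞) < (1 / 2) ^ n := fun n => by
    have : (0 : ℝ≥0∞) < 1 / 2 := by simp
    positivity
  -- One sequence per coordinate converges fast in the interior, for gradients, and on the boundary,
  -- so all three limits are dominated and hold almost everywhere.
  choose ψ hψC hψ1 hψ2 hψ3 using fun (i : Fin N) (n : ℕ) =>
    (hD i).exists_approx hΩo (hV i) (hpos n)
  have hψC1 : ∀ i n, ContDiff ℝ 1 (ψ i n) := fun i n => (hψC i n).of_le (by exact_mod_cast le_top)
  choose k1 hk1 hk1' using fun i => exists_memLp_bound_of_eLpNorm_sub_le hr.le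
    (fun n => (hψC i n).continuous.aestronglyMeasurable) (hV i).1 (hψ1 i)
  choose k2 hk2 hk2' using fun i => exists_memLp_bound_of_eLpNorm_sub_le hr.le
    (fun n => (continuous_gradient (hψC1 i n)).aestronglyMeasurable) (hV i).2.1 (hψ2 i)
  choose k3 hk3 hk3' using fun i => exists_memLp_bound_of_eLpNorm_sub_le hr.le
    (fun n => (hψC i n).continuous.aestronglyMeasurable) (hD i).1 (hψ3 i)
  let Ψ : ℕ → EuclideanSpace ℝ (Fin N) → EuclideanSpace ℝ (Fin N) := fun n x =>
    WithLp.toLp 2 fun i => ψ i n x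
  have hΨC : ∀ n, ContDiff ℝ 1 (Ψ n) := fun n => contDiff_euclidean.2 fun i => hψC1 i n
  have hΨd : ∀ n x i, fderiv ℝ (Ψ n) x w i = inner ℝ (gradient (ψ i n) x) w := by
    intro n x i
    rw [inner_gradient_eq_fderiv]
    have h1 : HasFDerivAt (Ψ n) _ x := ((hΨC n).differentiable one_ne_zero x).hasFDerivAt
    have h2 := (EuclideanSpace.proj (𝕜 := ℝ) i).hasFDerivAt.comp x h1
    have h3 : fderiv ℝ (ψ i n) x = _ := h2.fderiv
    rw [h3]
    rfl
  set K1 : EuclideanSpace ℝ (Fin N) → ℝ := fun x => ∑ i, k1 i x with hK1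
  set K2 : EuclideanSpace ℝ (Fin N) → ℝ := fun x => ∑ i, k2 i x * ‖w‖ with hK2
  set K3 : EuclideanSpace ℝ (Fin N) → ℝ := fun x => ∑ i, k3 i x with hK3
  have hK1p : MemLp K1 (ENNReal.ofReal r) (volume.restrict Ω) :=
    memLp_finsetSum _ fun i _ => hk1 i
  have hK2p : MemLp K2 (ENNReal.ofReal r) (volume.restrict Ω) :=
    memLp_finsetSum _ fun i _ => (hk2 i).mul_const _
  have hK3p : MemLp K3 (ENNReal.ofReal r) (surfaceMeasure Ω) :=
    memLp_finsetSum _ fun i _ => hk3 i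
  have hlim1 : ∀ᵐ x ∂volume.restrict Ω, (∀ n, ‖Ψ n x‖ ≤ ‖K1 x‖) ∧
      Tendsto (fun n => Ψ n x) atTop (𝓝 (V x)) := by
    filter_upwards [ae_all_iff.2 hk1'] with x hx
    refine ⟨fun n => (norm_le_sum_coord _).trans ((Finset.sum_le_sum fun i _ => (hx i).1 n).trans
      (le_abs_self _)), tendsto_euclidean fun i => (hx i).2⟩
  have hlim2 : ∀ᵐ x ∂volume.restrict Ω, (∀ n, ‖fderiv ℝ (Ψ n) x w‖ ≤ ‖K2 x‖) ∧
      Tendsto (fun n => fderiv ℝ (Ψ n) x w) atTop (𝓝 (weakDirDeriv H w x)) := by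
    filter_upwards [ae_all_iff.2 hk2'] with x hx
    refine ⟨fun n => (norm_le_sum_coord _).trans (le_trans (Finset.sum_le_sum fun i _ => ?_)
      (le_abs_self _)), tendsto_euclidean fun i => ?_⟩
    · rw [hΨd]
      exact (norm_inner_le_norm _ _).trans (by gcongr; exact (hx i).1 n)
    · simp only [hΨd, weakDirDeriv_apply]
      exact (hx i).2.inner tendsto_const_nhds
  have hlim3 : ∀ᵐ x ∂surfaceMeasure Ω, (∀ n, ‖Ψ n x‖ ≤ ‖K3 x‖) ∧
      Tendsto (fun n => Ψ n x) atTop (𝓝 (D x)) := by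
    filter_upwards [ae_all_iff.2 hk3'] with x hx
    refine ⟨fun n => (norm_le_sum_coord _).trans ((Finset.sum_le_sum fun i _ => (hx i).1 n).trans
      (le_abs_self _)), tendsto_euclidean fun i => (hx i).2⟩
  have hDFc : Continuous fun z : EuclideanSpace ℝ (Fin N) × EuclideanSpace ℝ (Fin N) =>
      fderiv ℝ F z.1 z.2 :=
    ((hF.continuous_fderiv one_ne_zero).comp continuous_fst).clm_apply continuous_snd
  have hFc := hF.continuous
  -- The growth of order r for F, and of order r - 1 for its derivative, is exactly what makes these
  -- majorants integrable; in `B2` the product of |V|^{r-1} and the derivative of V is split by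
  -- `rpow_sub_one_mul_le`.
  set B1 : EuclideanSpace ℝ (Fin N) → ℝ := fun x => C * (1 + ‖K1 x‖ ^ r) with hB1
  set B2 : EuclideanSpace ℝ (Fin N) → ℝ := fun x => C * (1 + ‖K1 x‖ ^ r + 2 * ‖K2 x‖ ^ r) with hB2
  set B3 : EuclideanSpace ℝ (Fin N) → ℝ := fun x => C * (1 + ‖K3 x‖ ^ r) with hB3
  have hB1i : Integrable B1 (volume.restrict Ω) :=
    ((integrable_const _).add (MemLp.integrable_norm_rpow_ofReal hr0 hK1p)).const_mul _
  have hB2i : Integrable B2 (volume.restrict Ω) :=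
    (((integrable_const _).add (MemLp.integrable_norm_rpow_ofReal hr0 hK1p)).add
      ((MemLp.integrable_norm_rpow_ofReal hr0 hK2p).const_mul _)).const_mul _
  have hB3i : Integrable B3 (surfaceMeasure Ω) :=
    ((integrable_const _).add (MemLp.integrable_norm_rpow_ofReal hr0 hK3p)).const_mul _
  have hbd1 : ∀ᵐ x ∂volume.restrict Ω, ∀ n, ‖F (Ψ n x)‖ ≤ B1 x := by
    filter_upwards [hlim1] with x hx n
    refine (hF1 _).trans ?_
    simp only [hB1]
    gcongr
    exact hx.1 n
  have hbd2 : ∀ᵐ x ∂volume.restrict Ω, ∀ n, ‖fderiv ℝ F (Ψ n x) (fderiv ℝ (Ψ n) x w)‖ ≤ B2 x := by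
    filter_upwards [hlim1, hlim2] with x hx1 hx2 n
    have h1 : ‖K2 x‖ ≤ 1 + ‖K2 x‖ ^ r := by
      have := rpow_sub_one_mul_le zero_le_one (norm_nonneg (K2 x)) hr
      simpa using this
    have h2 := rpow_sub_one_mul_le (norm_nonneg (K1 x)) (norm_nonneg (K2 x)) hr
    calc ‖fderiv ℝ F (Ψ n x) (fderiv ℝ (Ψ n) x w)‖
        ≤ ‖fderiv ℝ F (Ψ n x)‖ * ‖fderiv ℝ (Ψ n) x w‖ := ContinuousLinearMap.le_opNorm _ _
      _ ≤ C * (1 + ‖Ψ n x‖ ^ (r - 1)) * ‖K2 x‖ := by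
          gcongr
          · exact hF2 _
          · exact hx2.1 n
      _ ≤ C * (1 + ‖K1 x‖ ^ (r - 1)) * ‖K2 x‖ := by
          have : ‖Ψ n x‖ ^ (r - 1) ≤ ‖K1 x‖ ^ (r - 1) :=
            Real.rpow_le_rpow (norm_nonneg _) (hx1.1 n) (by linarith)
          gcongr
      _ = C * (‖K2 x‖ + ‖K1 x‖ ^ (r - 1) * ‖K2 x‖) := by ring
      _ ≤ B2 x := by
          exact mul_le_mul_of_nonneg_left (by linarith) hC
  have hbd3 : ∀ᵐ x ∂surfaceMeasure Ω, ∀ n, ‖F (Ψ n x)‖ ≤ B3 x := by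
    filter_upwards [hlim3] with x hx n
    refine (hF1 _).trans ?_
    simp only [hB3]
    gcongr
    exact hx.1 n
  have hm1 : ∀ n, Continuous fun x => F (Ψ n x) := fun n => hFc.comp (hΨC n).continuous
  have hm2 : ∀ n, Continuous fun x => fderiv ℝ F (Ψ n x) (fderiv ℝ (Ψ n) x w) := fun n =>
    hDFc.comp ((hΨC n).continuous.prodMk
      (((hΨC n).continuous_fderiv one_ne_zero).clm_apply continuous_const))
  have ht1 : ∀ᵐ x ∂volume.restrict Ω, Tendsto (fun n => F (Ψ n x)) atTop (𝓝 (F (V x))) := by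
    filter_upwards [hlim1] with x hx using (hFc.tendsto _).comp hx.2
  have ht2 : ∀ᵐ x ∂volume.restrict Ω, Tendsto
      (fun n => fderiv ℝ F (Ψ n x) (fderiv ℝ (Ψ n) x w)) atTop
      (𝓝 (fderiv ℝ F (V x) (weakDirDeriv H w x))) := by
    filter_upwards [hlim1, hlim2] with x hx1 hx2
    exact (hDFc.tendsto (V x, weakDirDeriv H w x)).comp (hx1.2.prodMk_nhds hx2.2)
  have ht3 : ∀ᵐ x ∂surfaceMeasure Ω, Tendsto (fun n => F (Ψ n x)) atTop (𝓝 (F (D x))) := by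
    filter_upwards [hlim3] with x hx using (hFc.tendsto _).comp hx.2
  have hlimit_int : ∀ {μ : Measure (EuclideanSpace ℝ (Fin N))} {f : ℕ → EuclideanSpace ℝ (Fin N) → ℝ}
      {g B : EuclideanSpace ℝ (Fin N) → ℝ}, Integrable B μ → (∀ n, AEStronglyMeasurable (f n) μ) →
      (∀ᵐ x ∂μ, ∀ n, ‖f n x‖ ≤ B x) → (∀ᵐ x ∂μ, Tendsto (fun n => f n x) atTop (𝓝 (g x))) →
      Integrable g μ := by
    intro μ f g B hB hfm hfB hfg
    refine hB.mono' (aestronglyMeasurable_of_tendsto_ae atTop hfm hfg) ?_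
    filter_upwards [hfB, hfg] with x hx1 hx2
    exact le_of_tendsto hx2.norm (Filter.Eventually.of_forall hx1)
  have hI1 : IntegrableOn (fun x => F (V x)) Ω :=
    hlimit_int hB1i (fun n => (hm1 n).aestronglyMeasurable) hbd1 ht1
  have hI2 : IntegrableOn (fun x => fderiv ℝ F (V x) (weakDirDeriv H w x)) Ω :=
    hlimit_int hB2i (fun n => (hm2 n).aestronglyMeasurable) hbd2 ht2
  have hI3 : Integrable (fun x => F (D x)) (surfaceMeasure Ω) :=
    hlimit_int hB3i (fun n => (hm1 n).aestronglyMeasurable) hbd3 ht3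
  refine ⟨hI1, hI2, hI3, fun φ hφ => ?_⟩
  have hφd : Continuous fun x => fderiv ℝ φ x w :=
    (hφ.continuous_fderiv one_ne_zero).clm_apply continuous_const
  obtain ⟨M1, hM1⟩ := exists_bound_of_continuous_of_isBounded hΩb hφd
  obtain ⟨M2, hM2⟩ := exists_bound_of_continuous_of_isBounded hΩb hφ.continuous
  have hνc : ContinuousOn (fun x => φ x * inner ℝ (exteriorNormal Ω x) w) (frontier Ω) :=
    hφ.continuous.continuousOn.mul ((hΩ.continuousOn_exteriorNormal hΩo).inner continuousOn_const)
  obtain ⟨M3, hM3⟩ := (isCompact_frontier_of_isBounded hΩb).exists_bound_of_continuousOn hνc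
  have l1 := tendsto_integral_mul_of_dominated hB1i (fun n => (hm1 n).aestronglyMeasurable) hbd1 ht1
    hφd.aestronglyMeasurable ((ae_restrict_iff' hΩo.measurableSet).2
      (Filter.Eventually.of_forall hM1))
  have l2 := tendsto_integral_mul_of_dominated hB2i (fun n => (hm2 n).aestronglyMeasurable) hbd2 ht2
    hφ.continuous.aestronglyMeasurable ((ae_restrict_iff' hΩo.measurableSet).2
      (Filter.Eventually.of_forall hM2))
  have l3 := tendsto_integral_mul_of_dominated hB3i (fun n => (hm1 n).aestronglyMeasurable) hbd3 ht3
    (integrable_surfaceMeasure_of_continuousOn hΩb hνc).1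
    ((ae_restrict_iff' isClosed_frontier.measurableSet).2 (Filter.Eventually.of_forall hM3))
  -- The identity for the approximations is Gauss-Green for the C^1 function F(Ψ_n) φ.
  refine tendsto_nhds_unique (l1.add l2) (l3.congr fun n => ?_)
  have hprod : ContDiff ℝ 1 fun x => F (Ψ n x) * φ x := (hF.comp (hΨC n)).mul hφ
  have hgg := hΩ.setIntegral_fderiv hΩo hΩb hprod w
  have i1 : IntegrableOn (fun x => F (Ψ n x) * fderiv ℝ φ x w) Ω :=
    integrableOn_of_continuous_of_isBounded hΩb ((hm1 n).mul hφd)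
  have i2 : IntegrableOn (fun x => fderiv ℝ F (Ψ n x) (fderiv ℝ (Ψ n) x w) * φ x) Ω :=
    integrableOn_of_continuous_of_isBounded hΩb ((hm2 n).mul hφ.continuous)
  rw [← integral_add i1 i2]
  have hder : ∀ x, fderiv ℝ (fun x => F (Ψ n x) * φ x) x w
      = F (Ψ n x) * fderiv ℝ φ x w + fderiv ℝ F (Ψ n x) (fderiv ℝ (Ψ n) x w) * φ x := by
    intro x
    have h1 := (hF.differentiable one_ne_zero (Ψ n x)).hasFDerivAt.comp x
      ((hΨC n).differentiable one_ne_zero x).hasFDerivAt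
    have h2 : HasFDerivAt (fun x => F (Ψ n x) * φ x) _ x :=
      h1.mul (hφ.differentiable one_ne_zero x).hasFDerivAt
    rw [h2.fderiv]
    simp only [add_apply, smul_apply, ContinuousLinearMap.comp_apply, smul_eq_mul,
      Function.comp_apply]
    ring
  simp only [hder] at hgg
  rw [hgg]
  congr 1
  ext x
  ring

end NonlinearGaussGreen


/-! ### Regularity and growth of the stress tensor of the s-Laplacian. -/

section Stress

variable {E : Type*} [NormedAddCommGroup E] [InnerProductSpace ℝ E]

/-- The quadratic expression `‖ξ‖ ^ (s - 2) ⟨a, ξ⟩ ⟨b, ξ⟩` in the stress tensor of the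
`s`-Laplacian. -/
noncomputable def stress (s : ℝ) (a b ξ : E) : ℝ := ‖ξ‖ ^ (s - 2) * (inner ℝ a ξ * inner ℝ b ξ)

/-- The derivative of `stress`. -/
noncomputable def stressDeriv (s : ℝ) (a b ξ : E) : E →L[ℝ] ℝ :=
  ‖ξ‖ ^ (s - 2) • (inner ℝ a ξ • innerSL ℝ b + inner ℝ b ξ • innerSL ℝ a)
    + (inner ℝ a ξ * inner ℝ b ξ) • (((s - 2) * ‖ξ‖ ^ (s - 2 - 2)) • innerSL ℝ ξ)

/-- As s ≠ 1, this is true at t = 0 too, so no vanishing gradient has to be excluded later. -/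
theorem rpow_sub_two_mul_self {t s : ℝ} (ht : 0 ≤ t) (hs : 1 < s) :
    t ^ (s - 2) * t = t ^ (s - 1) := by
  rw [← Real.rpow_add_one' ht (by linarith)]
  ring_nf

theorem rpow_sub_two_mul_sq {t s : ℝ} (ht : 0 ≤ t) (hs : 1 < s) :
    t ^ (s - 2) * t ^ 2 = t ^ s := by
  rw [pow_two, ← mul_assoc, rpow_sub_two_mul_self ht hs, ← Real.rpow_add_one' ht (by linarith)]
  ring_nf

theorem abs_stress_le {s : ℝ} (hs : 1 < s) (a b ξ : E) :
    |stress s a b ξ| ≤ ‖a‖ * ‖b‖ * ‖ξ‖ ^ s := by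
  rw [stress, abs_mul, abs_mul, abs_of_nonneg (by positivity)]
  calc ‖ξ‖ ^ (s - 2) * (|inner ℝ a ξ| * |inner ℝ b ξ|)
      ≤ ‖ξ‖ ^ (s - 2) * ((‖a‖ * ‖ξ‖) * (‖b‖ * ‖ξ‖)) := by
        gcongr <;> exact abs_real_inner_le_norm _ _
    _ = ‖a‖ * ‖b‖ * (‖ξ‖ ^ (s - 2) * ‖ξ‖ ^ 2) := by ring
    _ = _ := by rw [rpow_sub_two_mul_sq (norm_nonneg _) hs]

theorem norm_stressDeriv_le {s : ℝ} (hs : 1 < s) (a b ξ : E) :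
    ‖stressDeriv s a b ξ‖ ≤ (2 + |s - 2|) * (‖a‖ * ‖b‖) * ‖ξ‖ ^ (s - 1) := by
  -- Whatever value the powers take at the origin, the inner products with 0 vanish.
  rcases eq_or_ne ξ 0 with rfl | hξ
  · have h1 : stressDeriv s a b (0 : E) = 0 := by simp [stressDeriv]
    rw [h1, norm_zero]
    positivity
  have hξ0 : 0 < ‖ξ‖ := norm_pos_iff.2 hξ
  have h1 : ‖ξ‖ ^ (s - 2 - 2) * ‖ξ‖ ^ 2 = ‖ξ‖ ^ (s - 2) := by
    rw [← Real.rpow_natCast, ← Real.rpow_add hξ0]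
    norm_num
  have ha := abs_real_inner_le_norm a ξ
  have hb := abs_real_inner_le_norm b ξ
  have h2 := rpow_sub_two_mul_self (norm_nonneg ξ) hs
  calc ‖stressDeriv s a b ξ‖
      ≤ ‖ξ‖ ^ (s - 2) * (|inner ℝ a ξ| * ‖b‖ + |inner ℝ b ξ| * ‖a‖)
        + (|inner ℝ a ξ| * |inner ℝ b ξ|) * ((|s - 2| * ‖ξ‖ ^ (s - 2 - 2)) * ‖ξ‖) := by
        refine (norm_add_le _ _).trans (add_le_add ?_ (le_of_eq ?_))
        · rw [norm_smul, Real.norm_of_nonneg (by positivity)]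
          gcongr
          refine (norm_add_le _ _).trans (le_of_eq ?_)
          simp [norm_smul]
        · simp [norm_smul, abs_of_nonneg (Real.rpow_nonneg (norm_nonneg ξ) _)]
    _ ≤ ‖ξ‖ ^ (s - 2) * ((‖a‖ * ‖ξ‖) * ‖b‖ + (‖b‖ * ‖ξ‖) * ‖a‖)
        + ((‖a‖ * ‖ξ‖) * (‖b‖ * ‖ξ‖)) * ((|s - 2| * ‖ξ‖ ^ (s - 2 - 2)) * ‖ξ‖) := by
        gcongr
    _ = 2 * (‖a‖ * ‖b‖) * (‖ξ‖ ^ (s - 2) * ‖ξ‖)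
        + |s - 2| * (‖a‖ * ‖b‖) * ((‖ξ‖ ^ (s - 2 - 2) * ‖ξ‖ ^ 2) * ‖ξ‖) := by ring
    _ = _ := by rw [h1, h2]; ring

theorem hasFDerivAt_stress {s : ℝ} (hs : 1 < s) (a b ξ : E) :
    HasFDerivAt (stress s a b) (stressDeriv s a b ξ) ξ := by
  rcases eq_or_ne ξ 0 with rfl | hξ
  · have h1 : stressDeriv s a b (0 : E) = 0 := by simp [stressDeriv]
    have h0 : stress s a b (0 : E) = 0 := by simp [stress]
    rw [h1]
    refine .of_isLittleO ?_
    -- At the origin the function is O(|ξ|^s) with s > 1, hence o(|ξ|).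
    have h2 : (fun ξ : E => ‖a‖ * ‖b‖ * ‖ξ‖ ^ (s - 1)) =o[𝓝 0] fun _ : E => (1 : ℝ) := by
      refine (Asymptotics.isLittleO_const_iff one_ne_zero).2 ?_
      have h3 : ContinuousAt (fun ξ : E => ‖a‖ * ‖b‖ * ‖ξ‖ ^ (s - 1)) 0 :=
        continuousAt_const.mul (continuous_norm.continuousAt.rpow_const
          (Or.inr (by linarith)))
      simpa [ContinuousAt, Real.zero_rpow (show s - 1 ≠ 0 by linarith)] using h3
    have h4 : (fun ξ : E => (‖a‖ * ‖b‖ * ‖ξ‖ ^ (s - 1)) * ‖ξ‖) =o[𝓝 0]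
        fun ξ : E => (1 : ℝ) * ‖ξ‖ := h2.mul_isBigO (Asymptotics.isBigO_refl _ _)
    refine Asymptotics.IsLittleO.congr' (f₁ := stress s a b) (g₁ := fun ξ : E => ξ) ?_
      (Filter.Eventually.of_forall fun ξ => by simp [h0])
      (Filter.Eventually.of_forall fun ξ => by simp)
    have h5 : stress s a b =O[𝓝 0] fun ξ : E => (‖a‖ * ‖b‖ * ‖ξ‖ ^ (s - 1)) * ‖ξ‖ := by
      refine Asymptotics.IsBigO.of_bound 1 (Filter.Eventually.of_forall fun ξ => ?_)
      rw [one_mul, Real.norm_eq_abs, Real.norm_of_nonneg (by positivity)]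
      refine (abs_stress_le hs a b ξ).trans_eq ?_
      rw [mul_assoc _ (‖ξ‖ ^ (s - 1)), ← Real.rpow_add_one' (norm_nonneg _) (by linarith)]
      ring_nf
    have h6 := h5.trans_isLittleO h4
    simp only [one_mul] at h6
    exact Asymptotics.isLittleO_norm_right.1 h6
  · have hn : HasFDerivAt (fun ξ : E => ‖ξ‖ ^ (s - 2))
        (((s - 2) * ‖ξ‖ ^ (s - 2 - 2)) • innerSL ℝ ξ) ξ := by
      have h1 := ((hasStrictFDerivAt_norm_sq ξ).rpow_const (p := (s - 2) / 2)
        (by simp [hξ])).hasFDerivAt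
      convert! h1 using 1
      · ext η
        rw [← Real.rpow_natCast_mul (norm_nonneg _)]
        congr 1
        push_cast
        ring
      · rw [← Real.rpow_natCast_mul (norm_nonneg _), ← Nat.cast_smul_eq_nsmul ℝ, smul_smul]
        congr 1
        push_cast
        ring_nf
    have ha : HasFDerivAt (fun ξ : E => inner ℝ a ξ) (innerSL ℝ a) ξ := (innerSL ℝ a).hasFDerivAt
    have hb : HasFDerivAt (fun ξ : E => inner ℝ b ξ) (innerSL ℝ b) ξ := (innerSL ℝ b).hasFDerivAt
    exact hn.mul (ha.mul hb)

/-- The quadratic factor compensates the power |ξ|^{s-2}: the derivative is O(|ξ|^{s-1}) and tends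
to 0 at the origin, even for s < 2, when the flux |ξ|^{s-2} ξ fails to be C^1. -/
theorem contDiff_stress {s : ℝ} (hs : 1 < s) (a b : E) : ContDiff ℝ 1 (stress s a b) := by
  refine contDiff_one_iff_hasFDerivAt.2 ⟨stressDeriv s a b, ?_, hasFDerivAt_stress hs a b⟩
  refine continuous_iff_continuousAt.2 fun ξ => ?_
  rcases eq_or_ne ξ 0 with rfl | hξ
  · have h1 : stressDeriv s a b (0 : E) = 0 := by simp [stressDeriv]
    rw [ContinuousAt, h1, tendsto_zero_iff_norm_tendsto_zero]
    refine squeeze_zero (fun _ => norm_nonneg _) (fun ξ => norm_stressDeriv_le hs a b ξ) ?_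
    have h3 : ContinuousAt (fun ξ : E => (2 + |s - 2|) * (‖a‖ * ‖b‖) * ‖ξ‖ ^ (s - 1)) 0 :=
      continuousAt_const.mul (continuous_norm.continuousAt.rpow_const (Or.inr (by linarith)))
    simpa [ContinuousAt, Real.zero_rpow (show s - 1 ≠ 0 by linarith)] using h3
  · have h1 : ∀ t : ℝ, ContinuousAt (fun ξ : E => ‖ξ‖ ^ t) ξ := fun t =>
      continuous_norm.continuousAt.rpow_const (Or.inl (norm_ne_zero_iff.2 hξ))
    have ha : ∀ a : E, ContinuousAt (fun ξ : E => inner ℝ a ξ) ξ := fun a => by fun_prop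
    have hi : ContinuousAt (fun ξ : E => innerSL ℝ ξ) ξ := (innerSL ℝ).continuous.continuousAt
    exact ((h1 _).smul (((ha a).smul continuousAt_const).add ((ha b).smul continuousAt_const))).add
      (((ha a).mul (ha b)).smul ((continuousAt_const.mul (h1 _)).smul hi))

/-- This absorbs all lower powers, in particular those of order q, into growth of order p. -/
theorem rpow_le_one_add_rpow {t a b : ℝ} (ht : 0 ≤ t) (ha : 0 ≤ a) (hab : a ≤ b) :
    t ^ a ≤ 1 + t ^ b := by
  rcases le_total t 1 with h | h
  · linarith [Real.rpow_le_one ht h ha, Real.rpow_nonneg ht b]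
  · linarith [Real.rpow_le_rpow_of_exponent_le h hab]

end Stress

/-! ### Second derivatives, and the direction of the gradient on the boundary. -/

section SecondOrder

variable {N : ℕ} {Ω : Set (EuclideanSpace ℝ (Fin N))}

theorem MemW1.congr_ae (hΩb : Bornology.IsBounded Ω) {P : ℝ≥0∞} (hP : 1 ≤ P)
    {v w : EuclideanSpace ℝ (Fin N) → ℝ} {A : EuclideanSpace ℝ (Fin N) → EuclideanSpace ℝ (Fin N)}
    (hv : MemW1 Ω P v A) (h : v =ᵐ[volume.restrict Ω] w) : MemW1 Ω P w A := by
  have hi := memW1_integrableOn hΩb hP hv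
  refine ⟨hv.1.ae_eq h, hv.2.1, IntegrableOn.locallyIntegrableOn (hi.1.congr h), hv.2.2.2.1,
    fun φ hφ i => ?_⟩
  rw [← hv.2.2.2.2 φ hφ i]
  refine integral_congr_ae ?_
  filter_upwards [h] with x hx
  rw [hx]

theorem tendsto_half_pow_zero : Tendsto (fun n : ℕ => ((1 : ℝ≥0∞) / 2) ^ n) atTop (𝓝 0) :=
  ENNReal.tendsto_pow_atTop_nhds_zero_of_lt_one (by rw [one_div]; exact ENNReal.one_half_lt_one)

theorem half_pow_pos (n : ℕ) : (0 : ℝ≥0∞) < (1 / 2) ^ n := by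
  have : (0 : ℝ≥0∞) < 1 / 2 := by simp
  positivity

/-- Functions in `W^{1,r}_0(Ω)` are dominated almost everywhere limits of test functions. -/
theorem MemW1Zero.exists_dominated_seq {r : ℝ} (hr : 1 ≤ r)
    {u : EuclideanSpace ℝ (Fin N) → ℝ} {Du : EuclideanSpace ℝ (Fin N) → EuclideanSpace ℝ (Fin N)}
    (hu : MemW1Zero Ω (ENNReal.ofReal r) u Du) :
    ∃ (ψ : ℕ → EuclideanSpace ℝ (Fin N) → ℝ) (k₁ k₂ : EuclideanSpace ℝ (Fin N) → ℝ),
      (∀ n, IsTestFunction Ω (ψ n)) ∧ MemLp k₁ (ENNReal.ofReal r) (volume.restrict Ω) ∧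
      MemLp k₂ (ENNReal.ofReal r) (volume.restrict Ω) ∧
      (∀ᵐ x ∂volume.restrict Ω, (∀ n, ‖ψ n x‖ ≤ k₁ x) ∧
        Tendsto (fun n => ψ n x) atTop (𝓝 (u x))) ∧
      (∀ᵐ x ∂volume.restrict Ω, (∀ n, ‖gradient (ψ n) x‖ ≤ k₂ x) ∧
        Tendsto (fun n => gradient (ψ n) x) atTop (𝓝 (Du x))) := by
  obtain ⟨hW, φ, hφ, h1, h2⟩ := hu
  choose m hm1 hm2 using fun n : ℕ => ((h1.eventually (ge_mem_nhds (half_pow_pos n))).and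
    (h2.eventually (ge_mem_nhds (half_pow_pos n)))).exists
  have hC1 : ∀ n, ContDiff ℝ 1 (φ (m n)) := fun n => (hφ _).1.of_le (by exact_mod_cast le_top)
  obtain ⟨k₁, hk₁, hk₁'⟩ := exists_memLp_bound_of_eLpNorm_sub_le hr
    (fun n => (hφ (m n)).1.continuous.aestronglyMeasurable) hW.1 hm1
  obtain ⟨k₂, hk₂, hk₂'⟩ := exists_memLp_bound_of_eLpNorm_sub_le hr
    (fun n => (continuous_gradient (hC1 n)).aestronglyMeasurable) hW.2.1 hm2
  exact ⟨fun n => φ (m n), k₁, k₂, fun n => hφ _, hk₁, hk₂, hk₁', hk₂'⟩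

theorem abs_coord_le_norm (ξ : EuclideanSpace ℝ (Fin N)) (i : Fin N) : |ξ i| ≤ ‖ξ‖ :=
  PiLp.norm_apply_le ξ i

theorem fderiv_mul_apply {f k : EuclideanSpace ℝ (Fin N) → ℝ} (hf : ContDiff ℝ 1 f)
    (hk : ContDiff ℝ 1 k) (x w : EuclideanSpace ℝ (Fin N)) :
    fderiv ℝ (fun x => f x * k x) x w = fderiv ℝ f x w * k x + f x * fderiv ℝ k x w := by
  have h : HasFDerivAt (fun x => f x * k x) _ x :=
    (hf.differentiable one_ne_zero x).hasFDerivAt.mul (hk.differentiable one_ne_zero x).hasFDerivAt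
  rw [h.fderiv]
  simp only [add_apply, smul_apply, smul_eq_mul]
  ring

/-- Integration by parts against a test function. -/
theorem setIntegral_fderiv_mul_eq_neg (hΩo : IsOpen Ω) (hΩb : Bornology.IsBounded Ω)
    {ψ k : EuclideanSpace ℝ (Fin N) → ℝ} (hψ : ContDiff ℝ 1 ψ) (hψc : HasCompactSupport ψ)
    (hs : tsupport ψ ⊆ Ω) (hk : ContDiff ℝ 1 k) (w : EuclideanSpace ℝ (Fin N)) :
    ∫ x in Ω, fderiv ℝ ψ x w * k x = - ∫ x in Ω, ψ x * fderiv ℝ k x w := by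
  have hcont : ∀ {f : EuclideanSpace ℝ (Fin N) → ℝ}, ContDiff ℝ 1 f →
      Continuous fun x => fderiv ℝ f x w := fun hf =>
    (hf.continuous_fderiv one_ne_zero).clm_apply continuous_const
  have i1 : IntegrableOn (fun x => fderiv ℝ ψ x w * k x) Ω :=
    integrableOn_of_continuous_of_isBounded hΩb ((hcont hψ).mul hk.continuous)
  have i2 : IntegrableOn (fun x => ψ x * fderiv ℝ k x w) Ω :=
    integrableOn_of_continuous_of_isBounded hΩb (hψ.continuous.mul (hcont hk))
  have hsub : tsupport (fun x => ψ x * k x) ⊆ tsupport ψ := tsupport_mul_subset_left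
  have h := setIntegral_fderiv_of_tsupport_subset hΩo (hψ.mul hk) hψc.mul_right
    (hsub.trans hs) w
  have h0 : ∫ x, ψ x * k x * inner ℝ (exteriorNormal Ω x) w ∂surfaceMeasure Ω = 0 := by
    refine setIntegral_eq_zero_of_forall_eq_zero fun x hx => ?_
    have hx' : x ∉ tsupport ψ := fun h =>
      (hΩo.frontier_eq ▸ hx : x ∈ closure Ω \ Ω).2 (hs h)
    rw [image_eq_zero_of_notMem_tsupport hx', zero_mul, zero_mul]
  rw [h0] at h
  simp only [fderiv_mul_apply hψ hk] at h
  rw [integral_add i1 i2] at h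
  linarith

/-- Functions in `W^{1,r}_0(Ω)` have no boundary term in integrations by parts. -/
theorem MemW1Zero.setIntegral_mul_eq_neg (hΩo : IsOpen Ω) (hΩb : Bornology.IsBounded Ω) {r : ℝ}
    (hr : 1 ≤ r) {u : EuclideanSpace ℝ (Fin N) → ℝ}
    {Du : EuclideanSpace ℝ (Fin N) → EuclideanSpace ℝ (Fin N)}
    (hu : MemW1Zero Ω (ENNReal.ofReal r) u Du) {k : EuclideanSpace ℝ (Fin N) → ℝ}
    (hk : ContDiff ℝ 1 k) (i : Fin N) :
    ∫ x in Ω, Du x i * k x = - ∫ x in Ω, u x * fderiv ℝ k x (EuclideanSpace.single i 1) := by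
  have hfin := isFiniteMeasure_restrict_of_isBounded hΩb
  have hP : 1 ≤ ENNReal.ofReal r := by rwa [ENNReal.one_le_ofReal]
  obtain ⟨ψ, k₁, k₂, hψ, hk₁, hk₂, h1, h2⟩ := hu.exists_dominated_seq hr
  have hC1 : ∀ n, ContDiff ℝ 1 (ψ n) := fun n => (hψ _).1.of_le (by exact_mod_cast le_top)
  have hkd : Continuous fun x => fderiv ℝ k x (EuclideanSpace.single i 1) :=
    (hk.continuous_fderiv one_ne_zero).clm_apply continuous_const
  obtain ⟨M1, hM1⟩ := exists_bound_of_continuous_of_isBounded hΩb hk.continuous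
  obtain ⟨M2, hM2⟩ := exists_bound_of_continuous_of_isBounded hΩb hkd
  have l1 := tendsto_integral_mul_of_dominated (μ := volume.restrict Ω)
    (f := fun n x => gradient (ψ n) x i) (g := fun x => Du x i) (hk₂.integrable hP)
    (fun n => ((EuclideanSpace.proj (𝕜 := ℝ) i).continuous.comp
      (continuous_gradient (hC1 n))).aestronglyMeasurable)
    (by
      filter_upwards [h2] with x hx n
      exact (PiLp.norm_apply_le _ i).trans (hx.1 n))
    (by
      filter_upwards [h2] with x hx
      exact ((EuclideanSpace.proj (𝕜 := ℝ) i).continuous.tendsto _).comp hx.2)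
    hk.continuous.aestronglyMeasurable
    ((ae_restrict_iff' hΩo.measurableSet).2 (Filter.Eventually.of_forall hM1))
  have l2 := tendsto_integral_mul_of_dominated (μ := volume.restrict Ω)
    (f := ψ) (g := u) (hk₁.integrable hP)
    (fun n => (hC1 n).continuous.aestronglyMeasurable)
    (by filter_upwards [h1] with x hx using hx.1)
    (by filter_upwards [h1] with x hx using hx.2)
    hkd.aestronglyMeasurable
    ((ae_restrict_iff' hΩo.measurableSet).2 (Filter.Eventually.of_forall hM2))
  -- The boundary term is absent for each approximating test function, hence in the limit, although
  -- k need not vanish on ∂Ω.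
  refine tendsto_nhds_unique l1 (l2.neg.congr fun n => ?_)
  rw [← setIntegral_fderiv_mul_eq_neg hΩo hΩb (hC1 n) (hψ n).2.1 (hψ n).2.2 hk]
  simp only [gradient_apply_eq_fderiv]

theorem contDiff_fderiv_apply {φ : EuclideanSpace ℝ (Fin N) → ℝ} (hφ : ContDiff ℝ ∞ φ)
    (w : EuclideanSpace ℝ (Fin N)) : ContDiff ℝ ∞ fun x => fderiv ℝ φ x w :=
  (hφ.fderiv_right (m := ∞) (by simp)).clm_apply contDiff_const

theorem IsTestFunction.fderiv_apply {φ : EuclideanSpace ℝ (Fin N) → ℝ} (hφ : IsTestFunction Ω φ)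
    (w : EuclideanSpace ℝ (Fin N)) : IsTestFunction Ω fun x => fderiv ℝ φ x w :=
  ⟨contDiff_fderiv_apply hφ.1 w, hφ.2.1.fderiv_apply (𝕜 := ℝ) w,
    (tsupport_fderiv_apply_subset ℝ w).trans hφ.2.2⟩

theorem fderiv_fderiv_comm {φ : EuclideanSpace ℝ (Fin N) → ℝ} (hφ : ContDiff ℝ ∞ φ)
    (x v w : EuclideanSpace ℝ (Fin N)) :
    fderiv ℝ (fun y => fderiv ℝ φ y v) x w = fderiv ℝ (fun y => fderiv ℝ φ y w) x v := by
  have hd : DifferentiableAt ℝ (fderiv ℝ φ) x :=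
    ((hφ.fderiv_right (m := ∞) (by simp)).differentiable (by simp)) x
  have h : ∀ v w, fderiv ℝ (fun y => fderiv ℝ φ y v) x w = fderiv ℝ (fderiv ℝ φ) x w v := by
    intro v w
    have h1 : HasFDerivAt (fun y => fderiv ℝ φ y v) _ x :=
      ((ContinuousLinearMap.apply ℝ ℝ v).hasFDerivAt).comp x hd.hasFDerivAt
    rw [h1.fderiv]
    rfl
  have hsymm : IsSymmSndFDerivAt ℝ φ x :=
    (contDiff_infty.1 hφ 2).contDiffAt.isSymmSndFDerivAt (by simp)
  rw [h, h]
  exact hsymm w v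

/-- Second weak derivatives commute. -/
theorem IsWeakGradient.hessian_symm (hΩo : IsOpen Ω) {u : EuclideanSpace ℝ (Fin N) → ℝ}
    {V : EuclideanSpace ℝ (Fin N) → EuclideanSpace ℝ (Fin N)}
    {H : Fin N → EuclideanSpace ℝ (Fin N) → EuclideanSpace ℝ (Fin N)}
    (hV : IsWeakGradient Ω u V) (hH : ∀ i, IsWeakGradient Ω (fun x => V x i) (H i)) (i j : Fin N) :
    ∀ᵐ x ∂volume.restrict Ω, H i x j = H j x i := by
  have hcoord : ∀ {A : EuclideanSpace ℝ (Fin N) → EuclideanSpace ℝ (Fin N)},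
      LocallyIntegrableOn A Ω → ∀ i, LocallyIntegrableOn (fun x => A x i) Ω := by
    intro A hA i x hx
    obtain ⟨U, hU, hAU⟩ := hA x hx
    exact ⟨U, hU, (EuclideanSpace.proj (𝕜 := ℝ) i).integrable_comp hAU⟩
  -- Two integrations by parts move both derivatives onto φ, where they commute.
  have hsecond : ∀ i j φ, IsTestFunction Ω φ → ∫ x in Ω, H i x j * φ x
      = ∫ x in Ω, u x * fderiv ℝ (fun y => fderiv ℝ φ y (EuclideanSpace.single j 1)) x
        (EuclideanSpace.single i 1) := by
    intro i j φ hφ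
    have h1 := (hH i).2.2 φ hφ j
    have h2 := hV.2.2 _ (hφ.fderiv_apply (EuclideanSpace.single j 1)) i
    simp only [gradient_apply_eq_fderiv] at h1 h2
    rw [h2, h1, neg_neg]
  refine ae_eq_of_forall_setIntegral_mul_eq hΩo (hcoord (hH i).2.1 j) (hcoord (hH j).2.1 i)
    fun φ hφ => ?_
  rw [hsecond i j φ hφ, hsecond j i φ hφ]
  simp only [fun x => fderiv_fderiv_comm hφ.1 x (EuclideanSpace.single j 1)
    (EuclideanSpace.single i 1)]

/-- The boundary trace of the gradient of a function in `W^{1,r}_0 ∩ W^{2,r}` is normal. -/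
theorem HasC1Boundary.trace_gradient_eq_smul (hΩ : HasC1Boundary Ω) (hΩo : IsOpen Ω)
    (hΩb : Bornology.IsBounded Ω) {r : ℝ} (hr : 1 < r) {u : EuclideanSpace ℝ (Fin N) → ℝ}
    {V D : EuclideanSpace ℝ (Fin N) → EuclideanSpace ℝ (Fin N)}
    {H : Fin N → EuclideanSpace ℝ (Fin N) → EuclideanSpace ℝ (Fin N)}
    (hu : MemW1Zero Ω (ENNReal.ofReal r) u V)
    (hV : ∀ i, MemW1 Ω (ENNReal.ofReal r) (fun x => V x i) (H i))
    (hD : ∀ i, IsTrace Ω (ENNReal.ofReal r) (fun x => V x i) (fun x => D x i)) :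
    ∀ᵐ x ∂surfaceMeasure Ω,
      D x = (inner ℝ (D x) (exteriorNormal Ω x) : ℝ) • exteriorNormal Ω x := by
  have hK := isCompact_frontier_of_isBounded hΩb
  have hνc := hΩ.continuousOn_exteriorNormal hΩo
  have hνi : ∀ i, ContinuousOn (fun x => exteriorNormal Ω x i) (frontier Ω) := fun i =>
    (EuclideanSpace.proj (𝕜 := ℝ) i).continuous.comp_continuousOn hνc
  -- Gauss-Green with the linear function F(ξ) = ξ_i, whose growth is admissible because r > 1.
  have hcoord : ∀ i j : Fin N, ∀ φ : EuclideanSpace ℝ (Fin N) → ℝ, ContDiff ℝ ∞ φ →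
      Integrable (fun x => D x i) (surfaceMeasure Ω) ∧
      (∫ x in Ω, V x i * fderiv ℝ φ x (EuclideanSpace.single j 1)) + ∫ x in Ω, H i x j * φ x
        = ∫ x, D x i * (φ x * exteriorNormal Ω x j) ∂surfaceMeasure Ω := by
    intro i j φ hφ
    obtain ⟨-, -, h3, h4⟩ := hΩ.integral_nonlinear_gaussGreen hΩo hΩb hr hV hD
      (F := fun ξ => (EuclideanSpace.proj (𝕜 := ℝ) i : EuclideanSpace ℝ (Fin N) →L[ℝ] ℝ) ξ)
      (ContinuousLinearMap.contDiff _) (C := 1) zero_le_one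
      (fun ξ => by
        have h1 := rpow_le_one_add_rpow (norm_nonneg ξ) zero_le_one hr.le
        rw [Real.rpow_one] at h1
        rw [one_mul]
        exact (abs_coord_le_norm ξ i).trans h1)
      (fun ξ => by
        rw [ContinuousLinearMap.fderiv, one_mul]
        refine ContinuousLinearMap.opNorm_le_bound _ (by positivity) fun η => ?_
        refine (PiLp.norm_apply_le η i).trans ?_
        have : 0 ≤ ‖ξ‖ ^ (r - 1) := by positivity
        nlinarith [norm_nonneg η])
      (EuclideanSpace.single j 1)
    refine ⟨h3, ?_⟩
    have h5 := h4 φ (hφ.of_le (by exact_mod_cast le_top))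
    simp only [ContinuousLinearMap.fderiv, EuclideanSpace.inner_single_right] at h5
    simpa [EuclideanSpace.inner_single_right] using h5
  have hDi : ∀ i j, Integrable (fun x => D x i * exteriorNormal Ω x j) (surfaceMeasure Ω) := by
    intro i j
    exact IntegrableOn.mul_continuousOn (K := frontier Ω)
      (hcoord i j (fun _ => 0) contDiff_const).1 (hνi j) hK
  -- The interior side of `hcoord` is symmetric in i and j: the Hessian is symmetric, and ∫ V_i ∂_j
  -- φ = -∫ u ∂_i ∂_j φ has no boundary term since u lies in W^{1,r}_0. Hence the boundary side is
  -- symmetric too.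
  have hsymm : ∀ i j, ∀ᵐ x ∂surfaceMeasure Ω,
      D x i * exteriorNormal Ω x j - D x j * exteriorNormal Ω x i = 0 := by
    intro i j
    have hfin := hΩ.isFiniteMeasure_surfaceMeasure hΩo hΩb
    refine ae_eq_zero_of_integral_contDiff_smul_eq_zero
      ((hDi i j).sub (hDi j i)).locallyIntegrable fun φ hφ _ => ?_
    have i1 : ∀ i j, Integrable (fun x => D x i * (φ x * exteriorNormal Ω x j))
        (surfaceMeasure Ω) := fun i j =>
      IntegrableOn.mul_continuousOn (K := frontier Ω) (hcoord i j (fun _ => 0) contDiff_const).1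
        (hφ.continuous.continuousOn.mul (hνi j)) hK
    have h1 : ∫ x, φ x • (D x i * exteriorNormal Ω x j - D x j * exteriorNormal Ω x i)
        ∂surfaceMeasure Ω = (∫ x, D x i * (φ x * exteriorNormal Ω x j) ∂surfaceMeasure Ω)
          - ∫ x, D x j * (φ x * exteriorNormal Ω x i) ∂surfaceMeasure Ω := by
      rw [← integral_sub (i1 i j) (i1 j i)]
      congr 1
      ext x
      simp only [smul_eq_mul]
      ring
    have hφ1 : ∀ w, ContDiff ℝ 1 fun x => fderiv ℝ φ x w := fun w =>
      (contDiff_fderiv_apply hφ w).of_le (by exact_mod_cast le_top)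
    have h2 : ∫ x in Ω, H i x j * φ x = ∫ x in Ω, H j x i * φ x := by
      refine integral_congr_ae ?_
      filter_upwards [hu.1.2.2.hessian_symm hΩo (fun i => (hV i).2.2) i j] with x hx
      rw [hx]
    have h3 : ∫ x in Ω, V x i * fderiv ℝ φ x (EuclideanSpace.single j 1)
        = ∫ x in Ω, V x j * fderiv ℝ φ x (EuclideanSpace.single i 1) := by
      rw [hu.setIntegral_mul_eq_neg hΩo hΩb hr.le (hφ1 _) i,
        hu.setIntegral_mul_eq_neg hΩo hΩb hr.le (hφ1 _) j]
      simp only [fun x => fderiv_fderiv_comm hφ x (EuclideanSpace.single j 1)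
        (EuclideanSpace.single i 1)]
    rw [h1, ← (hcoord i j φ hφ).2, ← (hcoord j i φ hφ).2, h2, h3, sub_self]
  have hν1 : ∀ᵐ x ∂surfaceMeasure Ω, ‖exteriorNormal Ω x‖ = 1 :=
    (ae_restrict_iff' isClosed_frontier.measurableSet).2
      (Filter.Eventually.of_forall fun x hx => (hΩ.isExteriorUnitNormal hΩo hx).1)
  filter_upwards [hν1, ae_all_iff.2 fun i => ae_all_iff.2 (hsymm i)] with x hx hxs
  ext i
  have h1 : ∑ j, exteriorNormal Ω x j * exteriorNormal Ω x j = 1 := by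
    have h := EuclideanSpace.real_norm_sq_eq (exteriorNormal Ω x)
    rw [hx] at h
    simp only [← pow_two]
    linarith
  -- Multiply D_i ν_j = D_j ν_i by ν_j and sum over j, using |ν| = 1.
  calc D x i = ∑ j, D x i * (exteriorNormal Ω x j * exteriorNormal Ω x j) := by
        rw [← Finset.mul_sum, h1, mul_one]
    _ = ∑ j, (D x j * exteriorNormal Ω x j) * exteriorNormal Ω x i := by
        refine Finset.sum_congr rfl fun j _ => ?_
        rw [← mul_assoc, sub_eq_zero.1 (hxs i j)]
        ring
    _ = _ := by
        rw [← Finset.sum_mul, PiLp.smul_apply, smul_eq_mul, PiLp.inner_apply]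
        congr 1
        refine Finset.sum_congr rfl fun j _ => ?_
        simp [mul_comm]

end SecondOrder

/-! ### The Pohozaev tensor and the weak equation. -/

section WeakEquation

variable {N : ℕ} {Ω : Set (EuclideanSpace ℝ (Fin N))}

theorem gradient_mul {f k : EuclideanSpace ℝ (Fin N) → ℝ} (hf : ContDiff ℝ 1 f)
    (hk : ContDiff ℝ 1 k) (x : EuclideanSpace ℝ (Fin N)) :
    gradient (fun x => f x * k x) x = k x • gradient f x + f x • gradient k x := by
  ext i
  simp only [PiLp.add_apply, PiLp.smul_apply, gradient_apply_eq_fderiv, fderiv_mul_apply hf hk,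
    smul_eq_mul]
  ring

/-- The product of a test function and a function in `W^{1,p}(Ω)` lies in `W^{1,p}_0(Ω)`. -/
theorem HasC1Boundary.memW1Zero_testFunction_mul (hΩ : HasC1Boundary Ω) (hΩo : IsOpen Ω)
    (hΩb : Bornology.IsBounded Ω) {P : ℝ≥0∞} (hP1 : 1 ≤ P) (hP : P ≠ ⊤)
    {w : EuclideanSpace ℝ (Fin N) → ℝ} {Dw : EuclideanSpace ℝ (Fin N) → EuclideanSpace ℝ (Fin N)}
    (hw : MemW1 Ω P w Dw) {φ : EuclideanSpace ℝ (Fin N) → ℝ} (hφ : IsTestFunction Ω φ) :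
    MemW1Zero Ω P (fun x => φ x * w x) (fun x => w x • gradient φ x + φ x • Dw x) := by
  have hφ1 : ContDiff ℝ 1 φ := hφ.1.of_le (by exact_mod_cast le_top)
  have hgφ := continuous_gradient hφ1
  have hv : MemLp (fun x => φ x * w x) P (volume.restrict Ω) :=
    memLp_smul_of_continuous hΩo hΩb hφ.1.continuous hw.1
  have hDv : MemLp (fun x => w x • gradient φ x + φ x • Dw x) P (volume.restrict Ω) :=
    (memLp_smul_continuous hΩo hΩb hgφ hw.1).add
      (memLp_smul_of_continuous hΩo hΩb hφ.1.continuous hw.2.1)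
  have hfin := isFiniteMeasure_restrict_of_isBounded hΩb
  have hvi : IntegrableOn (fun x => φ x * w x) Ω := hv.integrable hP1
  have hDvi : IntegrableOn (fun x => w x • gradient φ x + φ x • Dw x) Ω := hDv.integrable hP1
  obtain ⟨hwi, hDwi⟩ := memW1_integrableOn hΩb hP1 hw
  refine ⟨⟨hv, hDv, hvi.locallyIntegrableOn, hDvi.locallyIntegrableOn, fun η hη i => ?_⟩, ?_⟩
  · have hη1 : ContDiff ℝ 1 η := hη.1.of_le (by exact_mod_cast le_top)
    have hφη : IsTestFunction Ω fun x => φ x * η x :=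
      ⟨hφ.1.mul hη.1, hφ.2.1.mul_right, tsupport_mul_subset_left.trans hφ.2.2⟩
    have h := hw.2.2.2.2 _ hφη i
    simp only [gradient_apply_eq_fderiv, fderiv_mul_apply hφ1 hη1] at h
    have hd : ∀ {f : EuclideanSpace ℝ (Fin N) → ℝ}, ContDiff ℝ 1 f →
        Continuous fun x => fderiv ℝ f x (EuclideanSpace.single i 1) := fun hf =>
      (hf.continuous_fderiv one_ne_zero).clm_apply continuous_const
    have i1 : IntegrableOn (fun x => w x * (fderiv ℝ φ x (EuclideanSpace.single i 1) * η x)) Ω :=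
      integrableOn_mul_of_continuous hΩo hΩb ((hd hφ1).mul hη1.continuous) hwi
    have i2 : IntegrableOn (fun x => w x * (φ x * fderiv ℝ η x (EuclideanSpace.single i 1))) Ω :=
      integrableOn_mul_of_continuous hΩo hΩb (hφ1.continuous.mul (hd hη1)) hwi
    have i3 : IntegrableOn (fun x => Dw x i * (φ x * η x)) Ω :=
      integrableOn_mul_of_continuous hΩo hΩb (hφ1.continuous.mul hη1.continuous)
        (integrableOn_coord hDwi i)
    simp only [mul_add] at h
    rw [integral_add i1 i2] at h
    have e1 : ∫ x in Ω, φ x * w x * gradient η x i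
        = ∫ x in Ω, w x * (φ x * fderiv ℝ η x (EuclideanSpace.single i 1)) := by
      congr 1; ext x; rw [gradient_apply_eq_fderiv]; ring
    have e2 : ∫ x in Ω, (w x • gradient φ x + φ x • Dw x) i * η x
        = (∫ x in Ω, w x * (fderiv ℝ φ x (EuclideanSpace.single i 1) * η x))
          + ∫ x in Ω, Dw x i * (φ x * η x) := by
      rw [← integral_add i1 i3]
      congr 1; ext x
      simp only [PiLp.add_apply, PiLp.smul_apply, gradient_apply_eq_fderiv, smul_eq_mul]
      ring
    rw [e1, e2]
    linarith
  -- The products of φ with functions smooth up to the boundary that approximate w are test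
  -- functions.
  · choose ψ hψC hψ1 hψ2 using fun n : ℕ =>
      hΩ.exists_contDiff_approx hΩo hΩb hP1 hP hw (half_pow_pos n)
    have hψC1 : ∀ n, ContDiff ℝ 1 (ψ n) := fun n => (hψC n).of_le (by exact_mod_cast le_top)
    obtain ⟨A, hA⟩ := exists_bound_of_continuous_of_isBounded hΩb hφ.1.continuous
    obtain ⟨B, hB⟩ := exists_bound_of_continuous_of_isBounded hΩb hgφ
    have hA' : ∀ᵐ x ∂volume.restrict Ω, ‖φ x‖ ≤ A :=
      (ae_restrict_iff' hΩo.measurableSet).2 (Filter.Eventually.of_forall hA)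
    have hB' : ∀ᵐ x ∂volume.restrict Ω, ‖gradient φ x‖ ≤ B :=
      (ae_restrict_iff' hΩo.measurableSet).2 (Filter.Eventually.of_forall hB)
    have hlim : ∀ c : ℝ≥0∞, c ≠ ⊤ → Tendsto (fun n : ℕ => c * (1 / 2) ^ n) atTop (𝓝 0) := by
      intro c hc
      have := ENNReal.Tendsto.const_mul tendsto_half_pow_zero (Or.inr hc)
      rwa [mul_zero] at this
    refine ⟨fun n x => φ x * ψ n x, fun n => ⟨hφ.1.mul (hψC n), hφ.2.1.mul_right,
      tsupport_mul_subset_left.trans hφ.2.2⟩, ?_, ?_⟩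
    · refine tendsto_of_tendsto_of_tendsto_of_le_of_le tendsto_const_nhds
        (hlim (ENNReal.ofReal A) ENNReal.ofReal_ne_top) (fun _ => zero_le) fun n => ?_
      refine (eLpNorm_le_mul_eLpNorm_of_ae_le_mul (g := fun x => ψ n x - w x) (c := A) ?_ P).trans
        (by gcongr; exact hψ1 n)
      filter_upwards [hA'] with x hx
      rw [← mul_sub, norm_mul]
      gcongr
    · refine tendsto_of_tendsto_of_tendsto_of_le_of_le tendsto_const_nhds
        (hlim (ENNReal.ofReal B + ENNReal.ofReal A) (by finiteness)) (fun _ => zero_le) fun n => ?_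
      have hdec : (fun x => gradient (fun x => φ x * ψ n x) x
            - (w x • gradient φ x + φ x • Dw x))
          = (fun x => (ψ n x - w x) • gradient φ x)
            + fun x => φ x • (gradient (ψ n) x - Dw x) := by
        ext1 x
        rw [gradient_mul hφ1 (hψC1 n), Pi.add_apply, sub_smul, smul_sub]
        abel
      dsimp only
      rw [hdec, add_mul]
      refine (eLpNorm_add_le (((hψC n).continuous.aestronglyMeasurable.sub hw.1.1).smul
        hgφ.aestronglyMeasurable) (hφ.1.continuous.aestronglyMeasurable.smul
        ((continuous_gradient (hψC1 n)).aestronglyMeasurable.sub hw.2.1.1)) hP1).trans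
        (add_le_add ?_ ?_)
      · refine (eLpNorm_le_mul_eLpNorm_of_ae_le_mul (g := fun x => ψ n x - w x) (c := B) ?_ P).trans
          (by gcongr; exact hψ1 n)
        filter_upwards [hB'] with x hx
        change ‖(ψ n x - w x) • gradient φ x‖ ≤ _
        rw [norm_smul, mul_comm]
        gcongr
      · refine (eLpNorm_le_mul_eLpNorm_of_ae_le_mul (g := fun x => gradient (ψ n) x - Dw x)
          (c := A) ?_ P).trans (by gcongr; exact hψ2 n)
        filter_upwards [hA'] with x hx
        change ‖φ x • (gradient (ψ n) x - Dw x)‖ ≤ _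
        rw [norm_smul]
        gcongr

/-- The stress tensor of the `(p,q)`-Laplacian contracted with the gradient. -/
noncomputable def pqStress (p q : ℝ) (i j : Fin N) (ξ : EuclideanSpace ℝ (Fin N)) : ℝ :=
  stress p (EuclideanSpace.single i 1) (EuclideanSpace.single j 1) ξ
    + stress q (EuclideanSpace.single i 1) (EuclideanSpace.single j 1) ξ

/-- The energy density of the `(p,q)`-Laplacian. -/
noncomputable def pqEnergy (p q : ℝ) (ξ : EuclideanSpace ℝ (Fin N)) : ℝ :=
  1 / p * ‖ξ‖ ^ p + 1 / q * ‖ξ‖ ^ q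

theorem pqStress_eq (p q : ℝ) (i j : Fin N) (ξ : EuclideanSpace ℝ (Fin N)) :
    pqStress p q i j ξ = (‖ξ‖ ^ (p - 2) + ‖ξ‖ ^ (q - 2)) * (ξ i * ξ j) := by
  simp [pqStress, stress, EuclideanSpace.inner_single_left]
  ring

variable {p q : ℝ}

theorem contDiff_pqStress (hp : 1 < p) (hq : 1 < q) (i j : Fin N) :
    ContDiff ℝ 1 (pqStress p q i j) :=
  (contDiff_stress hp _ _).add (contDiff_stress hq _ _)

theorem contDiff_pqEnergy (hp : 1 < p) (hq : 1 < q) :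
    ContDiff ℝ 1 (pqEnergy (N := N) p q) :=
  (contDiff_const.mul (contDiff_norm_rpow hp)).add (contDiff_const.mul (contDiff_norm_rpow hq))

theorem fderiv_pqEnergy_apply (hp : 1 < p) (hq : 1 < q) (ξ η : EuclideanSpace ℝ (Fin N)) :
    fderiv ℝ (pqEnergy p q) ξ η = (‖ξ‖ ^ (p - 2) + ‖ξ‖ ^ (q - 2)) * inner ℝ ξ η := by
  have h : HasFDerivAt (pqEnergy p q) _ ξ :=
    ((hasFDerivAt_norm_rpow ξ hp).const_mul (1 / p)).add
      ((hasFDerivAt_norm_rpow ξ hq).const_mul (1 / q))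
  rw [h.fderiv]
  simp only [add_apply, smul_apply, smul_eq_mul, innerSL_apply_apply]
  field_simp

theorem abs_pqStress_le (hq : 1 < q) (hqp : q < p) (i j : Fin N)
    (ξ : EuclideanSpace ℝ (Fin N)) : |pqStress p q i j ξ| ≤ 2 * (1 + ‖ξ‖ ^ p) := by
  have h1 := abs_stress_le (hq.trans hqp) (EuclideanSpace.single i (1 : ℝ))
    (EuclideanSpace.single j 1) ξ
  have h2 := abs_stress_le hq (EuclideanSpace.single i (1 : ℝ)) (EuclideanSpace.single j 1) ξ
  have h3 := rpow_le_one_add_rpow (norm_nonneg ξ) (by linarith) hqp.le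
  simp only [PiLp.norm_single, norm_one, mul_one, one_mul] at h1 h2
  exact (abs_add_le _ _).trans (by linarith)

theorem norm_fderiv_pqStress_le (hq : 1 < q) (hqp : q < p) (i j : Fin N)
    (ξ : EuclideanSpace ℝ (Fin N)) :
    ‖fderiv ℝ (pqStress p q i j) ξ‖ ≤ (4 + |p - 2| + |q - 2|) * (1 + ‖ξ‖ ^ (p - 1)) := by
  have hp := hq.trans hqp
  have h : HasFDerivAt (pqStress p q i j) _ ξ :=
    (hasFDerivAt_stress hp (EuclideanSpace.single i (1 : ℝ)) (EuclideanSpace.single j 1) ξ).add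
      (hasFDerivAt_stress hq (EuclideanSpace.single i (1 : ℝ)) (EuclideanSpace.single j 1) ξ)
  have h1 := norm_stressDeriv_le hp (EuclideanSpace.single i (1 : ℝ))
    (EuclideanSpace.single j 1) ξ
  have h2 := norm_stressDeriv_le hq (EuclideanSpace.single i (1 : ℝ))
    (EuclideanSpace.single j 1) ξ
  simp only [PiLp.norm_single, norm_one, mul_one] at h1 h2
  have h3 : ‖ξ‖ ^ (q - 1) ≤ 1 + ‖ξ‖ ^ (p - 1) :=
    rpow_le_one_add_rpow (norm_nonneg ξ) (by linarith) (by linarith)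
  have h4 : ‖ξ‖ ^ (p - 1) ≤ 1 + ‖ξ‖ ^ (p - 1) := by linarith
  rw [h.fderiv]
  calc _ ≤ _ := norm_add_le _ _
    _ ≤ (2 + |p - 2|) * ‖ξ‖ ^ (p - 1) + (2 + |q - 2|) * ‖ξ‖ ^ (q - 1) := add_le_add h1 h2
    _ ≤ (2 + |p - 2|) * (1 + ‖ξ‖ ^ (p - 1)) + (2 + |q - 2|) * (1 + ‖ξ‖ ^ (p - 1)) := by gcongr
    _ = _ := by ring

theorem abs_pqEnergy_le (hq : 1 < q) (hqp : q < p) (ξ : EuclideanSpace ℝ (Fin N)) :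
    |pqEnergy p q ξ| ≤ 2 * (1 + ‖ξ‖ ^ p) := by
  have h3 := rpow_le_one_add_rpow (norm_nonneg ξ) (by linarith) hqp.le
  have h1 : 1 / p * ‖ξ‖ ^ p ≤ 1 * ‖ξ‖ ^ p := by
    gcongr
    rw [div_le_one (by linarith)]; linarith
  have h2 : 1 / q * ‖ξ‖ ^ q ≤ 1 * ‖ξ‖ ^ q := by
    gcongr
    rw [div_le_one (by linarith)]; exact hq.le
  have h0 : 0 ≤ pqEnergy p q ξ := by
    have : 0 < p := by linarith
    unfold pqEnergy; positivity
  rw [abs_of_nonneg h0]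
  unfold pqEnergy
  linarith

theorem norm_fderiv_pqEnergy_le (hq : 1 < q) (hqp : q < p) (ξ : EuclideanSpace ℝ (Fin N)) :
    ‖fderiv ℝ (pqEnergy p q) ξ‖ ≤ 2 * (1 + ‖ξ‖ ^ (p - 1)) := by
  have h3 : ‖ξ‖ ^ (q - 1) ≤ 1 + ‖ξ‖ ^ (p - 1) :=
    rpow_le_one_add_rpow (norm_nonneg ξ) (by linarith) (by linarith)
  refine ContinuousLinearMap.opNorm_le_bound _ (by positivity) fun η => ?_
  rw [fderiv_pqEnergy_apply (hq.trans hqp) hq, norm_mul, Real.norm_of_nonneg (by positivity)]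
  calc (‖ξ‖ ^ (p - 2) + ‖ξ‖ ^ (q - 2)) * ‖inner ℝ ξ η‖
      ≤ (‖ξ‖ ^ (p - 2) + ‖ξ‖ ^ (q - 2)) * (‖ξ‖ * ‖η‖) := by
        gcongr; exact norm_inner_le_norm _ _
    _ = (‖ξ‖ ^ (p - 2) * ‖ξ‖ + ‖ξ‖ ^ (q - 2) * ‖ξ‖) * ‖η‖ := by ring
    _ ≤ _ := by
        rw [rpow_sub_two_mul_self (norm_nonneg _) (hq.trans hqp),
          rpow_sub_two_mul_self (norm_nonneg _) hq]
        gcongr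
        linarith

/-- The `i`-th component of the divergence of the Pohozaev tensor
`(|V|^{p-2} + |V|^{q-2}) V ⊗ V - (|V|^p / p + |V|^q / q) I`. -/
noncomputable def pohozaevDiv (p q : ℝ) (V : EuclideanSpace ℝ (Fin N) → EuclideanSpace ℝ (Fin N))
    (H : Fin N → EuclideanSpace ℝ (Fin N) → EuclideanSpace ℝ (Fin N)) (i : Fin N)
    (x : EuclideanSpace ℝ (Fin N)) : ℝ :=
  (∑ j, fderiv ℝ (pqStress p q i j) (V x) (weakDirDeriv H (EuclideanSpace.single j 1) x))
    - fderiv ℝ (pqEnergy p q) (V x) (weakDirDeriv H (EuclideanSpace.single i 1) x)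

variable {V D : EuclideanSpace ℝ (Fin N) → EuclideanSpace ℝ (Fin N)}
  {H : Fin N → EuclideanSpace ℝ (Fin N) → EuclideanSpace ℝ (Fin N)}

/-- **Gauss-Green** for the Pohozaev tensor. -/
theorem HasC1Boundary.integral_pohozaevDiv (hΩ : HasC1Boundary Ω) (hΩo : IsOpen Ω)
    (hΩb : Bornology.IsBounded Ω) (hq : 1 < q) (hqp : q < p)
    (hV : ∀ i, MemW1 Ω (ENNReal.ofReal p) (fun x => V x i) (H i))
    (hD : ∀ i, IsTrace Ω (ENNReal.ofReal p) (fun x => V x i) (fun x => D x i)) (i : Fin N) :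
    IntegrableOn (pohozaevDiv p q V H i) Ω ∧
    Integrable (fun x => pqEnergy p q (D x)) (surfaceMeasure Ω) ∧
    (∀ j, Integrable (fun x => pqStress p q i j (D x)) (surfaceMeasure Ω)) ∧
    (∀ φ : EuclideanSpace ℝ (Fin N) → ℝ, ContDiff ℝ 1 φ →
      (∑ j, ∫ x in Ω, pqStress p q i j (V x) * fderiv ℝ φ x (EuclideanSpace.single j 1))
        - (∫ x in Ω, pqEnergy p q (V x) * fderiv ℝ φ x (EuclideanSpace.single i 1))
        + ∫ x in Ω, pohozaevDiv p q V H i x * φ x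
      = (∑ j, ∫ x, pqStress p q i j (D x) * (φ x * exteriorNormal Ω x j) ∂surfaceMeasure Ω)
        - ∫ x, pqEnergy p q (D x) * (φ x * exteriorNormal Ω x i) ∂surfaceMeasure Ω) := by
  have hp := hq.trans hqp
  obtain ⟨-, e2, e3, e4⟩ := hΩ.integral_nonlinear_gaussGreen hΩo hΩb hp hV hD
    (contDiff_pqEnergy hp hq) (by norm_num) (abs_pqEnergy_le hq hqp)
    (norm_fderiv_pqEnergy_le hq hqp) (EuclideanSpace.single i 1)
  have hs := fun j => hΩ.integral_nonlinear_gaussGreen hΩo hΩb hp hV hD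
    (contDiff_pqStress hp hq i j) (C := 4 + |p - 2| + |q - 2|) (by positivity)
    (fun ξ => (abs_pqStress_le hq hqp i j ξ).trans (by
      gcongr
      linarith [abs_nonneg (p - 2), abs_nonneg (q - 2)]))
    (norm_fderiv_pqStress_le hq hqp i j) (EuclideanSpace.single j 1)
  have hB : IntegrableOn (pohozaevDiv p q V H i) Ω :=
    (integrable_finsetSum _ fun j _ => (hs j).2.1).sub e2
  refine ⟨hB, e3, fun j => (hs j).2.2.1, fun φ hφ => ?_⟩
  have e5 := e4 φ hφ
  have hs5 := fun j => (hs j).2.2.2 φ hφ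
  simp only [EuclideanSpace.inner_single_right, one_mul, conj_trivial] at e5 hs5
  rw [← e5, ← Finset.sum_congr rfl fun j _ => hs5 j, Finset.sum_add_distrib,
    ← integral_finsetSum _ fun j _ =>
      integrableOn_mul_of_continuous hΩo hΩb hφ.continuous (hs j).2.1]
  have h1 : ∫ x in Ω, pohozaevDiv p q V H i x * φ x
      = (∫ x in Ω, ∑ j, fderiv ℝ (pqStress p q i j) (V x)
          (weakDirDeriv H (EuclideanSpace.single j 1) x) * φ x)
        - ∫ x in Ω, fderiv ℝ (pqEnergy p q) (V x)
          (weakDirDeriv H (EuclideanSpace.single i 1) x) * φ x := by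
    rw [← integral_sub (integrable_finsetSum _ fun j _ =>
      integrableOn_mul_of_continuous hΩo hΩb hφ.continuous (hs j).2.1)
      (integrableOn_mul_of_continuous hΩo hΩb hφ.continuous e2)]
    congr 1
    ext x
    rw [pohozaevDiv, sub_mul, Finset.sum_mul]
  rw [h1]
  ring

/-- Test with a bump equal to 1 near the point. This is how local integrability of g(u) ∂_i u is
extracted from the weak formulation, which only speaks of products with admissible test functions.
-/
theorem locallyIntegrableOn_of_forall_testFunction_mul (hΩo : IsOpen Ω)
    {f : EuclideanSpace ℝ (Fin N) → ℝ}
    (h : ∀ φ, IsTestFunction Ω φ → IntegrableOn (fun x => f x * φ x) Ω) :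
    LocallyIntegrableOn f Ω := by
  intro x hx
  obtain ⟨ε, hε, hball⟩ := Metric.isOpen_iff.1 hΩo x hx
  let b : ContDiffBump x := ⟨ε / 4, ε / 2, by linarith, by linarith⟩
  have hb : IsTestFunction Ω b := by
    refine ⟨b.contDiff, b.hasCompactSupport, ?_⟩
    rw [b.tsupport_eq]
    exact (Metric.closedBall_subset_ball (show ε / 2 < ε by linarith)).trans hball
  have hsub : Metric.ball x (ε / 4) ⊆ Ω :=
    (Metric.ball_subset_ball (by linarith)).trans hball
  refine ⟨Metric.ball x (ε / 4), mem_nhdsWithin_of_mem_nhds (Metric.ball_mem_nhds x (by linarith)),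
    ?_⟩
  refine IntegrableOn.congr_fun ((h b hb).mono_set hsub) (fun y hy => ?_) measurableSet_ball
  have : b y = 1 := b.one_of_mem_closedBall (Metric.ball_subset_closedBall hy)
  simp [this]

/-- The weak equation in the strong form `div T = -g(u) ∇u` for the Pohozaev tensor `T`. -/
theorem IsWeakSolution.pohozaevDiv_eq (hΩ : HasC1Boundary Ω) (hΩo : IsOpen Ω)
    (hΩb : Bornology.IsBounded Ω) (hq : 1 < q) (hqp : q < p) {g : ℝ → ℝ}
    {u : EuclideanSpace ℝ (Fin N) → ℝ} (hu : IsWeakSolution Ω p q g u V)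
    (hV : ∀ i, MemW1 Ω (ENNReal.ofReal p) (fun x => V x i) (H i))
    (hD : ∀ i, IsTrace Ω (ENNReal.ofReal p) (fun x => V x i) (fun x => D x i)) (i : Fin N) :
    ∀ᵐ x ∂volume.restrict Ω, pohozaevDiv p q V H i x = -(g (u x) * V x i) := by
  have hp := hq.trans hqp
  have hP1 : 1 ≤ ENNReal.ofReal p := by rw [ENNReal.one_le_ofReal]; exact hp.le
  obtain ⟨b1, b2, b3, b4⟩ := hΩ.integral_pohozaevDiv hΩo hΩb hq hqp hV hD i
  -- Symmetry of the Hessian: ∂_i ∇u = ∇ ∂_i u.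
  have hdir : ∀ᵐ x ∂volume.restrict Ω, weakDirDeriv H (EuclideanSpace.single i 1) x = H i x := by
    filter_upwards [ae_all_iff.2 fun j =>
      hu.1.1.2.2.hessian_symm hΩo (fun i => (hV i).2.2) i j] with x hx
    ext j
    rw [hx j]
    simp [EuclideanSpace.inner_single_right]
  have hsI : ∀ j, IntegrableOn (fun x => pqStress p q i j (V x)) Ω := fun j =>
    (hΩ.integral_nonlinear_gaussGreen hΩo hΩb hp hV hD
      (contDiff_pqStress hp hq i j) (C := 4 + |p - 2| + |q - 2|) (by positivity)
      (fun ξ => (abs_pqStress_le hq hqp i j ξ).trans (by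
        gcongr
        linarith [abs_nonneg (p - 2), abs_nonneg (q - 2)]))
      (norm_fderiv_pqStress_le hq hqp i j) (EuclideanSpace.single j 1)).1
  obtain ⟨-, heI, -, heG⟩ := hΩ.integral_nonlinear_gaussGreen hΩo hΩb hp hV hD
    (contDiff_pqEnergy hp hq) (by norm_num) (abs_pqEnergy_le hq hqp)
    (norm_fderiv_pqEnergy_le hq hqp) (EuclideanSpace.single i 1)
  -- The decisive test function is φ ∂_i u, which lies in W^{1,p}_0 because u is in W^{2,p}.
  have hgi : ∀ φ, IsTestFunction Ω φ → IntegrableOn (fun x => g (u x) * V x i * φ x) Ω := by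
    intro φ hφ
    refine ((hu.2 _ _ (hΩ.memW1Zero_testFunction_mul hΩo hΩb hP1 ENNReal.ofReal_ne_top
      (hV i) hφ)).1).congr (Filter.Eventually.of_forall fun x => ?_)
    ring
  refine ae_eq_of_forall_setIntegral_mul_eq hΩo b1.locallyIntegrableOn
    (locallyIntegrableOn_of_forall_testFunction_mul hΩo hgi).neg fun φ hφ => ?_
  have hφ1 : ContDiff ℝ 1 φ := hφ.1.of_le (by exact_mod_cast le_top)
  have hφf : ∀ x ∈ frontier Ω, φ x = 0 := fun x hx =>
    image_eq_zero_of_notMem_tsupport fun h =>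
      (hΩo.frontier_eq ▸ hx : x ∈ closure Ω \ Ω).2 (hφ.2.2 h)
  have hbd : ∀ (F : EuclideanSpace ℝ (Fin N) → ℝ) (j : Fin N),
      ∫ x, F (D x) * (φ x * exteriorNormal Ω x j) ∂surfaceMeasure Ω = 0 := fun F j =>
    setIntegral_eq_zero_of_forall_eq_zero fun x hx => by rw [hφf x hx, zero_mul, mul_zero]
  have h5 := b4 φ hφ1
  simp only [hbd, Finset.sum_const_zero, sub_zero] at h5
  have hφd : ∀ w, Continuous fun x => fderiv ℝ φ x w := fun w =>
    (hφ1.continuous_fderiv one_ne_zero).clm_apply continuous_const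
  have i1 : IntegrableOn (fun x => ∑ j, pqStress p q i j (V x)
      * fderiv ℝ φ x (EuclideanSpace.single j 1)) Ω :=
    integrable_finsetSum _ fun j _ => integrableOn_mul_of_continuous hΩo hΩb (hφd _) (hsI j)
  have i2 := integrableOn_mul_of_continuous hΩo hΩb hφ1.continuous heI
  have i3 := hgi φ hφ
  have h6 := heG φ hφ1
  simp only [EuclideanSpace.inner_single_right, one_mul, conj_trivial, hbd] at h6
  have h7 := (hu.2 _ _ (hΩ.memW1Zero_testFunction_mul hΩo hΩb hP1 ENNReal.ofReal_ne_top
    (hV i) hφ)).2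
  -- In the tested equation, the flux against ∂_i u ∇φ gives the stress entries against ∂_j φ, and
  -- against φ ∇∂_i u it gives φ times the ∂_i derivative of the energy density. The flux is never
  -- differentiated.
  have h8 : ∫ x in Ω, ((∑ j, pqStress p q i j (V x) * fderiv ℝ φ x (EuclideanSpace.single j 1))
      + fderiv ℝ (pqEnergy p q) (V x) (weakDirDeriv H (EuclideanSpace.single i 1) x) * φ x
      - g (u x) * V x i * φ x) = 0 := by
    rw [← h7]
    refine integral_congr_ae ?_
    filter_upwards [hdir] with x hx
    have hsum : ∑ j, pqStress p q i j (V x) * fderiv ℝ φ x (EuclideanSpace.single j 1)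
        = (‖V x‖ ^ (p - 2) + ‖V x‖ ^ (q - 2)) * (V x i * inner ℝ (V x) (gradient φ x)) := by
      rw [PiLp.inner_apply, Finset.mul_sum, Finset.mul_sum]
      refine Finset.sum_congr rfl fun j _ => ?_
      rw [pqStress_eq, gradient_apply_eq_fderiv]
      simp only [RCLike.inner_apply, conj_trivial]
      ring
    rw [hx, hsum, fderiv_pqEnergy_apply hp hq, inner_add_right, inner_smul_right,
      inner_smul_right]
    ring
  have i12 : IntegrableOn (fun x => (∑ j, pqStress p q i j (V x)
      * fderiv ℝ φ x (EuclideanSpace.single j 1))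
      + fderiv ℝ (pqEnergy p q) (V x) (weakDirDeriv H (EuclideanSpace.single i 1) x) * φ x) Ω :=
    i1.add i2
  rw [integral_sub i12 i3, integral_add i1 i2, integral_finsetSum _ fun j _ =>
    integrableOn_mul_of_continuous hΩo hΩb (hφd _) (hsI j)] at h8
  have h9 : ∫ x in Ω, -(g (u x) * V x i) * φ x = -∫ x in Ω, g (u x) * V x i * φ x := by
    rw [← integral_neg]
    congr 1
    ext x
    ring
  rw [h9]
  linarith

end WeakEquation

/-! ### Integrating G(u) by parts without growth assumptions on g. -/

section Primitive

variable {N : ℕ} {Ω : Set (EuclideanSpace ℝ (Fin N))}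

theorem hasDerivAt_primitive {f : ℝ → ℝ} (hf : Continuous f) (t : ℝ) :
    HasDerivAt (primitive f) (f t) t :=
  intervalIntegral.integral_hasDerivAt_right (hf.intervalIntegrable _ _)
    (hf.stronglyMeasurableAtFilter _ _) hf.continuousAt

theorem contDiff_primitive {f : ℝ → ℝ} (hf : Continuous f) : ContDiff ℝ 1 (primitive f) := by
  refine contDiff_one_iff_deriv.2 ⟨fun t => (hasDerivAt_primitive hf t).differentiableAt, ?_⟩
  rw [show deriv (primitive f) = f from funext fun t => (hasDerivAt_primitive hf t).deriv]
  exact hf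

theorem abs_primitive_le {f : ℝ → ℝ} {M : ℝ} (hM : ∀ t, |f t| ≤ M) (t : ℝ) :
    |primitive f t| ≤ M * |t| := by
  have h := intervalIntegral.norm_integral_le_of_norm_le_const (a := 0) (b := t) (C := M)
    (f := f) fun x _ => hM x
  simpa [primitive] using h

/-- `N ∫ F(u) = -∫ f(u) ∇u · x` for a primitive `F` of a bounded continuous function `f` and
`u ∈ W^{1,r}_0`. -/
theorem MemW1Zero.integral_primitive_of_bounded (hΩo : IsOpen Ω) (hΩb : Bornology.IsBounded Ω)
    {r : ℝ} (hr : 1 ≤ r) {u : EuclideanSpace ℝ (Fin N) → ℝ}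
    {V : EuclideanSpace ℝ (Fin N) → EuclideanSpace ℝ (Fin N)}
    (hu : MemW1Zero Ω (ENNReal.ofReal r) u V) {f : ℝ → ℝ} (hf : Continuous f) {M : ℝ}
    (hM : ∀ t, |f t| ≤ M) :
    IntegrableOn (fun x => primitive f (u x)) Ω ∧
    N * ∫ x in Ω, primitive f (u x) = - ∫ x in Ω, f (u x) * inner ℝ (V x) x := by
  have hfin := isFiniteMeasure_restrict_of_isBounded hΩb
  have hP : 1 ≤ ENNReal.ofReal r := by rwa [ENNReal.one_le_ofReal]
  obtain ⟨ψ, k₁, k₂, hψ, hk₁, hk₂, h1, h2⟩ := hu.exists_dominated_seq hr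
  have hM0 : 0 ≤ M := (abs_nonneg _).trans (hM 0)
  have hC1 : ∀ n, ContDiff ℝ 1 (ψ n) := fun n => (hψ _).1.of_le (by exact_mod_cast le_top)
  have hFc := contDiff_primitive hf
  have hFu : IntegrableOn (fun x => primitive f (u x)) Ω := by
    refine Integrable.mono' (((hu.1.1.integrable hP).norm).const_mul M)
      (hFc.continuous.comp_aestronglyMeasurable hu.1.1.1)
      (Filter.Eventually.of_forall fun x => abs_primitive_le hM _)
  refine ⟨hFu, ?_⟩
  obtain ⟨R, hR⟩ := exists_bound_of_continuous_of_isBounded hΩb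
    (continuous_id (X := EuclideanSpace ℝ (Fin N)))
  have l1 : Tendsto (fun n => ∫ x in Ω, primitive f (ψ n x)) atTop
      (𝓝 (∫ x in Ω, primitive f (u x))) := by
    refine tendsto_integral_of_dominated_convergence (fun x => M * k₁ x)
      (fun n => (hFc.continuous.comp (hC1 n).continuous).aestronglyMeasurable)
      ((hk₁.integrable hP).const_mul M) (fun n => ?_) ?_
    · filter_upwards [h1] with x hx
      refine (abs_primitive_le hM _).trans ?_
      gcongr
      exact hx.1 n
    · filter_upwards [h1] with x hx using (hFc.continuous.tendsto _).comp hx.2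
  have l2 : Tendsto (fun n => ∫ x in Ω, f (ψ n x) * inner ℝ (gradient (ψ n) x) x) atTop
      (𝓝 (∫ x in Ω, f (u x) * inner ℝ (V x) x)) := by
    refine tendsto_integral_of_dominated_convergence (fun x => M * (k₂ x * R))
      (fun n => ((hf.comp (hC1 n).continuous).mul
        ((continuous_gradient (hC1 n)).inner continuous_id)).aestronglyMeasurable)
      (((hk₂.integrable hP).mul_const R).const_mul M) (fun n => ?_) ?_
    · filter_upwards [h2, ae_restrict_mem hΩo.measurableSet] with x hx hxΩ
      rw [norm_mul]
      have h3 : ‖(inner ℝ (gradient (ψ n) x) x : ℝ)‖ ≤ k₂ x * R :=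
        (norm_inner_le_norm _ _).trans (mul_le_mul (hx.1 n) (hR x hxΩ) (norm_nonneg _)
          ((norm_nonneg _).trans (hx.1 n)))
      exact mul_le_mul (hM _) h3 (norm_nonneg _) hM0
    · filter_upwards [h1, h2] with x hx1 hx2
      exact ((hf.tendsto _).comp hx1.2).mul (hx2.2.inner tendsto_const_nhds)
  refine tendsto_nhds_unique (l1.const_mul (N : ℝ)) (l2.neg.congr fun n => ?_)
  have hFψ : ContDiff ℝ 1 fun x => primitive f (ψ n x) := hFc.comp (hC1 n)
  -- This keeps F(ψ) compactly supported in Ω.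
  have hF0 : primitive f 0 = 0 := by simp [primitive]
  have hsupp : tsupport (fun x => primitive f (ψ n x)) ⊆ tsupport (ψ n) :=
    closure_mono fun x hx => by
      rw [Function.mem_support] at hx ⊢
      intro h
      exact hx (by rw [h, hF0])
  have hcomp : HasCompactSupport fun x => primitive f (ψ n x) :=
    (hψ n).2.1.mono' ((subset_tsupport _).trans hsupp)
  have hder : ∀ x w, fderiv ℝ (fun x => primitive f (ψ n x)) x w
      = f (ψ n x) * fderiv ℝ (ψ n) x w := by
    intro x w
    have h3 : HasFDerivAt (fun x => primitive f (ψ n x)) _ x :=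
      (hasDerivAt_primitive hf (ψ n x)).comp_hasFDerivAt x
        ((hC1 n).differentiable one_ne_zero x).hasFDerivAt
    rw [h3.fderiv]
    simp
  -- The factor N arises here: ∂_i x_i = 1 for each of the N coordinates.
  have hi : ∀ i : Fin N, ∫ x in Ω, f (ψ n x) * gradient (ψ n) x i * x i
      = - ∫ x in Ω, primitive f (ψ n x) := by
    intro i
    have hxi : ContDiff ℝ 1 fun x : EuclideanSpace ℝ (Fin N) => x i :=
      (EuclideanSpace.proj (𝕜 := ℝ) i).contDiff
    have h4 := setIntegral_fderiv_mul_eq_neg hΩo hΩb hFψ hcomp (hsupp.trans (hψ n).2.2) hxi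
      (EuclideanSpace.single i 1)
    have h5 : ∀ x, fderiv ℝ (fun x : EuclideanSpace ℝ (Fin N) => x i) x
        (EuclideanSpace.single i 1) = 1 := by
      intro x
      rw [show (fun x : EuclideanSpace ℝ (Fin N) => x i)
        = EuclideanSpace.proj (𝕜 := ℝ) i from rfl, ContinuousLinearMap.fderiv]
      simp
    simp only [hder, h5, mul_one] at h4
    simpa only [gradient_apply_eq_fderiv] using h4
  have hci : ∀ i : Fin N, IntegrableOn (fun x => f (ψ n x) * gradient (ψ n) x i * x i) Ω :=
    fun i => integrableOn_of_continuous_of_isBounded hΩb (((hf.comp (hC1 n).continuous).mul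
      ((EuclideanSpace.proj (𝕜 := ℝ) i).continuous.comp (continuous_gradient (hC1 n)))).mul
      (EuclideanSpace.proj (𝕜 := ℝ) i).continuous)
  have h6 : ∫ x in Ω, f (ψ n x) * inner ℝ (gradient (ψ n) x) x
      = ∑ i, ∫ x in Ω, f (ψ n x) * gradient (ψ n) x i * x i := by
    rw [← integral_finsetSum _ fun i _ => hci i]
    congr 1
    ext x
    rw [PiLp.inner_apply, Finset.mul_sum]
    refine Finset.sum_congr rfl fun i _ => ?_
    simp only [RCLike.inner_apply, conj_trivial]
    ring
  rw [h6, Finset.sum_congr rfl fun i _ => hi i]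
  simp

/-- A continuous cut-off function on the line. -/
noncomputable def lineCutoff (k : ℕ) (t : ℝ) : ℝ := max 0 (min 1 (k + 1 - |t|))

theorem continuous_lineCutoff (k : ℕ) : Continuous (lineCutoff k) := by
  unfold lineCutoff; fun_prop

theorem lineCutoff_nonneg (k : ℕ) (t : ℝ) : 0 ≤ lineCutoff k t := le_max_left _ _

theorem lineCutoff_le_one (k : ℕ) (t : ℝ) : lineCutoff k t ≤ 1 :=
  max_le zero_le_one (min_le_left _ _)

theorem lineCutoff_eq_one {k : ℕ} {t : ℝ} (h : |t| ≤ k) : lineCutoff k t = 1 := by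
  rw [lineCutoff, min_eq_left (by linarith), max_eq_right zero_le_one]

theorem exists_bound_mul_lineCutoff {g : ℝ → ℝ} (hg : Continuous g) (k : ℕ) :
    ∃ M, ∀ t, |g t * lineCutoff k t| ≤ M := by
  obtain ⟨M, hM⟩ := (isCompact_Icc (a := -((k : ℝ) + 1)) (b := k + 1)).exists_bound_of_continuousOn
    hg.continuousOn
  refine ⟨max M 0, fun t => ?_⟩
  rcases le_total |t| (k + 1) with h | h
  · rw [abs_mul, abs_of_nonneg (lineCutoff_nonneg k t)]
    calc |g t| * lineCutoff k t ≤ |g t| * 1 := by gcongr; exact lineCutoff_le_one k t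
      _ ≤ _ := by rw [mul_one]; exact (hM t (abs_le.1 h)).trans (le_max_left _ _)
  · have : lineCutoff k t = 0 := by
      rw [lineCutoff, min_eq_right (by linarith), max_eq_left (by linarith)]
    simp [this]

theorem primitive_mul_lineCutoff_eq (g : ℝ → ℝ) {k : ℕ} {t : ℝ} (h : |t| ≤ k) :
    primitive (fun s => g s * lineCutoff k s) t = primitive g t := by
  refine intervalIntegral.integral_congr fun s hs => ?_
  have hs' : |s| ≤ |t| := by
    have := abs_sub_left_of_mem_uIcc hs
    simpa using this
  simp [lineCutoff_eq_one (hs'.trans h)]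

/-- A continuous substitute for the sign function. -/
noncomputable def clampSign (t : ℝ) : ℝ := max (-1) (min 1 t)

theorem continuous_clampSign : Continuous clampSign := by unfold clampSign; fun_prop

theorem abs_clampSign_le (t : ℝ) : |clampSign t| ≤ 1 :=
  abs_le.2 ⟨le_max_left _ _, max_le (by norm_num) (min_le_left _ _)⟩

theorem clampSign_neg (t : ℝ) : clampSign (-t) = -clampSign t := by
  simp only [clampSign, max_def, min_def]
  split_ifs <;> linarith

theorem clampSign_nonneg {t : ℝ} (ht : 0 ≤ t) : 0 ≤ clampSign t :=
  (le_min zero_le_one ht).trans (le_max_right _ _)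

theorem clampSign_eq_one {t : ℝ} (ht : 1 ≤ t) : clampSign t = 1 := by
  rw [clampSign, min_eq_left ht, max_eq_right (by norm_num)]

theorem primitive_neg (f : ℝ → ℝ) (t : ℝ) :
    primitive f (-t) = -primitive (fun s => f (-s)) t := by
  simp only [primitive]
  rw [intervalIntegral.integral_comp_neg, neg_zero, intervalIntegral.integral_symm]

/-- Beyond 1 the clamped sign equals 1 and the increments compare directly; on [0,1], where it is
smaller, the left side is at most C. The constant does not depend on the weight c, which serves both
as a cut-off and as its complement. -/
theorem abs_primitive_le_add_of_nonneg {g : ℝ → ℝ} (hg : Continuous g) {C : ℝ}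
    (hC : ∀ s ∈ Icc (-1 : ℝ) 1, |g s| ≤ C) {c : ℝ → ℝ} (hc : Continuous c) (hc0 : ∀ s, 0 ≤ c s)
    (hc1 : ∀ s, c s ≤ 1) {t : ℝ} (ht : 0 ≤ t) :
    0 ≤ primitive (fun s => |g s| * clampSign s * c s) t ∧
    |primitive (fun s => g s * c s) t|
      ≤ primitive (fun s => |g s| * clampSign s * c s) t + C := by
  have hK0 : ∀ {t}, 0 ≤ t → 0 ≤ primitive (fun s => |g s| * clampSign s * c s) t := by
    intro t ht
    refine intervalIntegral.integral_nonneg ht fun s hs => ?_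
    have := clampSign_nonneg hs.1
    have := hc0 s
    positivity
  have hsmall : ∀ {t}, 0 ≤ t → t ≤ 1 → |primitive (fun s => g s * c s) t| ≤ C := by
    intro t ht ht1
    have hC0 : 0 ≤ C := (abs_nonneg _).trans (hC 0 (by norm_num))
    have h := intervalIntegral.norm_integral_le_of_norm_le_const (a := 0) (b := t) (C := C)
      (f := fun s => g s * c s) fun s hs => by
        rw [uIoc_of_le ht] at hs
        rw [norm_mul, Real.norm_eq_abs, Real.norm_of_nonneg (hc0 s)]
        calc |g s| * c s ≤ C * 1 :=
              mul_le_mul (hC s ⟨by linarith [hs.1], hs.2.trans ht1⟩) (hc1 s) (hc0 s) hC0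
          _ = C := mul_one C
    rw [sub_zero, abs_of_nonneg ht] at h
    exact h.trans (mul_le_of_le_one_right hC0 ht1)
  refine ⟨hK0 ht, ?_⟩
  rcases le_total t 1 with h1 | h1
  · linarith [hsmall ht h1, hK0 ht]
  have hf1 : Continuous fun s => g s * c s := hg.mul hc
  have hf2 : Continuous fun s => |g s| * clampSign s * c s :=
    (hg.abs.mul continuous_clampSign).mul hc
  have e1 : primitive (fun s => g s * c s) t
      = primitive (fun s => g s * c s) 1 + ∫ s in (1 : ℝ)..t, g s * c s :=
    (intervalIntegral.integral_add_adjacent_intervals (hf1.intervalIntegrable _ _)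
      (hf1.intervalIntegrable _ _)).symm
  have e2 : primitive (fun s => |g s| * clampSign s * c s) t
      = primitive (fun s => |g s| * clampSign s * c s) 1
        + ∫ s in (1 : ℝ)..t, |g s| * clampSign s * c s :=
    (intervalIntegral.integral_add_adjacent_intervals (hf2.intervalIntegrable _ _)
      (hf2.intervalIntegrable _ _)).symm
  have e3 : |∫ s in (1 : ℝ)..t, g s * c s| ≤ ∫ s in (1 : ℝ)..t, |g s| * clampSign s * c s := by
    refine (intervalIntegral.abs_integral_le_integral_abs h1).trans (le_of_eq ?_)
    refine intervalIntegral.integral_congr fun s hs => ?_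
    rw [uIcc_of_le h1] at hs
    rw [clampSign_eq_one hs.1, abs_mul, abs_of_nonneg (hc0 s), mul_one]
  rw [e1, e2]
  have e4 := abs_add_le (primitive (fun s => g s * c s) 1) (∫ s in (1 : ℝ)..t, g s * c s)
  linarith [hsmall zero_le_one le_rfl, hK0 (t := 1) zero_le_one]

/-- Negative arguments reduce to positive ones by reflection, since the clamped sign is odd. -/
theorem abs_primitive_le_add {g : ℝ → ℝ} (hg : Continuous g) {C : ℝ}
    (hC : ∀ s ∈ Icc (-1 : ℝ) 1, |g s| ≤ C) {c : ℝ → ℝ} (hc : Continuous c) (hc0 : ∀ s, 0 ≤ c s)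
    (hc1 : ∀ s, c s ≤ 1) (t : ℝ) :
    0 ≤ primitive (fun s => |g s| * clampSign s * c s) t ∧
    |primitive (fun s => g s * c s) t|
      ≤ primitive (fun s => |g s| * clampSign s * c s) t + C := by
  rcases le_total 0 t with ht | ht
  · exact abs_primitive_le_add_of_nonneg hg hC hc hc0 hc1 ht
  · obtain ⟨s, rfl⟩ : ∃ s, t = -s := ⟨-t, by ring⟩
    have h := abs_primitive_le_add_of_nonneg (hg.comp continuous_neg) (C := C)
      (fun s hs => hC (-s) ⟨by linarith [hs.2], by linarith [hs.1]⟩) (hc.comp continuous_neg)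
      (fun s => hc0 (-s)) (fun s => hc1 (-s)) (show 0 ≤ s by linarith)
    have e1 : primitive (fun s => |g s| * clampSign s * c s) (-s)
        = primitive (fun s => |(g ∘ Neg.neg) s| * clampSign s * (c ∘ Neg.neg) s) s := by
      rw [primitive_neg]
      simp only [primitive, clampSign_neg, Function.comp_apply]
      rw [← intervalIntegral.integral_neg]
      congr 1
      ext s
      ring
    rw [e1, primitive_neg, abs_neg]
    exact h

/-- `N ∫ G(u) = -∫ g(u) ∇u · x` for the primitive `G` of `g` and `u ∈ W^{1,r}_0`, as soon as
`g(u) ∇u` is integrable. -/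
theorem MemW1Zero.integral_primitive (hΩo : IsOpen Ω) (hΩb : Bornology.IsBounded Ω)
    {r : ℝ} (hr : 1 ≤ r) (hN : 0 < N) {u : EuclideanSpace ℝ (Fin N) → ℝ}
    {V : EuclideanSpace ℝ (Fin N) → EuclideanSpace ℝ (Fin N)}
    (hu : MemW1Zero Ω (ENNReal.ofReal r) u V) {g : ℝ → ℝ} (hg : Continuous g)
    (hgV : IntegrableOn (fun x => g (u x) • V x) Ω) :
    IntegrableOn (fun x => primitive g (u x)) Ω ∧
    N * ∫ x in Ω, primitive g (u x) = - ∫ x in Ω, g (u x) * inner ℝ (V x) x := by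
  have hfin := isFiniteMeasure_restrict_of_isBounded hΩb
  have hum : AEStronglyMeasurable u (volume.restrict Ω) := hu.1.1.1
  have hVm : AEStronglyMeasurable V (volume.restrict Ω) := hu.1.2.1.1
  obtain ⟨R, hR⟩ := exists_bound_of_continuous_of_isBounded hΩb
    (continuous_id (X := EuclideanSpace ℝ (Fin N)))
  obtain ⟨C, hC⟩ := (isCompact_Icc (a := (-1 : ℝ)) (b := 1)).exists_bound_of_continuousOn
    hg.continuousOn
  have hC0 : 0 ≤ C := (norm_nonneg _).trans (hC 0 (by norm_num))
  have hN' : (0 : ℝ) < N := by exact_mod_cast hN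
  set B : EuclideanSpace ℝ (Fin N) → ℝ := fun x => ‖g (u x) • V x‖ * R with hB
  have hBi : Integrable B (volume.restrict Ω) := hgV.norm.mul_const R
  have hinner : ∀ᵐ x ∂volume.restrict Ω, ∀ a : ℝ, |a| ≤ |g (u x)| →
      ‖a * inner ℝ (V x) x‖ ≤ B x := by
    filter_upwards [ae_restrict_mem hΩo.measurableSet] with x hxΩ a ha
    rw [norm_mul]
    have h1 : ‖(inner ℝ (V x) x : ℝ)‖ ≤ ‖V x‖ * R :=
      (norm_inner_le_norm _ _).trans (by gcongr; exact hR x hxΩ)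
    calc ‖a‖ * ‖(inner ℝ (V x) x : ℝ)‖ ≤ |g (u x)| * (‖V x‖ * R) :=
          mul_le_mul ha h1 (norm_nonneg _) (abs_nonneg _)
      _ = B x := by simp only [hB, norm_smul, Real.norm_eq_abs]; ring
  have hθg : Continuous fun s => |g s| * clampSign s := hg.abs.mul continuous_clampSign
  have hfc : ∀ k : ℕ, Continuous fun s => g s * lineCutoff k s := fun k =>
    hg.mul (continuous_lineCutoff k)
  have hfθc : ∀ k : ℕ, Continuous fun s => |g s| * clampSign s * lineCutoff k s := fun k =>
    hθg.mul (continuous_lineCutoff k)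
  have hle : ∀ (k : ℕ) (t : ℝ), |g t * lineCutoff k t| ≤ |g t| := fun k t => by
    rw [abs_mul, abs_of_nonneg (lineCutoff_nonneg k t)]
    exact mul_le_of_le_one_right (abs_nonneg _) (lineCutoff_le_one k t)
  have hleθ : ∀ (k : ℕ) (t : ℝ), |(|g t| * clampSign t * lineCutoff k t)| ≤ |g t| := fun k t => by
    rw [abs_mul, abs_mul, abs_abs, abs_of_nonneg (lineCutoff_nonneg k t)]
    calc |g t| * |clampSign t| * lineCutoff k t ≤ |g t| * 1 * 1 := by
          gcongr
          · exact lineCutoff_nonneg k t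
          · exact abs_clampSign_le t
          · exact lineCutoff_le_one k t
      _ = _ := by ring
  choose M hM using fun k => exists_bound_mul_lineCutoff hg k
  choose M' hM' using fun k => exists_bound_mul_lineCutoff hθg k
  have hGk := fun k => hu.integral_primitive_of_bounded hΩo hΩb hr (hfc k) (hM k)
  have hKk := fun k => hu.integral_primitive_of_bounded hΩo hΩb hr (hfθc k) (hM' k)
  have hcomp := fun (k : ℕ) (t : ℝ) => abs_primitive_le_add hg hC (continuous_lineCutoff k)
    (lineCutoff_nonneg k) (lineCutoff_le_one k) t
  have hKlim : ∀ t : ℝ, Tendsto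
      (fun k : ℕ => primitive (fun s => |g s| * clampSign s * lineCutoff k s) t) atTop
      (𝓝 (primitive (fun s => |g s| * clampSign s) t)) := by
    intro t
    refine tendsto_const_nhds.congr' ?_
    filter_upwards [eventually_ge_atTop ⌈|t|⌉₊] with k hk
    exact (primitive_mul_lineCutoff_eq (fun s => |g s| * clampSign s)
      ((Nat.le_ceil _).trans (by exact_mod_cast hk))).symm
  have hGlim : ∀ t : ℝ, Tendsto
      (fun k : ℕ => primitive (fun s => g s * lineCutoff k s) t) atTop
      (𝓝 (primitive g t)) := by
    intro t
    refine tendsto_const_nhds.congr' ?_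
    filter_upwards [eventually_ge_atTop ⌈|t|⌉₊] with k hk
    exact (primitive_mul_lineCutoff_eq g ((Nat.le_ceil _).trans (by exact_mod_cast hk))).symm
  -- The difference is the primitive with weight 1 - `lineCutoff k`, which is again nonnegative.
  have hKmono : ∀ (k : ℕ) (t : ℝ), primitive (fun s => |g s| * clampSign s * lineCutoff k s) t
      ≤ primitive (fun s => |g s| * clampSign s) t := by
    intro k t
    have h1 := (abs_primitive_le_add hg hC (c := fun s => 1 - lineCutoff k s)
      (continuous_const.sub (continuous_lineCutoff k))
      (fun s => by linarith [lineCutoff_le_one k s])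
      (fun s => by linarith [lineCutoff_nonneg k s]) t).1
    have h2 : primitive (fun s => |g s| * clampSign s * (1 - lineCutoff k s)) t
        = primitive (fun s => |g s| * clampSign s) t
          - primitive (fun s => |g s| * clampSign s * lineCutoff k s) t := by
      simp only [primitive]
      rw [← intervalIntegral.integral_sub (hθg.intervalIntegrable _ _)
        ((hfθc k).intervalIntegrable _ _)]
      congr 1
      ext s
      ring
    linarith
  -- The truncated identity bounds the integrals of the truncated primitives of |g| `clampSign` by
  -- (1/N) ∫ |g(u) ∇u| R. These primitives are nonnegative, so Fatou's lemma applies; G itself may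
  -- change sign, and is dominated only afterwards.
  have hKint : IntegrableOn (fun x => primitive (fun s => |g s| * clampSign s) (u x)) Ω := by
    have hcont := (contDiff_primitive hθg).continuous
    refine ⟨hcont.comp_aestronglyMeasurable hum, ?_⟩
    have h1 := Lp.eLpNorm_lim_le_liminf_eLpNorm (p := 1) (μ := volume.restrict Ω)
      (f := fun (k : ℕ) x => primitive (fun s => |g s| * clampSign s * lineCutoff k s) (u x))
      (fun k => (hKk k).1.1) (fun x => primitive (fun s => |g s| * clampSign s) (u x))
      (Filter.Eventually.of_forall fun x => hKlim (u x))
    rw [eLpNorm_one_eq_lintegral_enorm] at h1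
    refine (h1.trans (liminf_le_of_le (by isBoundedDefault)
      (a := ENNReal.ofReal (1 / N * ∫ x in Ω, B x)) fun b hb => ?_)).trans_lt ENNReal.ofReal_lt_top
    obtain ⟨k, hk⟩ := hb.exists
    refine hk.trans ?_
    rw [eLpNorm_one_eq_lintegral_enorm, ← ofReal_integral_norm_eq_lintegral_enorm (hKk k).1]
    refine ENNReal.ofReal_le_ofReal ?_
    have h2 : ∫ x in Ω, ‖primitive (fun s => |g s| * clampSign s * lineCutoff k s) (u x)‖
        = ∫ x in Ω, primitive (fun s => |g s| * clampSign s * lineCutoff k s) (u x) := by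
      congr 1
      ext x
      exact Real.norm_of_nonneg (hcomp k (u x)).1
    have h3 : ‖∫ x in Ω, |g (u x)| * clampSign (u x) * lineCutoff k (u x) * inner ℝ (V x) x‖
        ≤ ∫ x in Ω, B x := by
      refine norm_integral_le_of_norm_le hBi ?_
      filter_upwards [hinner] with x hx using hx _ (hleθ k (u x))
    have h4 := (hKk k).2
    rw [h2, div_mul_eq_mul_div, one_mul, le_div_iff₀ hN', mul_comm, h4]
    exact (neg_le_abs _).trans h3
  have hGint : IntegrableOn (fun x => primitive g (u x)) Ω := by
    refine Integrable.mono' (hKint.add (integrable_const C))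
      ((contDiff_primitive hg).continuous.comp_aestronglyMeasurable hum)
      (Filter.Eventually.of_forall fun x => ?_)
    exact le_of_tendsto_of_tendsto' (hGlim (u x)).abs ((hKlim (u x)).add_const C)
      fun k => (hcomp k (u x)).2
  refine ⟨hGint, ?_⟩
  have l1 : Tendsto (fun k : ℕ => ∫ x in Ω, primitive (fun s => g s * lineCutoff k s) (u x)) atTop
      (𝓝 (∫ x in Ω, primitive g (u x))) := by
    refine tendsto_integral_of_dominated_convergence _ (fun k => (hGk k).1.1)
      (hKint.add (integrable_const C)) (fun k => Filter.Eventually.of_forall fun x => ?_)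
      (Filter.Eventually.of_forall fun x => hGlim (u x))
    exact (hcomp k (u x)).2.trans (add_le_add_left (hKmono k (u x)) C)
  have l2 : Tendsto (fun k : ℕ => ∫ x in Ω, g (u x) * lineCutoff k (u x) * inner ℝ (V x) x) atTop
      (𝓝 (∫ x in Ω, g (u x) * inner ℝ (V x) x)) := by
    refine tendsto_integral_of_dominated_convergence B
      (fun k => ((hfc k).comp_aestronglyMeasurable hum).mul
        (hVm.inner continuous_id.aestronglyMeasurable)) hBi
      (fun k => ?_) (Filter.Eventually.of_forall fun x => ?_)
    · filter_upwards [hinner] with x hx using hx _ (hle k (u x))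
    · refine Tendsto.mul_const _ (tendsto_const_nhds.congr' ?_)
      filter_upwards [eventually_ge_atTop ⌈|u x|⌉₊] with k hk
      rw [lineCutoff_eq_one ((Nat.le_ceil _).trans (by exact_mod_cast hk)), mul_one]
  exact tendsto_nhds_unique (l1.const_mul (N : ℝ)) (l2.neg.congr fun k => (hGk k).2.symm)

end Primitive

/-! ### Assembling the Pohozaev and energy identities. -/

section Pohozaev

variable {N : ℕ} {Ω : Set (EuclideanSpace ℝ (Fin N))} {p q : ℝ}
  {V D : EuclideanSpace ℝ (Fin N) → EuclideanSpace ℝ (Fin N)}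
  {H : Fin N → EuclideanSpace ℝ (Fin N) → EuclideanSpace ℝ (Fin N)}

theorem sum_coord_mul_coord (ξ η : EuclideanSpace ℝ (Fin N)) :
    ∑ i, ξ i * η i = inner ℝ ξ η := by
  rw [PiLp.inner_apply]
  refine Finset.sum_congr rfl fun i _ => ?_
  simp [mul_comm]

theorem integrableOn_norm_rpow_of_memLp (hΩb : Bornology.IsBounded Ω) (hq : 0 < q) (hqp : q ≤ p)
    (hV : MemLp V (ENNReal.ofReal p) (volume.restrict Ω)) :
    IntegrableOn (fun x => ‖V x‖ ^ q) Ω := by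
  have hfin := isFiniteMeasure_restrict_of_isBounded hΩb
  exact MemLp.integrable_norm_rpow_ofReal hq (hV.mono_exponent (ENNReal.ofReal_le_ofReal hqp))

/-- The Pohozaev tensor of a normal vector field, contracted with the position and the normal. -/
theorem pohozaev_boundary_eq (hp : 1 < p) (hq : 1 < q) {ν : EuclideanSpace ℝ (Fin N)}
    (hν : ‖ν‖ = 1) (h : ℝ) (x : EuclideanSpace ℝ (Fin N)) :
    ∑ i, ((∑ j, pqStress p q i j (h • ν) * (x i * ν j)) - pqEnergy p q (h • ν) * (x i * ν i))
      = ((1 - 1 / p) * |h| ^ p + (1 - 1 / q) * |h| ^ q) * inner ℝ x ν := by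
  have hn : ‖h • ν‖ = |h| := by rw [norm_smul, hν, mul_one, Real.norm_eq_abs]
  have h1 : ∀ i, ∑ j, pqStress p q i j (h • ν) * (x i * ν j)
      = (|h| ^ p + |h| ^ q) * (x i * ν i) := by
    intro i
    calc ∑ j, pqStress p q i j (h • ν) * (x i * ν j)
        = ∑ j, ((|h| ^ (p - 2) + |h| ^ (q - 2)) * |h| ^ 2 * (x i * ν i)) * (ν j * ν j) := by
          refine Finset.sum_congr rfl fun j _ => ?_
          rw [pqStress_eq, hn, sq_abs]
          simp only [PiLp.smul_apply, smul_eq_mul]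
          ring
      _ = _ := by
          rw [← Finset.mul_sum, sum_coord_mul_coord, real_inner_self_eq_norm_sq, hν, add_mul,
            rpow_sub_two_mul_sq (abs_nonneg h) hp, rpow_sub_two_mul_sq (abs_nonneg h) hq]
          ring
  rw [Finset.sum_sub_distrib, Finset.sum_congr rfl fun i _ => h1 i, ← Finset.mul_sum,
    ← Finset.mul_sum, sum_coord_mul_coord, pqEnergy, hn]
  ring

theorem sum_pqStress_self (hp : 1 < p) (hq : 1 < q) (ξ : EuclideanSpace ℝ (Fin N)) :
    ∑ i, pqStress p q i i ξ = ‖ξ‖ ^ p + ‖ξ‖ ^ q := by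
  simp only [pqStress_eq]
  rw [← Finset.mul_sum, sum_coord_mul_coord, real_inner_self_eq_norm_sq, add_mul,
    rpow_sub_two_mul_sq (norm_nonneg _) hp, rpow_sub_two_mul_sq (norm_nonneg _) hq]

/-- The integrability up to the boundary comes from the equation: each component is minus a
component of the divergence of the Pohozaev tensor, which is integrable by the growth of the tensor
alone. -/
theorem IsWeakSolution.integrableOn_smul_gradient (hΩ : HasC1Boundary Ω) (hΩo : IsOpen Ω)
    (hΩb : Bornology.IsBounded Ω) (hq : 1 < q) (hqp : q < p) {g : ℝ → ℝ} (hg : Continuous g)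
    {u : EuclideanSpace ℝ (Fin N) → ℝ} (hu : IsWeakSolution Ω p q g u V)
    (hV : ∀ i, MemW1 Ω (ENNReal.ofReal p) (fun x => V x i) (H i))
    (hD : ∀ i, IsTrace Ω (ENNReal.ofReal p) (fun x => V x i) (fun x => D x i)) :
    IntegrableOn (fun x => g (u x) • V x) Ω := by
  have hi : ∀ i, IntegrableOn (fun x => g (u x) * V x i) Ω := by
    intro i
    have h1 : IntegrableOn (fun x => -pohozaevDiv p q V H i x) Ω :=
      (hΩ.integral_pohozaevDiv hΩo hΩb hq hqp hV hD i).1.neg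
    refine h1.congr ?_
    filter_upwards [hu.pohozaevDiv_eq hΩ hΩo hΩb hq hqp hV hD i] with x hx
    rw [hx, neg_neg]
  refine Integrable.mono' (integrable_finsetSum Finset.univ fun i _ => (hi i).norm)
    ((hg.comp_aestronglyMeasurable hu.1.1.1.1).smul hu.1.1.2.1.1)
    (Filter.Eventually.of_forall fun x => ?_)
  exact norm_le_sum_coord (g (u x) • V x)

theorem fderiv_coord_single (i j : Fin N) (x : EuclideanSpace ℝ (Fin N)) :
    fderiv ℝ (fun x : EuclideanSpace ℝ (Fin N) => x i) x (EuclideanSpace.single j 1)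
      = if i = j then 1 else 0 := by
  rw [show (fun x : EuclideanSpace ℝ (Fin N) => x i) = EuclideanSpace.proj (𝕜 := ℝ) i from rfl,
    ContinuousLinearMap.fderiv]
  simp

/-- The Gauss-Green formula for the Pohozaev tensor against the position vector field. -/
theorem HasC1Boundary.pohozaev_identity (hΩ : HasC1Boundary Ω) (hΩo : IsOpen Ω)
    (hΩb : Bornology.IsBounded Ω) (hq : 1 < q) (hqp : q < p)
    {u : EuclideanSpace ℝ (Fin N) → ℝ} (hu : MemW1Zero Ω (ENNReal.ofReal p) u V)
    (hV : ∀ i, MemW1 Ω (ENNReal.ofReal p) (fun x => V x i) (H i))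
    (hD : ∀ i, IsTrace Ω (ENNReal.ofReal p) (fun x => V x i) (fun x => D x i))
    {h : EuclideanSpace ℝ (Fin N) → ℝ}
    (hh : ∀ᵐ x ∂surfaceMeasure Ω, h x = inner ℝ (D x) (exteriorNormal Ω x)) :
    Integrable (fun x => ((1 - 1 / p) * |h x| ^ p + (1 - 1 / q) * |h x| ^ q) *
        inner ℝ x (exteriorNormal Ω x)) (surfaceMeasure Ω) ∧
    (1 - N / p) * (∫ x in Ω, ‖V x‖ ^ p) + (1 - N / q) * (∫ x in Ω, ‖V x‖ ^ q)
        + ∫ x in Ω, ∑ i, pohozaevDiv p q V H i x * x i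
      = ∫ x, ((1 - 1 / p) * |h x| ^ p + (1 - 1 / q) * |h x| ^ q) *
        inner ℝ x (exteriorNormal Ω x) ∂surfaceMeasure Ω := by
  have hp := hq.trans hqp
  have hK := isCompact_frontier_of_isBounded hΩb
  have hfin := isFiniteMeasure_restrict_of_isBounded hΩb
  have hνc := hΩ.continuousOn_exteriorNormal hΩo
  have hxν : ∀ i j : Fin N, ContinuousOn (fun x => x i * exteriorNormal Ω x j) (frontier Ω) :=
    fun i j => (EuclideanSpace.proj (𝕜 := ℝ) i).continuous.continuousOn.mul
      ((EuclideanSpace.proj (𝕜 := ℝ) j).continuous.comp_continuousOn hνc)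
  have key := fun i => hΩ.integral_pohozaevDiv hΩo hΩb hq hqp hV hD i
  have hVp := integrableOn_norm_rpow_of_memLp hΩb (by linarith) le_rfl hu.1.2.1
  have hVq := integrableOn_norm_rpow_of_memLp hΩb (by linarith) hqp.le hu.1.2.1
  have hS : ∀ i, IntegrableOn (fun x => pqStress p q i i (V x)) Ω := fun i => by
    refine Integrable.mono' (((integrable_const 1).add hVp).const_mul 2)
      ((contDiff_pqStress hp hq i i).continuous.comp_aestronglyMeasurable hu.1.2.1.1)
      (Filter.Eventually.of_forall fun x => abs_pqStress_le hq hqp i i (V x))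
  have hSD : ∀ i j, Integrable
      (fun x => pqStress p q i j (D x) * (x i * exteriorNormal Ω x j)) (surfaceMeasure Ω) :=
    fun i j => IntegrableOn.mul_continuousOn (K := frontier Ω) ((key i).2.2.1 j) (hxν i j) hK
  have hED : ∀ i, Integrable
      (fun x => pqEnergy p q (D x) * (x i * exteriorNormal Ω x i)) (surfaceMeasure Ω) :=
    fun i => IntegrableOn.mul_continuousOn (K := frontier Ω) (key i).2.1 (hxν i i) hK
  have hSDs : ∀ i, Integrable (fun x => (∑ j, pqStress p q i j (D x)
      * (x i * exteriorNormal Ω x j)) - pqEnergy p q (D x) * (x i * exteriorNormal Ω x i))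
      (surfaceMeasure Ω) := fun i =>
    (integrable_finsetSum _ fun j _ => hSD i j).sub (hED i)
  have hbd : (fun x => ∑ i, ((∑ j, pqStress p q i j (D x) * (x i * exteriorNormal Ω x j))
        - pqEnergy p q (D x) * (x i * exteriorNormal Ω x i)))
      =ᵐ[surfaceMeasure Ω] fun x => ((1 - 1 / p) * |h x| ^ p + (1 - 1 / q) * |h x| ^ q) *
        inner ℝ x (exteriorNormal Ω x) := by
    have hν1 : ∀ᵐ x ∂surfaceMeasure Ω, ‖exteriorNormal Ω x‖ = 1 :=
      (ae_restrict_iff' isClosed_frontier.measurableSet).2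
        (Filter.Eventually.of_forall fun x hx => (hΩ.isExteriorUnitNormal hΩo hx).1)
    filter_upwards [hh, hν1, hΩ.trace_gradient_eq_smul hΩo hΩb hp hu hV hD] with x h1 h2 h3
    rw [← h1] at h3
    rw [h3]
    exact pohozaev_boundary_eq hp hq h2 (h x) x
  refine ⟨(integrable_finsetSum _ fun i _ => hSDs i).congr hbd, ?_⟩
  rw [← integral_congr_ae hbd, integral_finsetSum _ fun i _ => hSDs i]
  have hxi : ∀ i : Fin N, ContDiff ℝ 1 fun x : EuclideanSpace ℝ (Fin N) => x i := fun i =>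
    (EuclideanSpace.proj (𝕜 := ℝ) i).contDiff
  -- The i-th row of the tensor is tested with φ(x) = x_i, so only the diagonal entry remains; the
  -- sum over i gives its trace.
  have hterm : ∀ i, ∫ x, ((∑ j, pqStress p q i j (D x) * (x i * exteriorNormal Ω x j))
        - pqEnergy p q (D x) * (x i * exteriorNormal Ω x i)) ∂surfaceMeasure Ω
      = (∫ x in Ω, pqStress p q i i (V x)) - (∫ x in Ω, pqEnergy p q (V x))
        + ∫ x in Ω, pohozaevDiv p q V H i x * x i := by
    intro i
    have h1 := (key i).2.2.2 _ (hxi i)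
    simp only [fderiv_coord_single, mul_ite, mul_one, mul_zero, if_true] at h1
    rw [integral_sub (integrable_finsetSum _ fun j _ => hSD i j) (hED i),
      integral_finsetSum _ fun j _ => hSD i j, ← h1,
      Finset.sum_eq_single i (fun j _ hj => by simp [hj.symm]) (by simp)]
    simp
  rw [Finset.sum_congr rfl fun i _ => hterm i, Finset.sum_add_distrib, Finset.sum_sub_distrib,
    ← integral_finsetSum _ fun i _ => hS i, ← integral_finsetSum _ fun i _ =>
      integrableOn_mul_of_continuous hΩo hΩb (hxi i).continuous (key i).1]
  have hE : ∫ x in Ω, pqEnergy p q (V x)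
      = 1 / p * (∫ x in Ω, ‖V x‖ ^ p) + 1 / q * ∫ x in Ω, ‖V x‖ ^ q := by
    simp only [pqEnergy]
    rw [integral_add (hVp.const_mul _) (hVq.const_mul _), integral_const_mul, integral_const_mul]
  have hT : ∫ x in Ω, ∑ i, pqStress p q i i (V x)
      = (∫ x in Ω, ‖V x‖ ^ p) + ∫ x in Ω, ‖V x‖ ^ q := by
    simp only [sum_pqStress_self hp hq]
    exact integral_add hVp hVq
  rw [hT, hE]
  simp only [Finset.sum_const, Finset.card_univ, Fintype.card_fin, nsmul_eq_mul]
  ring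

/-- The energy identity, from testing the weak equation with the solution. -/
theorem IsWeakSolution.integral_norm_rpow_add (hΩb : Bornology.IsBounded Ω) (hq : 1 < q)
    (hqp : q < p) {g : ℝ → ℝ} {u : EuclideanSpace ℝ (Fin N) → ℝ}
    (hu : IsWeakSolution Ω p q g u V) :
    IntegrableOn (fun x => u x * g (u x)) Ω ∧
    (∫ x in Ω, ‖V x‖ ^ p) + (∫ x in Ω, ‖V x‖ ^ q) = ∫ x in Ω, u x * g (u x) := by
  have hp := hq.trans hqp
  obtain ⟨h1, h2⟩ := hu.2 u V hu.1
  have hug : IntegrableOn (fun x => u x * g (u x)) Ω := by simpa only [mul_comm] using h1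
  have hVp := integrableOn_norm_rpow_of_memLp hΩb (by linarith) le_rfl hu.1.1.2.1
  have hVq := integrableOn_norm_rpow_of_memLp hΩb (by linarith) hqp.le hu.1.1.2.1
  have hVpq : IntegrableOn (fun x => ‖V x‖ ^ p + ‖V x‖ ^ q) Ω := hVp.add hVq
  refine ⟨hug, ?_⟩
  have h3 : ∫ x in Ω, (‖V x‖ ^ p + ‖V x‖ ^ q - u x * g (u x)) = 0 := by
    rw [← h2]
    congr 1
    ext x
    rw [real_inner_self_eq_norm_sq, rpow_sub_two_mul_sq (norm_nonneg _) hp,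
      rpow_sub_two_mul_sq (norm_nonneg _) hq, mul_comm (u x)]
  rw [integral_sub hVpq hug, integral_add hVp hVq] at h3
  linarith

end Pohozaev

theorem theorem1p6 (N : ℕ) (p q : ℝ) (hq : 1 < q) (hqp : q < p) (hpN : p < N)
    (Ω : Set (EuclideanSpace ℝ (Fin N)))
    (hΩ_open : IsOpen Ω) (hΩ_conn : IsConnected Ω) (hΩ_bdd : Bornology.IsBounded Ω)
    (hΩ_C1 : HasC1Boundary Ω)
    (g : ℝ → ℝ) (hg : Continuous g)
    (u : EuclideanSpace ℝ (Fin N) → ℝ)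
    (Du : EuclideanSpace ℝ (Fin N) → EuclideanSpace ℝ (Fin N))
    (hu_zero : MemW1Zero Ω (ENNReal.ofReal p) u Du)
    (hu_two : MemW2 Ω (ENNReal.ofReal p) u)
    (hu_sol : IsWeakSolution Ω p q g u Du) :
    IntegrableOn (fun x => ‖Du x‖ ^ q) Ω ∧
    IntegrableOn (fun x => primitive g (u x)) Ω ∧
    IntegrableOn (fun x => u x * g (u x)) Ω ∧
    (∃ dnu : EuclideanSpace ℝ (Fin N) → ℝ,
      IsNormalDerivative Ω (ENNReal.ofReal p) Du dnu) ∧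
    ∀ dnu : EuclideanSpace ℝ (Fin N) → ℝ,
      IsNormalDerivative Ω (ENNReal.ofReal p) Du dnu →
      Integrable (fun x => ((1 - 1 / p) * |dnu x| ^ p + (1 - 1 / q) * |dnu x| ^ q) *
        inner ℝ x (exteriorNormal Ω x)) (surfaceMeasure Ω) ∧
      (1 / q - 1 / p) * (∫ x in Ω, ‖Du x‖ ^ q)
        - (∫ x in Ω, (primitive g (u x) - 1 / criticalExponent N p * (u x * g (u x))))
        + 1 / N * (∫ x, ((1 - 1 / p) * |dnu x| ^ p + (1 - 1 / q) * |dnu x| ^ q) *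
          inner ℝ x (exteriorNormal Ω x) ∂(surfaceMeasure Ω)) = 0 := by
  have hp := hq.trans hqp
  have hP1 : 1 ≤ ENNReal.ofReal p := by rw [ENNReal.one_le_ofReal]; exact hp.le
  have hN0 : (0 : ℝ) < N := by linarith
  have hN : 0 < N := by exact_mod_cast hN0
  obtain ⟨Dv, hDv, hH'⟩ := hu_two
  choose H hH using hH'
  have hV : ∀ i, MemW1 Ω (ENNReal.ofReal p) (fun x => Du x i) (H i) := by
    intro i
    -- The weak gradient supplied by W^{2,p} membership agrees almost everywhere with the given one.
    refine (hH i).congr_ae hΩ_bdd hP1 ?_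
    filter_upwards [hDv.2.2.ae_eq hΩ_open hu_zero.1.2.2] with x hx
    rw [hx]
  choose T hT using fun i => hΩ_C1.exists_isTrace hΩ_open hΩ_bdd hp (hV i)
  have hD₀ : ∀ i, IsTrace Ω (ENNReal.ofReal p) (fun x => Du x i)
      (fun x => (WithLp.toLp 2 fun i => T i x : EuclideanSpace ℝ (Fin N)) i) := hT
  have hgV := hu_sol.integrableOn_smul_gradient hΩ_C1 hΩ_open hΩ_bdd hq hqp hg hV hD₀
  obtain ⟨hGint, hG⟩ := hu_zero.integral_primitive hΩ_open hΩ_bdd hp.le hN hg hgV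
  obtain ⟨hug, hen⟩ := hu_sol.integral_norm_rpow_add hΩ_bdd hq hqp
  refine ⟨integrableOn_norm_rpow_of_memLp hΩ_bdd (by linarith) hqp.le hu_zero.1.2.1, hGint, hug,
    ⟨_, _, hD₀, Filter.Eventually.of_forall fun x => rfl⟩, ?_⟩
  -- Each normal derivative brings its own trace D, so uniqueness of traces is not needed.
  rintro dnu ⟨D, hD, hdnu⟩
  obtain ⟨hbi, hb⟩ := hΩ_C1.pohozaev_identity hΩ_open hΩ_bdd hq hqp hu_zero hV hD hdnu
  refine ⟨hbi, ?_⟩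
  have hB : ∫ x in Ω, ∑ i, pohozaevDiv p q Du H i x * x i
      = N * ∫ x in Ω, primitive g (u x) := by
    rw [hG, ← integral_neg]
    refine integral_congr_ae ?_
    filter_upwards [ae_all_iff.2 fun i =>
      hu_sol.pohozaevDiv_eq hΩ_C1 hΩ_open hΩ_bdd hq hqp hV hD i] with x hx
    rw [← sum_coord_mul_coord, Finset.mul_sum, ← Finset.sum_neg_distrib]
    refine Finset.sum_congr rfl fun i _ => ?_
    rw [hx i]
    ring
  -- The energy identity eliminates ∫ u g(u); what remains is algebra in ∫|∇u|^p, ∫|∇u|^q and ∫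
  -- G(u), in which the first cancels because 1/p* = 1/p - 1/N.
  rw [← hb, hB, integral_sub hGint (hug.const_mul _), integral_const_mul, criticalExponent, ← hen]
  have hp0 : p ≠ 0 := by linarith
  have hq0 : q ≠ 0 := by linarith
  have hNp : (N : ℝ) - p ≠ 0 := by linarith
  field_simp
  ring
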